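/- Let $A:\mathbb{R}^3\to\mathbb{R}^3$ and $V:\mathbb{R}^3\to\mathbb{R}$ satisfy $A\in L^{q}+L^\infty$ for some $q>3$, $\nabla\cdot A\in L^2+L^\infty$ (in the weak sense), $V\in L^2+L^\infty$, and, for some $q>3$ and with $V_-=\max(-V,0)$, $$\|A\|_{(L^q+L^\infty)(|x|>R)}+\|V_-\|_{(L^2+L^\infty)(|x|>R)}\to 0\quad\text{as } R\to\infty .$$ Let $H=-\Delta+2iA\cdot\nabla+i(\nabla\cdot A)+V$ on $H^2(\mathbb{R}^3;\mathbb{C})$, and let $e_0<0$ be a nondegenerate eigenvalue of $H$ with eigenfunction $\phi_0\in H^2$, $\|\phi_0\|_{L^2}=1$. Let $g(\psi)=\sigma|\psi|^2\psi$ with $\sigma\in\{1,-1\}$. Then there are $\delta>0$, $\beta>0$ and maps $z\mapsto Q[z]\in H^2$ and $z\mapsto E[z]\in\mathbb{R}$ such that, for all $z=z_1+iz_2\in\mathbb{C}$ with $|z|<\delta$, $$HQ[z]+g(Q[z])=E[z]\,Q[z],\qquad Q[z]\neq 0\ \text{ if } z\neq0,$$ the map $Q$ is twice continuously differentiable in $(z_1,z_2)$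 on $|z|<\delta$ as a map into $H^2$, and, as $z\to0$, $E[z]=e_0+o(z)$, $Q[z]=z\phi_0+q(z)$ with $$q(z)=o(z^2),\qquad \left(\tfrac{\partial Q}{\partial z_1}[z],\tfrac{\partial Q}{\partial z_2}[z]\right)=(1,i)\,\phi_0+o(z),\qquad \frac{\partial^2 Q}{\partial z_j\partial z_k}[z]=o(1)\ \ (j,k\in\{1,2\})\quad\text{in } H^2 .$$ Furthermore, for all $|z|<\delta$, $e^{\beta|x|}Q[z]\in H^1\cap L^\infty$, where $\beta$ does not depend on $z$. -/

import Mathlib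

open MeasureTheory Set Filter Topology Asymptotics
open scoped ENNReal

namespace MagneticNLS

noncomputable section

/-- Physical space `ℝ³` with its Euclidean norm. -/
abbrev E3 : Type := EuclideanSpace ℝ (Fin 3)

/-- The Hilbert space `L²(ℝ³; ℂ)`. -/
abbrev L2 : Type := Lp ℂ 2 (volume : Measure E3)

/-- The `j`-th standard unit vector of `ℝ³`. -/
def basisVec (j : Fin 3) : E3 := EuclideanSpace.single j 1

/-- `v` is the weak partial derivative `∂_j u` on `ℝ³`: both are locally integrable and
`∫ (∂_j η) u = - ∫ η v` for every test function `η ∈ C_c^∞(ℝ³)`. -/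
def HasWeakPartial (j : Fin 3) (u v : E3 → ℂ) : Prop :=
  LocallyIntegrable u volume ∧ LocallyIntegrable v volume ∧
    ∀ η : E3 → ℝ, ContDiff ℝ (⊤ : ℕ∞) η → HasCompactSupport η →
      ∫ x, fderiv ℝ η x (basisVec j) • u x = - ∫ x, η x • v x

/-- `d` is the weak divergence `∇ · A` of the vector field `A`: both are locally integrable and
`∫ A · ∇η = - ∫ η d` for every test function `η ∈ C_c^∞(ℝ³)`. -/
def HasWeakDiv (A : E3 → E3) (d : E3 → ℝ) : Prop :=
  LocallyIntegrable A volume ∧ LocallyIntegrable d volume ∧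
    ∀ η : E3 → ℝ, ContDiff ℝ (⊤ : ℕ∞) η → HasCompactSupport η →
      ∫ x, fderiv ℝ η x (A x) = - ∫ x, η x * d x

theorem integrable_fderiv_smul {η : E3 → ℝ} (hη : ContDiff ℝ (⊤ : ℕ∞) η)
    (hc : HasCompactSupport η) (e : E3) {u : E3 → ℂ} (hu : LocallyIntegrable u volume) :
    Integrable (fun x => fderiv ℝ η x e • u x) volume :=
  hu.integrable_smul_left_of_hasCompactSupport
    ((hη.continuous_fderiv (by simp)).clm_apply continuous_const) (hc.fderiv_apply (𝕜 := ℝ) e)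

theorem HasWeakPartial.congr {j : Fin 3} {u v u' v' : E3 → ℂ} (h : HasWeakPartial j u v)
    (hu : u =ᵐ[volume] u') (hv : v =ᵐ[volume] v') : HasWeakPartial j u' v' := by
  refine ⟨(locallyIntegrable_congr hu).1 h.1, (locallyIntegrable_congr hv).1 h.2.1, ?_⟩
  intro η hη hc
  have h1 : ∫ x, fderiv ℝ η x (basisVec j) • u x = ∫ x, fderiv ℝ η x (basisVec j) • u' x :=
    integral_congr_ae (hu.mono fun x hx => by simp only [hx])
  have h2 : ∫ x, η x • v x = ∫ x, η x • v' x :=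
    integral_congr_ae (hv.mono fun x hx => by simp only [hx])
  rw [← h1, ← h2]
  exact h.2.2 η hη hc

theorem HasWeakPartial.zero (j : Fin 3) : HasWeakPartial j 0 0 :=
  ⟨locallyIntegrable_zero, locallyIntegrable_zero, fun η _ _ => by simp⟩

theorem HasWeakPartial.add {j : Fin 3} {u v u' v' : E3 → ℂ} (h : HasWeakPartial j u v)
    (h' : HasWeakPartial j u' v') : HasWeakPartial j (u + u') (v + v') := by
  refine ⟨h.1.add h'.1, h.2.1.add h'.2.1, ?_⟩
  intro η hη hc
  simp only [Pi.add_apply, smul_add]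
  rw [integral_add (integrable_fderiv_smul hη hc _ h.1) (integrable_fderiv_smul hη hc _ h'.1),
    integral_add (h.2.1.integrable_smul_left_of_hasCompactSupport hη.continuous hc)
      (h'.2.1.integrable_smul_left_of_hasCompactSupport hη.continuous hc),
    h.2.2 η hη hc, h'.2.2 η hη hc, neg_add]

theorem HasWeakPartial.const_smul {j : Fin 3} {u v : E3 → ℂ} (c : ℂ) (h : HasWeakPartial j u v) :
    HasWeakPartial j (c • u) (c • v) := by
  refine ⟨h.1.smul c, h.2.1.smul c, ?_⟩
  intro η hη hc
  simp only [Pi.smul_apply, smul_comm _ c]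
  rw [integral_smul, integral_smul, h.2.2 η hη hc, smul_neg]

/-- Index set of the weak derivatives of order at most two: the function itself, the first
derivatives `∂_i`, and the second derivatives `∂_j ∂_i`. -/
abbrev JetIndex : Type := Unit ⊕ Fin 3 ⊕ (Fin 3 × Fin 3)

/-- The Sobolev space `H²(ℝ³; ℂ)`. An element is a function `u ∈ L²` together with its weak
derivatives of order one and two, all in `L²` (they are determined by `u`). The inherited norm is
`‖u‖²_{H²} = ‖u‖² + ∑ ‖∂_i u‖² + ∑ ‖∂_j ∂_i u‖²`, with `L²` norms on the right. -/
def H2Submodule : Submodule ℂ (PiLp 2 (fun _ : JetIndex => L2)) where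
  carrier := {w | (∀ i : Fin 3, HasWeakPartial i (w (.inl ())) (w (.inr (.inl i)))) ∧
    ∀ i j : Fin 3, HasWeakPartial j (w (.inr (.inl i))) (w (.inr (.inr (i, j))))}
  zero_mem' := by
    have h0 : ((0 : L2) : E3 → ℂ) =ᵐ[volume] 0 := Lp.coeFn_zero ℂ 2 volume
    exact ⟨fun i => (HasWeakPartial.zero i).congr h0.symm h0.symm,
      fun i j => (HasWeakPartial.zero j).congr h0.symm h0.symm⟩
  add_mem' := by
    intro a b ha hb
    exact ⟨fun i => ((ha.1 i).add (hb.1 i)).congr (Lp.coeFn_add _ _).symm (Lp.coeFn_add _ _).symm,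
      fun i j => ((ha.2 i j).add (hb.2 i j)).congr (Lp.coeFn_add _ _).symm
        (Lp.coeFn_add _ _).symm⟩
  smul_mem' := by
    intro c a ha
    exact ⟨fun i => ((ha.1 i).const_smul c).congr (Lp.coeFn_smul _ _).symm
        (Lp.coeFn_smul _ _).symm,
      fun i j => ((ha.2 i j).const_smul c).congr (Lp.coeFn_smul _ _).symm
        (Lp.coeFn_smul _ _).symm⟩

/-- `H²(ℝ³; ℂ)` as a normed space. -/
abbrev H2 : Type := H2Submodule

/-- The underlying element of `L²`. -/
def H2.toL2 (u : H2) : L2 := u.1 (.inl ())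

/-- The underlying function, defined almost everywhere. -/
def H2.fn (u : H2) : E3 → ℂ := u.toL2

/-- The weak derivative `∂_i u`. -/
def H2.grad (u : H2) (i : Fin 3) : E3 → ℂ := u.1 (.inr (.inl i))

/-- The weak second derivative `∂_j ∂_i u`. -/
def H2.hess (u : H2) (i j : Fin 3) : E3 → ℂ := u.1 (.inr (.inr (i, j)))

/-- The operator `H = -Δ + 2 i A · ∇ + i (∇ · A) + V` on `H²`; `divA` stands for `∇ · A`. -/
def magH (A : E3 → E3) (divA V : E3 → ℝ) (u : H2) : E3 → ℂ := fun x =>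
  - (∑ j, u.hess j j x) + 2 * Complex.I * (∑ j, (A x j : ℂ) * u.grad j x)
    + Complex.I * (divA x : ℂ) * u.fn x + (V x : ℂ) * u.fn x

/-- `f ∈ L^p + L^r`. -/
def MemLpAdd {F : Type*} [NormedAddCommGroup F] (f : E3 → F) (p r : ℝ≥0∞) (μ : Measure E3) :
    Prop :=
  ∃ g h : E3 → F, MemLp g p μ ∧ MemLp h r μ ∧ f =ᵐ[μ] g + h

/-- The norm of `L^p + L^r`: the infimum of `‖g‖_p + ‖h‖_r` over all decompositions
`f = g + h`. -/
def eLpAddNorm {F : Type*} [NormedAddCommGroup F] (f : E3 → F) (p r : ℝ≥0∞) (μ : Measure E3) :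
    ℝ≥0∞ :=
  sInf {t | ∃ g h : E3 → F, MemLp g p μ ∧ MemLp h r μ ∧ f =ᵐ[μ] g + h ∧
    t = eLpNorm g p μ + eLpNorm h r μ}

/-- Lebesgue measure on the exterior region `|x| > R`. -/
def exterior (R : ℝ) : Measure E3 := volume.restrict {x | R < ‖x‖}

/-- Standing assumption for self-adjointness: `A ∈ L^q + L^∞` for some `q > 3`, the weak
divergence `divA = ∇ · A` exists and lies in `L² + L^∞`, and `V ∈ L² + L^∞`. -/
def SelfAdjointAssumption (A : E3 → E3) (divA V : E3 → ℝ) : Prop :=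
  (∃ q : ℝ≥0∞, 3 < q ∧ MemLpAdd A q ⊤ volume) ∧
    HasWeakDiv A divA ∧ MemLpAdd divA 2 ⊤ volume ∧ MemLpAdd V 2 ⊤ volume

/-- Decay assumption: for some `q > 3`,
`‖A‖_{(L^q + L^∞)(|x| > R)} + ‖V₋‖_{(L² + L^∞)(|x| > R)} → 0` as `R → ∞`, where
`V₋ = max (-V) 0`. -/
def DecayAssumption (A : E3 → E3) (V : E3 → ℝ) : Prop :=
  ∃ q : ℝ≥0∞, 3 < q ∧
    Tendsto (fun R : ℝ => eLpAddNorm A q ⊤ (exterior R) +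
      eLpAddNorm (fun x => max (- V x) 0) 2 ⊤ (exterior R)) atTop (𝓝 0)

/-- `f ∈ H¹(ℝ³; ℂ)`: `f` and its weak first derivatives lie in `L²`. -/
def MemH1 (f : E3 → ℂ) : Prop :=
  MemLp f 2 volume ∧ ∀ j : Fin 3, ∃ v : E3 → ℂ, MemLp v 2 volume ∧ HasWeakPartial j f v

/-- The two real coordinate directions `1, i` of the parameter `z = z₁ + i z₂`. -/
def dir : Fin 2 → ℂ := ![1, Complex.I]

/-- The real partial derivative `∂ Q / ∂ z_k` of an `H²`-valued map, taken in the norm of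
`H²`; `k = 0` is `z₁` and `k = 1` is `z₂`. -/
def DQ (k : Fin 2) (Q : ℂ → H2) (z : ℂ) : H2 := lineDeriv ℝ Q z (dir k)

end

end MagneticNLS

open MagneticNLS

/-!
The nonlinear bound states bifurcate from the eigenvalue `e₀` by the implicit function theorem, and
their exponential decay is that of solutions of a Schrödinger equation below the essential spectrum.

**The operator.** On the Fourier side `H²` is the image of `L²` under `(1 - Δ)⁻¹`, whose kernel is
square integrable in dimension three; this gives the embeddings of `H²` in `L^∞`
(`eLpNorm_top_le`) and, together with the Sobolev inequality, in `W^{1,6}`, as well as the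
compactness of restriction to balls (`isCompactOperator_ballCLM_resolvent`). Since
`A ∈ L^q + L^∞` with `q > 3`, Hölder's inequality `L³ · L⁶ ⊂ L²` shows that all lower-order terms
have relative bound zero with respect to the Laplacian (`exists_norm_lowerOp_le`), so that `H` is a
bounded operator from `H²` to `L²`. It is symmetric by the definition of the weak divergence
(`inner_magOp`).

**Fredholm property.** As `A` and `V₋` decay at infinity, only their part in a ball matters for the
quadratic form, and adding a large multiple `W` of the indicator function of a ball makes `H - e₀`
coercive (`exists_le_re_inner_magOp`) and, by the method of continuity, invertible
(`exists_wellOp_equiv`). The term added is relatively compact, so the Fredholm alternative applies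
to `H - e₀`, and nondegeneracy makes `H - e₀ + |φ₀⟩⟨φ₀|` an isomorphism
(`SimpleEigenvalue.exists_linOp_equiv`).

**The branch.** By gauge covariance the equation for `Q = z (φ₀ + η)` and `E = e₀ + ν` only depends
on `s = |z|²`, namely `(H - e₀) η + s σ |φ₀ + η|² (φ₀ + η) = ν (φ₀ + η)` with `η ⟂ φ₀`. The cubic
term is smooth on `H²` over the reals, and the linearization at `s = 0` is the isomorphism above, so
there is a branch `η(s)`, `ν(s)` of class `C²` with `η(0) = 0` and `ν(0) = 0`
(`SimpleEigenvalue.exists_branch`). The energy is real because `H` is symmetric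
(`im_eq_zero_of_bound_state`). The expansions at `z = 0` hold because `F z = η(|z|²)` is `C²` and
`o(z)` (`isLittleO_lineDeriv_smul_add`, `tendsto_lineDeriv_lineDeriv_smul_add`).

**Decay.** The equation for a small bound state reads `S Q = W 1_{|x| < R} Q`, where
`S = H + W 1_{|x| < R} - E + σ |Q|²` is a small perturbation of the invertible operator above.
Conjugating `S` by the weight `exp (-β √(1 + |x|²))` changes it by `O(β)` (`magOp_conjH2`), so for
small `β` the conjugated operator is invertible too. The right-hand side has bounded support, so it
is the weight times some `f ∈ L²`, and solving the conjugated equation for `f` gives, by uniqueness,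
`Q = exp (-β √(1 + |x|²)) v` with `v ∈ H²` (`exists_conjH2_eq`). Neither `β` nor the smallness
conditions depend on `z`. Replacing `√(1 + |x|²)` by `|x|` costs a bounded Lipschitz factor
(`HasWeakPartial.ratio_smul`).
-/

namespace MagneticNLS

open scoped SchwartzMap LineDeriv FourierTransform

noncomputable section

/-! ### Test functions are dense in the Schwartz space -/

/-- A cutoff function minus one is bounded together with each of its derivatives. -/
theorem exists_iteratedFDeriv_bound (χ : ContDiffBump (0 : E3)) (i : ℕ) :
    ∃ B : ℝ, 0 ≤ B ∧ ∀ y, ‖iteratedFDeriv ℝ i (fun y => χ y - 1) y‖ ≤ B := by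
  have hc : HasCompactSupport (iteratedFDeriv ℝ i χ) := χ.hasCompactSupport.iteratedFDeriv i
  have hcont : Continuous (iteratedFDeriv ℝ i χ) :=
    (χ.contDiff (n := (⊤ : ℕ∞))).continuous_iteratedFDeriv (mod_cast le_top)
  obtain ⟨B, hB⟩ := hc.exists_bound_of_continuous hcont
  have hB1 : ∀ y, ‖iteratedFDeriv ℝ i (fun _ : E3 => (1 : ℝ)) y‖ ≤ 1 := by
    intro y
    rcases Nat.eq_zero_or_pos i with rfl | hi
    · simp
    · rw [iteratedFDeriv_const_of_ne hi.ne']; simp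
  refine ⟨B + 1, by linarith [norm_nonneg (iteratedFDeriv ℝ i χ 0), hB 0], fun y => ?_⟩
  rw [fun_iteratedFDeriv_sub_apply (χ.contDiff.contDiffAt) contDiffAt_const]
  exact (norm_sub_le _ _).trans (add_le_add (hB y) (hB1 y))

set_option maxHeartbeats 1000000 in
/-- Cutting off a Schwartz function at radius `n` gives compactly supported functions converging to
it in the Schwartz topology. -/
theorem exists_seq_hasCompactSupport_tendsto (φ : 𝓢(E3, ℂ)) :
    ∃ ψ : ℕ → 𝓢(E3, ℂ), (∀ n, HasCompactSupport (ψ n)) ∧ Tendsto ψ atTop (𝓝 φ) := by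
  let χ : ContDiffBump (0 : E3) := ⟨1, 2, one_pos, one_lt_two⟩
  let c : ℕ → ℝ := fun n => 1 / ((n : ℝ) + 1)
  have hc0 : ∀ n, 0 < c n := fun n => by positivity
  have hc1 : ∀ n, c n ≤ 1 := fun n => by
    simp only [c]; rw [div_le_one (by positivity)]; linarith [n.cast_nonneg (α := ℝ)]
  have hsm : ∀ n, ContDiff ℝ (⊤ : ℕ∞) (fun x : E3 => χ (c n • x) • φ x) := fun n =>
    (χ.contDiff.comp (contDiff_const_smul (c n))).smul (φ.smooth ⊤)
  have hcs : ∀ n, HasCompactSupport (fun x : E3 => χ (c n • x) • φ x) := fun n =>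
    HasCompactSupport.smul_right (χ.hasCompactSupport.comp_smul (hc0 n).ne')
  let ψ : ℕ → 𝓢(E3, ℂ) := fun n => (hcs n).toSchwartzMap (hsm n)
  refine ⟨ψ, fun n => hcs n, ?_⟩
  rw [(schwartz_withSeminorms ℝ E3 ℂ).tendsto_nhds_atTop]
  rintro ⟨k, m⟩ ε hε
  choose B hB0 hB using exists_iteratedFDeriv_bound χ
  choose C hC0 hC using fun l => φ.decay (k + 1) l
  let D : ℝ := ∑ i ∈ Finset.range (m + 1), (m.choose i : ℝ) * B i * C (m - i)
  have hD : 0 ≤ D := Finset.sum_nonneg fun i _ =>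
    mul_nonneg (mul_nonneg (Nat.cast_nonneg _) (hB0 i)) (hC0 _).le
  have key : ∀ n, SchwartzMap.seminorm ℝ k m (ψ n - φ) ≤ c n * D := by
    intro n
    refine SchwartzMap.seminorm_le_bound ℝ k m _ (mul_nonneg (hc0 n).le hD) fun x => ?_
    have heq : (⇑(ψ n - φ) : E3 → ℂ) = fun x => (χ (c n • x) - 1) • φ x := by
      ext x
      simp [ψ, sub_mul]
    rw [heq]
    have hh : ContDiff ℝ (⊤ : ℕ∞) (fun x : E3 => χ x - 1) := χ.contDiff.sub contDiff_const
    -- the difference vanishes for `|x| < 1 / c n`; elsewhere `1 ≤ c n |x|`, and the spare factor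
    -- `|x|` is absorbed by the next seminorm of `φ`
    by_cases hx : ‖c n • x‖ < 1
    · have hev : (fun x : E3 => (χ (c n • x) - 1) • φ x) =ᶠ[𝓝 x] fun _ => 0 := by
        have : ∀ᶠ y in 𝓝 x, ‖c n • y‖ < 1 :=
          (continuous_norm.comp (continuous_const_smul (c n))).continuousAt.eventually_lt
            continuousAt_const hx
        filter_upwards [this] with y hy
        have : χ (c n • y) = 1 := χ.one_of_mem_closedBall (by simpa using hy.le)
        simp [this]
      rw [(hev.iteratedFDeriv ℝ m).eq_of_nhds]
      have : iteratedFDeriv ℝ m (fun _ : E3 => (0 : ℂ)) x = 0 := by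
        have := iteratedFDeriv_fun_zero (𝕜 := ℝ) (E := E3) (F := ℂ) (n := m)
        exact congrFun this x
      rw [this]
      simpa using mul_nonneg (hc0 n).le hD
    · push Not at hx
      rw [norm_smul, Real.norm_of_nonneg (hc0 n).le] at hx
      have h1 := norm_iteratedFDeriv_smul_le (𝕜 := ℝ) (N := ((⊤ : ℕ∞) : WithTop ℕ∞))
        (hh.comp (contDiff_const_smul (c n))) (φ.smooth ⊤) x (n := m) (mod_cast le_top)
      calc ‖x‖ ^ k * ‖iteratedFDeriv ℝ m (fun x => (χ (c n • x) - 1) • φ x) x‖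
          ≤ ‖x‖ ^ k * ∑ i ∈ Finset.range (m + 1), (m.choose i : ℝ) *
            ‖iteratedFDeriv ℝ i ((fun x => χ x - 1) ∘ fun x => c n • x) x‖ *
              ‖iteratedFDeriv ℝ (m - i) φ x‖ := by gcongr; exact h1
        _ = ∑ i ∈ Finset.range (m + 1), (m.choose i : ℝ) *
            ‖iteratedFDeriv ℝ i ((fun x => χ x - 1) ∘ fun x => c n • x) x‖ *
              (‖x‖ ^ k * ‖iteratedFDeriv ℝ (m - i) φ x‖) := by
            rw [Finset.mul_sum]; exact Finset.sum_congr rfl fun i _ => by ring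
        _ ≤ ∑ i ∈ Finset.range (m + 1), (m.choose i : ℝ) * B i * (c n * C (m - i)) := by
            refine Finset.sum_le_sum fun i _ => ?_
            have e1 : ‖iteratedFDeriv ℝ i ((fun x => χ x - 1) ∘ fun x => c n • x) x‖ ≤ B i := by
              have := congrFun (iteratedFDeriv_comp_const_smul (i := i) (c n)
                (hh.of_le (mod_cast le_top))) x
              simp only [Function.comp_def]
              rw [this, norm_smul, norm_pow, Real.norm_of_nonneg (hc0 n).le]
              calc c n ^ i * _ ≤ 1 * B i := by
                    gcongr
                    · exact pow_le_one₀ (hc0 n).le (hc1 n)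
                    · exact hB i _
                _ = B i := one_mul _
            have e2 : ‖x‖ ^ k * ‖iteratedFDeriv ℝ (m - i) φ x‖ ≤ c n * C (m - i) := by
              calc ‖x‖ ^ k * ‖iteratedFDeriv ℝ (m - i) φ x‖
                  ≤ (c n * ‖x‖) * (‖x‖ ^ k * ‖iteratedFDeriv ℝ (m - i) φ x‖) :=
                    le_mul_of_one_le_left (by positivity) hx
                _ = c n * (‖x‖ ^ (k + 1) * ‖iteratedFDeriv ℝ (m - i) φ x‖) := by ring
                _ ≤ _ := by gcongr; exact hC _ x
            gcongr
            exact mul_nonneg (Nat.cast_nonneg _) (hB0 i)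
        _ = c n * D := by
            simp only [D]; rw [Finset.mul_sum]; exact Finset.sum_congr rfl fun i _ => by ring
  have hlim : Tendsto (fun n => c n * D) atTop (𝓝 0) := by
    simpa only [zero_mul] using
      (tendsto_one_div_add_atTop_nhds_zero_nat (𝕜 := ℝ)).mul_const D
  obtain ⟨N, hN⟩ := ((tendsto_order.1 hlim).2 ε hε).exists_forall_of_atTop
  exact ⟨N, fun n hn => (key n).trans_lt (hN n hn)⟩

/-! ### Weak derivatives on the Fourier side -/

/-- A Schwartz function as an element of `L²`. -/
def schwartzL2 : 𝓢(E3, ℂ) →L[ℂ] L2 := SchwartzMap.toLpCLM ℂ ℂ 2 volume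

theorem coeFn_schwartzL2 (φ : 𝓢(E3, ℂ)) : (schwartzL2 φ : E3 → ℂ) =ᵐ[volume] φ :=
  φ.coeFn_toLp 2 volume

theorem denseRange_schwartzL2 : DenseRange schwartzL2 :=
  SchwartzMap.denseRange_toLpCLM ENNReal.ofNat_ne_top

theorem fourier_schwartzL2 (φ : 𝓢(E3, ℂ)) : 𝓕 (schwartzL2 φ) = schwartzL2 (𝓕 φ) :=
  φ.toLp_fourier_eq

theorem inner_schwartzL2 (φ : 𝓢(E3, ℂ)) (u : L2) :
    inner ℂ (schwartzL2 φ) u = ∫ x, (starRingEnd ℂ) (φ x) * u x := by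
  rw [L2.inner_def]
  refine integral_congr_ae ?_
  filter_upwards [coeFn_schwartzL2 φ] with x hx
  rw [hx, RCLike.inner_apply, mul_comm]

theorem L2.locallyIntegrable (u : L2) : LocallyIntegrable (u : E3 → ℂ) volume :=
  (Lp.memLp u).locallyIntegrable one_le_two

theorem fderiv_ofReal_comp {η : E3 → ℝ} (hη : ContDiff ℝ (⊤ : ℕ∞) η) (x e : E3) :
    fderiv ℝ (fun x => (η x : ℂ)) x e = (fderiv ℝ η x e : ℂ) := by
  have h := (Complex.ofRealCLM.hasFDerivAt (x := η x)).comp x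
    ((hη.differentiable (by simp)) x).hasFDerivAt
  have h2 : fderiv ℝ (fun x => (η x : ℂ)) x = Complex.ofRealCLM.comp (fderiv ℝ η x) := h.fderiv
  rw [h2]; rfl

/-- A real test function as a complex-valued Schwartz function. -/
def realTest {η : E3 → ℝ} (hη : ContDiff ℝ (⊤ : ℕ∞) η) (hc : HasCompactSupport η) : 𝓢(E3, ℂ) :=
  HasCompactSupport.toSchwartzMap (f := fun x => (η x : ℂ))
    (hc.comp_left (g := Complex.ofReal) rfl) (Complex.ofRealCLM.contDiff.comp hη)

theorem realTest_apply {η : E3 → ℝ} (hη : ContDiff ℝ (⊤ : ℕ∞) η) (hc : HasCompactSupport η)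
    (x : E3) : realTest hη hc x = η x := rfl

theorem lineDerivOp_realTest_apply {η : E3 → ℝ} (hη : ContDiff ℝ (⊤ : ℕ∞) η)
    (hc : HasCompactSupport η) (e x : E3) : (∂_{e} (realTest hη hc)) x = (fderiv ℝ η x e : ℂ) := by
  rw [SchwartzMap.lineDerivOp_apply_eq_fderiv]
  exact fderiv_ofReal_comp hη x e

/-- The real and imaginary parts of a compactly supported Schwartz function are test functions. -/
theorem exists_realTest_add (φ : 𝓢(E3, ℂ)) (hφ : HasCompactSupport φ) :
    ∃ (a b : E3 → ℝ) (ha : ContDiff ℝ (⊤ : ℕ∞) a) (hac : HasCompactSupport a)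
      (hb : ContDiff ℝ (⊤ : ℕ∞) b) (hbc : HasCompactSupport b),
      φ = realTest ha hac + Complex.I • realTest hb hbc := by
  refine ⟨fun x => (φ x).re, fun x => (φ x).im, Complex.reCLM.contDiff.comp (φ.smooth ⊤),
    hφ.comp_left (g := Complex.re) rfl, Complex.imCLM.contDiff.comp (φ.smooth ⊤),
    hφ.comp_left (g := Complex.im) rfl, ?_⟩
  ext x
  simp only [add_apply, smul_apply, smul_eq_mul]
  rw [mul_comm]
  exact (Complex.re_add_im (φ x)).symm

theorem inner_realTest {η : E3 → ℝ} (hη : ContDiff ℝ (⊤ : ℕ∞) η) (hc : HasCompactSupport η)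
    (u : L2) : inner ℂ (schwartzL2 (realTest hη hc)) u = ∫ x, η x • u x := by
  rw [inner_schwartzL2]
  simp [realTest_apply]

theorem inner_lineDerivOp_realTest {η : E3 → ℝ} (hη : ContDiff ℝ (⊤ : ℕ∞) η)
    (hc : HasCompactSupport η) (e : E3) (u : L2) :
    inner ℂ (schwartzL2 (∂_{e} (realTest hη hc))) u = ∫ x, fderiv ℝ η x e • u x := by
  rw [inner_schwartzL2]
  simp [lineDerivOp_realTest_apply]

/-- For two functions in `L²`, weak differentiability can be tested against Schwartz functions. -/
theorem hasWeakPartial_iff_inner (j : Fin 3) (u v : L2) :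
    HasWeakPartial j u v ↔ ∀ φ : 𝓢(E3, ℂ),
      inner ℂ (schwartzL2 (∂_{basisVec j} φ)) u = - inner ℂ (schwartzL2 φ) v := by
  constructor
  · intro h
    have hcs : ∀ φ : 𝓢(E3, ℂ), HasCompactSupport φ →
        inner ℂ (schwartzL2 (∂_{basisVec j} φ)) u = - inner ℂ (schwartzL2 φ) v := by
      intro φ hφ
      obtain ⟨a, b, ha, hac, hb, hbc, rfl⟩ := exists_realTest_add φ hφ
      have e1 := h.2.2 a ha hac
      have e2 := h.2.2 b hb hbc
      rw [← inner_lineDerivOp_realTest ha hac, ← inner_realTest ha hac] at e1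
      rw [← inner_lineDerivOp_realTest hb hbc, ← inner_realTest hb hbc] at e2
      simp only [LineDeriv.lineDerivOp_add, LineDeriv.lineDerivOp_smul, map_add, map_smul,
        inner_add_left, inner_smul_left, e1, e2]
      ring
    intro φ
    obtain ⟨ψ, hψ, hlim⟩ := exists_seq_hasCompactSupport_tendsto φ
    have c1 : Continuous fun φ : 𝓢(E3, ℂ) =>
        (inner ℂ (schwartzL2 (∂_{basisVec j} φ)) u : ℂ) := by
      have : Continuous fun φ : 𝓢(E3, ℂ) => ∂_{basisVec j} φ :=
        (LineDeriv.lineDerivOpCLM ℂ 𝓢(E3, ℂ) (basisVec j)).continuous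
      exact (schwartzL2.continuous.comp this).inner continuous_const
    have c2 : Continuous fun φ : 𝓢(E3, ℂ) => (- inner ℂ (schwartzL2 φ) v : ℂ) :=
      (schwartzL2.continuous.inner continuous_const).neg
    refine tendsto_nhds_unique ((c1.tendsto φ).comp hlim) ?_
    refine Tendsto.congr (fun n => ?_) ((c2.tendsto φ).comp hlim)
    exact (hcs (ψ n) (hψ n)).symm
  · intro h
    refine ⟨L2.locallyIntegrable u, L2.locallyIntegrable v, fun η hη hc => ?_⟩
    rw [← inner_lineDerivOp_realTest hη hc, ← inner_realTest hη hc]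
    exact h _

theorem inner_basisVec (ξ : E3) (j : Fin 3) : inner ℝ ξ (basisVec j) = ξ j := by
  simp [basisVec, EuclideanSpace.inner_single_right]

theorem hasTemperateGrowth_coord (j : Fin 3) :
    Function.HasTemperateGrowth (fun ξ : E3 => inner ℝ ξ (basisVec j)) :=
  Function.hasTemperateGrowth_inner_left _

theorem fourier_lineDerivOp_apply (j : Fin 3) (φ : 𝓢(E3, ℂ)) (ξ : E3) :
    𝓕 (∂_{basisVec j} φ) ξ = (2 * Real.pi * Complex.I * ξ j) * 𝓕 φ ξ := by
  rw [SchwartzMap.fourier_lineDerivOp_eq]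
  simp only [smul_apply]
  rw [SchwartzMap.smulLeftCLM_apply_apply (hasTemperateGrowth_coord j), inner_basisVec]
  simp [mul_assoc]

/-- The Fourier symbol of `∂_j`. -/
def symb (j : Fin 3) (ξ : E3) : ℂ := 2 * Real.pi * Complex.I * ξ j

theorem conj_symb (j : Fin 3) (ξ : E3) : (starRingEnd ℂ) (symb j ξ) = - symb j ξ := by
  simp [symb, map_ofNat]

theorem continuous_symb (j : Fin 3) : Continuous (symb j) := by
  unfold symb
  fun_prop

theorem locallyIntegrable_symb_mul (j : Fin 3) (u : L2) :
    LocallyIntegrable (fun ξ => symb j ξ * u ξ) volume := by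
  rw [← locallyIntegrableOn_univ]
  exact (L2.locallyIntegrable u).locallyIntegrableOn univ |>.continuousOn_mul
    (continuous_symb j).continuousOn isOpen_univ.isLocallyClosed

/-- Between functions in `L²`, weak differentiation is multiplication by `2πiξ_j` on the Fourier
side. -/
theorem hasWeakPartial_iff_fourier (j : Fin 3) (u v : L2) :
    HasWeakPartial j u v ↔ (𝓕 v : L2) =ᵐ[volume] fun ξ => symb j ξ * (𝓕 u : L2) ξ := by
  rw [hasWeakPartial_iff_inner]
  have h1 : ∀ φ : 𝓢(E3, ℂ), inner ℂ (schwartzL2 (∂_{basisVec j} φ)) u =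
      - ∫ ξ, (starRingEnd ℂ) (𝓕 φ ξ) * (symb j ξ * (𝓕 u : L2) ξ) := by
    intro φ
    rw [← Lp.inner_fourier_eq, fourier_schwartzL2, inner_schwartzL2, ← integral_neg]
    refine integral_congr_ae (ae_of_all _ fun ξ => ?_)
    simp only
    rw [fourier_lineDerivOp_apply, map_mul]
    change (starRingEnd ℂ) (symb j ξ) * _ * _ = _
    rw [conj_symb]; ring
  have h2 : ∀ φ : 𝓢(E3, ℂ), inner ℂ (schwartzL2 φ) v =
      ∫ ξ, (starRingEnd ℂ) (𝓕 φ ξ) * (𝓕 v : L2) ξ := by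
    intro φ
    rw [← Lp.inner_fourier_eq, fourier_schwartzL2, inner_schwartzL2]
  constructor
  · intro h
    have hl : LocallyIntegrable (fun ξ => symb j ξ * (𝓕 u : L2) ξ - (𝓕 v : L2) ξ) volume :=
      (locallyIntegrable_symb_mul j _).sub (L2.locallyIntegrable _)
    have := ae_eq_zero_of_integral_contDiff_smul_eq_zero hl (fun g hg hgc => ?_)
    · filter_upwards [this] with ξ hξ
      exact (sub_eq_zero.1 hξ).symm
    · -- every Schwartz function is the Fourier transform of a Schwartz function
      have e := h (𝓕⁻ (realTest hg hgc))
      rw [h1, h2, neg_inj] at e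
      simp only [FourierTransform.fourier_fourierInv_eq, realTest_apply, Complex.conj_ofReal] at e
      simp only [smul_sub]
      rw [integral_sub]
      · simpa [sub_eq_zero] using e
      · exact (locallyIntegrable_symb_mul j _).integrable_smul_left_of_hasCompactSupport
          hg.continuous hgc
      · exact (L2.locallyIntegrable _).integrable_smul_left_of_hasCompactSupport hg.continuous hgc
  · intro h φ
    rw [h1, h2]
    congr 1
    refine integral_congr_ae ?_
    filter_upwards [h] with ξ hξ
    rw [hξ]

/-! ### The jet maps of `H²` and the resolvent of the Laplacian -/

/-- Multiplication by a function in `L^∞`, as an operator on `L²`. -/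
def mulCLM (m : E3 → ℂ) (hm : MemLp m ⊤ volume) : L2 →L[ℂ] L2 :=
  (ContinuousLinearMap.mul ℂ ℂ).holderL volume ⊤ 2 2 (hm.toLp m)

theorem coeFn_mulCLM {m : E3 → ℂ} (hm : MemLp m ⊤ volume) (u : L2) :
    (mulCLM m hm u : E3 → ℂ) =ᵐ[volume] fun x => m x * u x := by
  have h := (ContinuousLinearMap.mul ℂ ℂ).coeFn_holder (r := 2) (hm.toLp m) u
  filter_upwards [h, hm.coeFn_toLp] with x hx hx2
  rw [mulCLM]
  refine hx.trans ?_
  rw [hx2]; rfl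

/-- The Fourier transform on `L²` as a continuous linear equivalence. -/
def fourierL : L2 ≃L[ℂ] L2 := (Lp.fourierTransformₗᵢ E3 ℂ).toContinuousLinearEquiv

theorem fourierL_apply (u : L2) : fourierL u = 𝓕 u := rfl

/-- The operator on `L²` with Fourier multiplier `m`. -/
def multiplier (m : E3 → ℂ) (hm : MemLp m ⊤ volume) : L2 →L[ℂ] L2 :=
  fourierL.symm.toContinuousLinearMap ∘L mulCLM m hm ∘L fourierL.toContinuousLinearMap

theorem fourier_multiplier {m : E3 → ℂ} (hm : MemLp m ⊤ volume) (u : L2) :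
    (𝓕 (multiplier m hm u) : L2) =ᵐ[volume] fun ξ => m ξ * (𝓕 u : L2) ξ := by
  have : 𝓕 (multiplier m hm u) = mulCLM m hm (𝓕 u) := by
    rw [← fourierL_apply, ← fourierL_apply]
    simp [multiplier]
  rw [this]
  exact coeFn_mulCLM hm _

/-- The symbol `1 + 4π²|ξ|²` of `1 - Δ`. -/
def den (ξ : E3) : ℝ := 1 + ‖(2 * Real.pi) • ξ‖ ^ 2

theorem den_pos (ξ : E3) : 0 < den ξ := by unfold den; positivity

theorem one_le_den (ξ : E3) : 1 ≤ den ξ := by unfold den; nlinarith [sq_nonneg ‖(2 * Real.pi) • ξ‖]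

theorem continuous_den : Continuous den := by unfold den; fun_prop

theorem den_eq (ξ : E3) : den ξ = 1 + ∑ j, (2 * Real.pi * ξ j) ^ 2 := by
  simp [den, EuclideanSpace.norm_sq_eq, mul_pow]

theorem den_eq_symb (ξ : E3) : (den ξ : ℂ) = 1 - ∑ j, symb j ξ * symb j ξ := by
  rw [den_eq]
  push_cast
  rw [sub_eq_add_neg, ← Finset.sum_neg_distrib]
  congr 1
  refine Finset.sum_congr rfl fun j _ => ?_
  unfold symb
  linear_combination ((2 * Real.pi * (ξ j : ℂ)) ^ 2) * Complex.I_mul_I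

theorem norm_symb_sq_le (j : Fin 3) (ξ : E3) : ‖symb j ξ‖ ^ 2 ≤ den ξ := by
  have h : ‖symb j ξ‖ ^ 2 = (2 * Real.pi * ξ j) ^ 2 := by
    simp [symb, mul_pow]
  rw [h, den_eq]
  have := Finset.single_le_sum (f := fun j => (2 * Real.pi * ξ j) ^ 2)
    (fun i _ => sq_nonneg _) (Finset.mem_univ j)
  simp only at this
  linarith

/-- The symbol of the `a`-th derivative. -/
def jetSymb : JetIndex → E3 → ℂ
  | .inl _ => fun _ => 1
  | .inr (.inl i) => symb i
  | .inr (.inr (i, j)) => fun ξ => symb j ξ * symb i ξ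

theorem continuous_jetSymb (a : JetIndex) : Continuous (jetSymb a) := by
  rcases a with _ | i | ⟨i, j⟩
  · exact continuous_const
  · exact continuous_symb i
  · exact (continuous_symb j).mul (continuous_symb i)

theorem norm_jetSymb_le (a : JetIndex) (ξ : E3) : ‖jetSymb a ξ‖ ≤ den ξ := by
  have h1 := one_le_den ξ
  rcases a with _ | i | ⟨i, j⟩
  · simpa [jetSymb] using h1
  · have := norm_symb_sq_le i ξ
    simp only [jetSymb]
    nlinarith [norm_nonneg (symb i ξ), sq_nonneg (‖symb i ξ‖ - 1)]
  · have h2 := norm_symb_sq_le i ξ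
    have h3 := norm_symb_sq_le j ξ
    simp only [jetSymb, norm_mul]
    nlinarith [sq_nonneg (‖symb i ξ‖ - ‖symb j ξ‖)]

theorem continuous_jetSymb_div (a : JetIndex) : Continuous fun ξ => jetSymb a ξ / (den ξ : ℂ) :=
  (continuous_jetSymb a).div (Complex.continuous_ofReal.comp continuous_den)
    fun ξ => by exact_mod_cast (den_pos ξ).ne'

theorem memLp_jetSymb_div (a : JetIndex) :
    MemLp (fun ξ => jetSymb a ξ / (den ξ : ℂ)) ⊤ (volume : Measure E3) := by
  refine memLp_top_of_bound (continuous_jetSymb_div a).aestronglyMeasurable 1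
    (ae_of_all _ fun ξ => ?_)
  rw [norm_div, Complex.norm_real, Real.norm_of_nonneg (den_pos ξ).le, div_le_one (den_pos ξ)]
  exact norm_jetSymb_le a ξ

/-- The `a`-th derivative of an element of `H²`, in `L²`. -/
def jet (a : JetIndex) : H2 →L[ℂ] L2 :=
  (PiLp.proj 2 (fun _ : JetIndex => L2) a).comp H2Submodule.subtypeL

/-- The embedding of `H²` in `L²`. -/
def incl : H2 →L[ℂ] L2 := jet (.inl ())

/-- The derivative `∂_i : H² → L²`. -/
def gradL (i : Fin 3) : H2 →L[ℂ] L2 := jet (.inr (.inl i))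

/-- The second derivative `∂_j ∂_i : H² → L²`. -/
def hessL (i j : Fin 3) : H2 →L[ℂ] L2 := jet (.inr (.inr (i, j)))

theorem coeFn_incl (u : H2) : (incl u : E3 → ℂ) = u.fn := rfl

theorem fourier_gradL (i : Fin 3) (u : H2) :
    (𝓕 (gradL i u) : L2) =ᵐ[volume] fun ξ => symb i ξ * (𝓕 (incl u) : L2) ξ :=
  (hasWeakPartial_iff_fourier i _ _).1 (u.2.1 i)

theorem fourier_hessL (i j : Fin 3) (u : H2) :
    (𝓕 (hessL i j u) : L2) =ᵐ[volume] fun ξ => symb j ξ * (𝓕 (gradL i u) : L2) ξ :=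
  (hasWeakPartial_iff_fourier j _ _).1 (u.2.2 i j)

theorem fourier_jet (a : JetIndex) (u : H2) :
    (𝓕 (jet a u) : L2) =ᵐ[volume] fun ξ => jetSymb a ξ * (𝓕 (incl u) : L2) ξ := by
  rcases a with _ | i | ⟨i, j⟩
  · exact Eventually.of_forall fun ξ => (one_mul _).symm
  · exact fourier_gradL i u
  · filter_upwards [fourier_gradL i u, fourier_hessL i j u] with ξ h1 h2
    refine h2.trans ?_
    rw [h1, ← mul_assoc]; rfl

/-- The derivatives of an element of `H²` are determined by its underlying function. -/
theorem H2.ext_incl {u v : H2} (h : incl u = incl v) : u = v := by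
  apply Subtype.ext
  ext1 a
  have h1 : 𝓕 (jet a u) = 𝓕 (jet a v) := by
    apply Lp.ext
    filter_upwards [fourier_jet a u, fourier_jet a v] with ξ h1 h2
    rw [h1, h2, h]
  exact fourierL.injective h1

/-- An element of `H²` from a family of functions related by the right Fourier symbols. -/
theorem mem_H2Submodule_of_fourier (w : PiLp 2 (fun _ : JetIndex => L2))
    (h : ∀ a, (𝓕 (w a) : L2) =ᵐ[volume] fun ξ => jetSymb a ξ * (𝓕 (w (.inl ())) : L2) ξ) :
    w ∈ H2Submodule := by
  refine ⟨fun i => (hasWeakPartial_iff_fourier i _ _).2 (h (.inr (.inl i))),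
    fun i j => (hasWeakPartial_iff_fourier j _ _).2 ?_⟩
  filter_upwards [h (.inr (.inl i)), h (.inr (.inr (i, j)))] with ξ h1 h2
  rw [h1, h2, ← mul_assoc]; rfl

/-- The family `∂^a (1 - Δ)⁻¹ f`. -/
def resolventJet : L2 →L[ℂ] PiLp 2 (fun _ : JetIndex => L2) :=
  (PiLp.continuousLinearEquiv 2 ℂ (fun _ : JetIndex => L2)).symm.toContinuousLinearMap ∘L
    ContinuousLinearMap.pi fun a => multiplier _ (memLp_jetSymb_div a)

theorem fourier_resolventJet (f : L2) (a : JetIndex) :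
    (𝓕 (resolventJet f a) : L2) =ᵐ[volume] fun ξ => jetSymb a ξ / (den ξ : ℂ) * (𝓕 f : L2) ξ :=
  fourier_multiplier (memLp_jetSymb_div a) f

/-- The resolvent `(1 - Δ)⁻¹ : L² → H²`. -/
def resolvent : L2 →L[ℂ] H2 :=
  resolventJet.codRestrict H2Submodule fun f => mem_H2Submodule_of_fourier _ fun a => by
    filter_upwards [fourier_resolventJet f a, fourier_resolventJet f (.inl ())] with ξ h1 h2
    rw [h1, h2]
    simp only [jetSymb]
    ring

theorem fourier_incl_resolvent (f : L2) :
    (𝓕 (incl (resolvent f)) : L2) =ᵐ[volume] fun ξ => (𝓕 f : L2) ξ / (den ξ : ℂ) := by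
  filter_upwards [fourier_resolventJet f (.inl ())] with ξ h1
  refine h1.trans ?_
  simp only [jetSymb]
  ring

/-- The Laplacian `H² → L²`. -/
def lapL : H2 →L[ℂ] L2 := ∑ j, hessL j j

theorem lapL_apply (u : H2) : lapL u = ∑ j, hessL j j u := by
  simp [lapL]

theorem fourierL_sub_lapL (u : H2) :
    (𝓕 (incl u - lapL u) : L2) =ᵐ[volume] fun ξ => (den ξ : ℂ) * (𝓕 (incl u) : L2) ξ := by
  have h0 : 𝓕 (incl u - lapL u) = 𝓕 (incl u) - ∑ j, 𝓕 (hessL j j u) := by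
    simp only [← fourierL_apply, map_sub, lapL_apply, map_sum]
  rw [h0]
  have h1 : ∀ᵐ ξ, ∀ j : Fin 3, (𝓕 (hessL j j u) : L2) ξ =
      symb j ξ * (symb j ξ * (𝓕 (incl u) : L2) ξ) := by
    rw [ae_all_iff]
    intro j
    filter_upwards [fourier_gradL j u, fourier_hessL j j u] with ξ h1 h2
    rw [h2, h1]
  filter_upwards [h1, Lp.coeFn_sub (𝓕 (incl u)) (∑ j, 𝓕 (hessL j j u)),
    Lp.coeFn_finsetSum Finset.univ (fun j => 𝓕 (hessL j j u))] with ξ h1 h2 h3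
  rw [h2, Pi.sub_apply, h3, Finset.sum_apply, den_eq_symb, sub_mul, one_mul, Finset.sum_mul]
  congr 1
  refine Finset.sum_congr rfl fun j _ => ?_
  rw [h1 j, mul_assoc]

theorem resolvent_sub_lapL (u : H2) : resolvent (incl u - lapL u) = u := by
  apply H2.ext_incl
  apply fourierL.injective
  apply Lp.ext
  filter_upwards [fourier_incl_resolvent (incl u - lapL u), fourierL_sub_lapL u] with ξ h1 h2
  refine h1.trans ?_
  have : (den ξ : ℂ) ≠ 0 := by exact_mod_cast (den_pos ξ).ne'
  rw [h2, mul_div_cancel_left₀ _ this]; rfl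

theorem sub_lapL_resolvent (f : L2) : incl (resolvent f) - lapL (resolvent f) = f := by
  apply fourierL.injective
  apply Lp.ext
  filter_upwards [fourier_incl_resolvent f, fourierL_sub_lapL (resolvent f)] with ξ h1 h2
  refine h2.trans ?_
  have : (den ξ : ℂ) ≠ 0 := by exact_mod_cast (den_pos ξ).ne'
  rw [h1, mul_div_cancel₀ _ this]; rfl

/-- The isomorphism `1 - Δ : H² → L²`. -/
def oneSubLap : H2 ≃L[ℂ] L2 :=
  ContinuousLinearEquiv.equivOfInverse (incl - lapL) resolvent
    (fun u => resolvent_sub_lapL u) (fun f => sub_lapL_resolvent f)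

theorem oneSubLap_apply (u : H2) : oneSubLap u = incl u - lapL u := rfl

theorem oneSubLap_symm_apply (f : L2) : oneSubLap.symm f = resolvent f := rfl

/-- Integration by parts in the `j`-th variable, by Parseval's identity. -/
theorem inner_hessL (j : Fin 3) (u v : H2) :
    inner ℂ (incl u) (hessL j j v) = - inner ℂ (gradL j u) (gradL j v) := by
  rw [← Lp.inner_fourier_eq (incl u), ← Lp.inner_fourier_eq (gradL j u), L2.inner_def,
    L2.inner_def, ← integral_neg]
  refine integral_congr_ae ?_
  filter_upwards [fourier_gradL j u, fourier_gradL j v, fourier_hessL j j v] with ξ h1 h2 h3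
  simp only [RCLike.inner_apply]
  rw [h1, h3, map_mul, conj_symb]
  ring

/-- Integration by parts for the Laplacian. -/
theorem inner_lapL (u v : H2) :
    inner ℂ (incl u) (lapL v) = - ∑ j, inner ℂ (gradL j u) (gradL j v) := by
  rw [lapL_apply, inner_sum, ← Finset.sum_neg_distrib]
  exact Finset.sum_congr rfl fun j _ => inner_hessL j u v

/-! ### Density of test functions in `H²` -/

theorem hasWeakPartial_schwartz (j : Fin 3) (φ : 𝓢(E3, ℂ)) :
    HasWeakPartial j (schwartzL2 φ) (schwartzL2 (∂_{basisVec j} φ)) := by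
  rw [hasWeakPartial_iff_fourier, fourier_schwartzL2, fourier_schwartzL2]
  filter_upwards [coeFn_schwartzL2 (𝓕 (∂_{basisVec j} φ)), coeFn_schwartzL2 (𝓕 φ)] with ξ h1 h2
  rw [h1, h2, fourier_lineDerivOp_apply]; rfl

/-- The derivative of a Schwartz function with a given index. -/
def schwartzJet : JetIndex → 𝓢(E3, ℂ) →L[ℂ] 𝓢(E3, ℂ)
  | .inl _ => ContinuousLinearMap.id ℂ _
  | .inr (.inl i) => LineDeriv.lineDerivOpCLM ℂ 𝓢(E3, ℂ) (basisVec i)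
  | .inr (.inr (i, j)) => (LineDeriv.lineDerivOpCLM ℂ 𝓢(E3, ℂ) (basisVec j)).comp
      (LineDeriv.lineDerivOpCLM ℂ 𝓢(E3, ℂ) (basisVec i))

/-- A Schwartz function as an element of `H²`. -/
def schwartzH2 : 𝓢(E3, ℂ) →L[ℂ] H2 :=
  ((PiLp.continuousLinearEquiv 2 ℂ (fun _ : JetIndex => L2)).symm.toContinuousLinearMap ∘L
    ContinuousLinearMap.pi fun a => schwartzL2 ∘L schwartzJet a).codRestrict H2Submodule fun φ =>
      ⟨fun i => hasWeakPartial_schwartz i φ,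
        fun i j => hasWeakPartial_schwartz j (∂_{basisVec i} φ)⟩

theorem incl_schwartzH2 (φ : 𝓢(E3, ℂ)) : incl (schwartzH2 φ) = schwartzL2 φ := rfl

theorem gradL_schwartzH2 (i : Fin 3) (φ : 𝓢(E3, ℂ)) :
    gradL i (schwartzH2 φ) = schwartzL2 (∂_{basisVec i} φ) := rfl

theorem hasTemperateGrowth_inv_den : Function.HasTemperateGrowth fun ξ => ((den ξ)⁻¹ : ℝ) := by
  have h1 := Function.hasTemperateGrowth_one_add_norm_sq_rpow E3 (-1)
  have h2 : Function.HasTemperateGrowth fun ξ : E3 => (2 * Real.pi) • ξ :=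
    ((2 * Real.pi) • ContinuousLinearMap.id ℝ E3).hasTemperateGrowth
  have h3 := h1.comp h2
  refine (congrArg Function.HasTemperateGrowth (funext fun ξ => ?_)).mp h3
  exact Real.rpow_neg_one _

/-- The resolvent of the Laplacian preserves the Schwartz space. -/
def schwartzResolvent (φ : 𝓢(E3, ℂ)) : 𝓢(E3, ℂ) :=
  𝓕⁻ (SchwartzMap.smulLeftCLM ℂ (fun ξ => ((den ξ)⁻¹ : ℝ)) (𝓕 φ))

theorem fourier_schwartzResolvent (φ : 𝓢(E3, ℂ)) (ξ : E3) :
    𝓕 (schwartzResolvent φ) ξ = 𝓕 φ ξ / (den ξ : ℂ) := by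
  rw [schwartzResolvent, FourierTransform.fourier_fourierInv_eq,
    SchwartzMap.smulLeftCLM_apply_apply hasTemperateGrowth_inv_den]
  rw [Complex.real_smul, Complex.ofReal_inv, mul_comm, div_eq_mul_inv]

theorem resolvent_schwartzL2 (φ : 𝓢(E3, ℂ)) :
    resolvent (schwartzL2 φ) = schwartzH2 (schwartzResolvent φ) := by
  apply H2.ext_incl
  apply fourierL.injective
  apply Lp.ext
  rw [fourierL_apply, fourierL_apply, incl_schwartzH2, fourier_schwartzL2]
  filter_upwards [fourier_incl_resolvent (schwartzL2 φ), coeFn_schwartzL2 (𝓕 (schwartzResolvent φ)),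
    coeFn_schwartzL2 (𝓕 φ)] with ξ h1 h2 h3
  rw [h1, h2, fourier_schwartzL2, h3, fourier_schwartzResolvent]

/-- Schwartz functions are dense in `H²`: they are the image of a dense subspace of `L²` under the
isomorphism `(1 - Δ)⁻¹`. -/
theorem denseRange_schwartzH2 : DenseRange schwartzH2 := by
  have h1 : DenseRange (resolvent ∘ schwartzL2) :=
    (oneSubLap.symm.surjective.denseRange).comp denseRange_schwartzL2 resolvent.continuous
  refine h1.mono ?_
  rintro _ ⟨φ, rfl⟩
  exact ⟨schwartzResolvent φ, (resolvent_schwartzL2 φ).symm⟩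

/-- A closed property of elements of `H²` holds everywhere if it holds for test functions. -/
theorem H2.induction_test {P : H2 → Prop} (hP : IsClosed {u | P u})
    (h : ∀ φ : 𝓢(E3, ℂ), HasCompactSupport φ → P (schwartzH2 φ)) (u : H2) : P u := by
  refine denseRange_schwartzH2.induction_on u hP fun φ => ?_
  obtain ⟨ψ, hψ, hlim⟩ := exists_seq_hasCompactSupport_tendsto φ
  exact hP.mem_of_tendsto ((schwartzH2.continuous.tendsto φ).comp hlim)
    (Eventually.of_forall fun n => h (ψ n) (hψ n))

/-! ### Sobolev inequalities -/

/-- Upper bounds on `L^p` norms are stable under limits in `H²`, by Fatou's lemma. -/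
theorem isClosed_eLpNorm_le (D : H2 →L[ℂ] L2) (p : ℝ≥0∞) {B : H2 → ℝ≥0∞} (hB : Continuous B) :
    IsClosed {u | eLpNorm (D u) p volume ≤ B u} := by
  refine IsSeqClosed.isClosed fun u v hu hv => ?_
  have h1 : Tendsto (fun n => D (u n)) atTop (𝓝 (D v)) := (D.continuous.tendsto v).comp hv
  obtain ⟨ns, hns, hae⟩ := (tendstoInMeasure_of_tendsto_Lp h1).exists_seq_tendsto_ae
  have h2 := Lp.eLpNorm_lim_le_liminf_eLpNorm (p := p) (f := fun i => (D (u (ns i)) : E3 → ℂ))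
    (fun n => Lp.aestronglyMeasurable _) (D v) hae
  have h3 : Tendsto (fun i => B (u (ns i))) atTop (𝓝 (B v)) :=
    ((hB.tendsto v).comp hv).comp hns.tendsto_atTop
  refine h2.trans ?_
  rw [← h3.liminf_eq]
  exact liminf_le_liminf (Eventually.of_forall fun i => hu (ns i))

theorem norm_fderiv_le_sum (f : E3 → ℂ) (x : E3) :
    ‖fderiv ℝ f x‖ ≤ ∑ j, ‖fderiv ℝ f x (basisVec j)‖ := by
  refine ContinuousLinearMap.opNorm_le_bound _ (Finset.sum_nonneg fun _ _ => norm_nonneg _)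
    fun v => ?_
  have hv : v = ∑ j, v j • basisVec j := by
    ext i
    simp [basisVec, Finset.sum_apply, Pi.single_apply]
  conv_lhs => rw [hv]
  rw [map_sum, Finset.sum_mul]
  refine (norm_sum_le _ _).trans (Finset.sum_le_sum fun j _ => ?_)
  rw [map_smul, norm_smul, mul_comm]
  gcongr
  exact PiLp.norm_apply_le v j

theorem eLpNorm_schwartzL2 (φ : 𝓢(E3, ℂ)) (p : ℝ≥0∞) :
    eLpNorm (schwartzL2 φ) p volume = eLpNorm φ p volume :=
  eLpNorm_congr_ae (coeFn_schwartzL2 φ)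

/-- The constant of the Sobolev inequality `‖w‖₆ ≤ C ∑ ‖∂_j w‖₂`. -/
def sobolevConst : ℝ≥0∞ := SNormLESNormFDerivOfEqConst ℂ (volume : Measure E3) ((2 : NNReal) : ℝ)

theorem sobolevConst_ne_top : sobolevConst ≠ ⊤ := ENNReal.coe_ne_top

/-- The Gagliardo-Nirenberg-Sobolev inequality for test functions, in terms of the partial
derivatives. -/
theorem eLpNorm_six_le_of_hasCompactSupport (φ : 𝓢(E3, ℂ)) (hφ : HasCompactSupport φ) :
    eLpNorm φ 6 volume ≤
      sobolevConst * ∑ j, eLpNorm (⇑(∂_{basisVec j} φ : 𝓢(E3, ℂ))) 2 volume := by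
  have h := eLpNorm_le_eLpNorm_fderiv_of_eq (volume : Measure E3) (φ.smooth 1) hφ
    (p := 2) (p' := 6) one_le_two (by simp) (by simp; norm_num)
  refine h.trans ?_
  unfold sobolevConst
  gcongr
  have h1 : eLpNorm (fderiv ℝ φ) 2 (volume : Measure E3) ≤
      eLpNorm (∑ j, fun x => ‖(∂_{basisVec j} φ) x‖) 2 volume := by
    refine eLpNorm_mono_real fun x => ?_
    rw [Finset.sum_apply]
    exact norm_fderiv_le_sum φ x
  refine h1.trans ((eLpNorm_sum_le (fun j _ => ?_) one_le_two).trans_eq ?_)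
  · exact (∂_{basisVec j} φ).continuous.norm.aestronglyMeasurable
  · simp only [eLpNorm_norm]

theorem enorm_gradL_schwartzH2 (j : Fin 3) (φ : 𝓢(E3, ℂ)) :
    ‖gradL j (schwartzH2 φ)‖ₑ = eLpNorm (⇑(∂_{basisVec j} φ : 𝓢(E3, ℂ))) 2 volume := by
  rw [Lp.enorm_def, gradL_schwartzH2, eLpNorm_schwartzL2]

theorem enorm_hessL_schwartzH2 (i j : Fin 3) (φ : 𝓢(E3, ℂ)) :
    ‖hessL i j (schwartzH2 φ)‖ₑ =
      eLpNorm (⇑(∂_{basisVec j} (∂_{basisVec i} φ) : 𝓢(E3, ℂ))) 2 volume := by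
  rw [Lp.enorm_def]
  exact eLpNorm_schwartzL2 _ _

theorem hasCompactSupport_lineDerivOp (e : E3) {φ : 𝓢(E3, ℂ)} (hφ : HasCompactSupport φ) :
    HasCompactSupport (⇑(∂_{e} φ : 𝓢(E3, ℂ))) := by
  have : (⇑(∂_{e} φ : 𝓢(E3, ℂ))) = fun x => fderiv ℝ φ x e := by
    ext x; exact SchwartzMap.lineDerivOp_apply_eq_fderiv e φ x
  rw [this]
  exact hφ.fderiv_apply (𝕜 := ℝ) e

theorem continuous_sobolevConst_mul {ι : Type*} [Fintype ι] (D : ι → H2 →L[ℂ] L2) :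
    Continuous fun u => sobolevConst * ∑ j, ‖D j u‖ₑ :=
  (ENNReal.continuous_const_mul sobolevConst_ne_top).comp
    (continuous_finsetSum _ fun j _ => (D j).continuous.enorm)

/-- The Sobolev inequality for an element of `H²`. -/
theorem eLpNorm_incl_six_le (u : H2) :
    eLpNorm (incl u) 6 volume ≤ sobolevConst * ∑ j, ‖gradL j u‖ₑ := by
  refine H2.induction_test (isClosed_eLpNorm_le incl 6 (continuous_sobolevConst_mul gradL))
    (fun φ hφ => ?_) u
  simp only [enorm_gradL_schwartzH2, incl_schwartzH2, eLpNorm_schwartzL2]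
  exact eLpNorm_six_le_of_hasCompactSupport φ hφ

/-- The Sobolev inequality for the gradient of an element of `H²`. -/
theorem eLpNorm_gradL_six_le (i : Fin 3) (u : H2) :
    eLpNorm (gradL i u) 6 volume ≤ sobolevConst * ∑ j, ‖hessL i j u‖ₑ := by
  refine H2.induction_test (isClosed_eLpNorm_le (gradL i) 6 (continuous_sobolevConst_mul (hessL i)))
    (fun φ hφ => ?_) u
  simp only [enorm_hessL_schwartzH2, gradL_schwartzH2, eLpNorm_schwartzL2]
  exact eLpNorm_six_le_of_hasCompactSupport _ (hasCompactSupport_lineDerivOp _ hφ)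

/-! ### The kernel of the resolvent: boundedness and local compactness -/

/-- In dimension three `(1 + 4π²|ξ|²)⁻¹` is square integrable. -/
theorem integrable_inv_den_sq : Integrable (fun ξ => (1 / den ξ) ^ 2) (volume : Measure E3) := by
  have h := integrable_rpow_neg_one_add_norm_sq (E := E3) (μ := volume) (r := 4)
    (by simp; norm_num)
  have h2 := h.comp_smul (R := 2 * Real.pi) (by positivity)
  refine h2.congr (ae_of_all _ fun ξ => ?_)
  have e : (-4 / 2 : ℝ) = ((-2 : ℤ) : ℝ) := by norm_num
  simp only [den]
  rw [e, Real.rpow_intCast, zpow_neg, one_div, inv_pow]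
  rfl

/-- The Fourier transform of the resolvent kernel based at `x`, conjugated. -/
def kerFun (x ξ : E3) : ℂ := Complex.exp (-(2 * Real.pi * inner ℝ ξ x : ℝ) * Complex.I) / den ξ

theorem norm_kerFun (x ξ : E3) : ‖kerFun x ξ‖ = 1 / den ξ := by
  rw [kerFun, norm_div, ← Complex.ofReal_neg, Complex.norm_exp_ofReal_mul_I, Complex.norm_real,
    Real.norm_of_nonneg (den_pos ξ).le]

theorem continuous_kerFun_right (x : E3) : Continuous (kerFun x) := by
  unfold kerFun
  refine Continuous.div (by fun_prop) (Complex.continuous_ofReal.comp continuous_den)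
    fun p => by exact_mod_cast (den_pos p).ne'

theorem continuous_kerFun_left (ξ : E3) : Continuous fun x => kerFun x ξ := by
  unfold kerFun
  fun_prop

theorem memLp_kerFun (x : E3) : MemLp (kerFun x) 2 volume := by
  rw [memLp_two_iff_integrable_sq_norm (continuous_kerFun_right x).aestronglyMeasurable]
  simp only [norm_kerFun]
  exact integrable_inv_den_sq

/-- The resolvent kernel on the Fourier side, as an element of `L²`. -/
def ker (x : E3) : L2 := (memLp_kerFun x).toLp

theorem L2.norm_sq_eq (f : L2) : ‖f‖ ^ 2 = ∫ x, ‖f x‖ ^ 2 := by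
  have h : (inner ℂ f f : ℂ) = ((∫ x, ‖f x‖ ^ 2 : ℝ) : ℂ) := by
    rw [L2.inner_def, ← integral_complex_ofReal]
    refine integral_congr_ae (ae_of_all _ fun x => ?_)
    simp [inner_self_eq_norm_sq_to_K]
  apply Complex.ofReal_injective
  rw [← h, inner_self_eq_norm_sq_to_K]
  push_cast
  rfl

/-- The resolvent kernel is translation invariant, so its norm does not depend on the base point. -/
theorem norm_ker (x : E3) : ‖ker x‖ = ‖ker 0‖ := by
  have h : ∀ y, ‖ker y‖ ^ 2 = ∫ ξ, (1 / den ξ) ^ 2 := by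
    intro y
    rw [L2.norm_sq_eq]
    refine integral_congr_ae ?_
    filter_upwards [(memLp_kerFun y).coeFn_toLp] with ξ hξ
    simp only [ker]
    rw [hξ, norm_kerFun]
  exact (sq_eq_sq₀ (norm_nonneg _) (norm_nonneg _)).1 ((h x).trans (h 0).symm)

theorem continuous_ker : Continuous ker := by
  rw [continuous_iff_continuousAt]
  intro x
  rw [ContinuousAt, tendsto_iff_norm_sub_tendsto_zero]
  have h1 : ∀ y, ‖ker y - ker x‖ ^ 2 = ∫ ξ, ‖kerFun y ξ - kerFun x ξ‖ ^ 2 := by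
    intro y
    rw [L2.norm_sq_eq]
    refine integral_congr_ae ?_
    filter_upwards [(memLp_kerFun y).coeFn_toLp, (memLp_kerFun x).coeFn_toLp,
      Lp.coeFn_sub (ker y) (ker x)] with ξ h1 h2 h3
    rw [h3, Pi.sub_apply]
    simp only [ker]
    rw [h1, h2]
  have h2 : Tendsto (fun y => ∫ ξ, ‖kerFun y ξ - kerFun x ξ‖ ^ 2) (𝓝 x)
      (𝓝 (∫ _ : E3, (0 : ℝ))) := by
    refine tendsto_integral_filter_of_dominated_convergence (fun ξ => 4 * (1 / den ξ) ^ 2)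
      (Eventually.of_forall fun y => ?_) (Eventually.of_forall fun y => ae_of_all _ fun ξ => ?_)
      (integrable_inv_den_sq.const_mul 4) (ae_of_all _ fun ξ => ?_)
    · exact (((continuous_kerFun_right y).sub
        (continuous_kerFun_right x)).norm.pow 2).aestronglyMeasurable
    · rw [Real.norm_of_nonneg (by positivity)]
      have := norm_sub_le (kerFun y ξ) (kerFun x ξ)
      rw [norm_kerFun, norm_kerFun] at this
      nlinarith [norm_nonneg (kerFun y ξ - kerFun x ξ)]
    · have c : Continuous fun y => ‖kerFun y ξ - kerFun x ξ‖ ^ 2 :=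
        ((continuous_kerFun_left ξ).sub continuous_const).norm.pow 2
      simpa using c.tendsto x
  rw [integral_zero] at h2
  have h3 := h2.sqrt
  simp only [← h1, Real.sqrt_sq (norm_nonneg _), Real.sqrt_zero] at h3
  exact h3

/-- Pointwise values of `(1 - Δ)⁻¹ φ` are inner products with the resolvent kernel, by Fourier
inversion. -/
theorem schwartzResolvent_apply (φ : 𝓢(E3, ℂ)) (x : E3) :
    schwartzResolvent φ x = inner ℂ (ker x) (𝓕 (schwartzL2 φ)) := by
  have h1 : schwartzResolvent φ x = (𝓕⁻ (𝓕 (schwartzResolvent φ))) x := by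
    rw [FourierTransform.fourierInv_fourier_eq]
  rw [h1, SchwartzMap.fourierInv_coe, Real.fourierInv_eq', L2.inner_def, fourier_schwartzL2]
  refine integral_congr_ae ?_
  filter_upwards [coeFn_schwartzL2 (𝓕 φ), (memLp_kerFun x).coeFn_toLp] with ξ h2 h3
  simp only [ker]
  rw [h2, h3, fourier_schwartzResolvent, RCLike.inner_apply, kerFun, smul_eq_mul, map_div₀,
    ← Complex.exp_conj, Complex.conj_ofReal, map_mul, Complex.conj_I, ← Complex.ofReal_neg,
    Complex.conj_ofReal]
  push_cast
  ring_nf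

/-- The embedding `H² ⊂ L^∞`. -/
theorem eLpNorm_top_le : ∃ C : ℝ, 0 < C ∧ ∀ u : H2,
    eLpNorm (incl u) ⊤ volume ≤ ENNReal.ofReal (C * ‖u‖) := by
  let C : ℝ := ‖ker 0‖ * ‖(incl - lapL : H2 →L[ℂ] L2)‖ + 1
  have hC : ∀ u : H2, eLpNorm (incl u) ⊤ volume ≤ ENNReal.ofReal (C * ‖u‖) := by
    intro u
    have hd : DenseRange (resolvent ∘ schwartzL2) :=
      (oneSubLap.symm.surjective.denseRange).comp denseRange_schwartzL2 resolvent.continuous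
    refine hd.induction_on (p := fun u => eLpNorm (incl u) ⊤ volume ≤ ENNReal.ofReal (C * ‖u‖)) u
      (isClosed_eLpNorm_le incl ⊤
        (ENNReal.continuous_ofReal.comp (continuous_const.mul continuous_norm))) fun φ => ?_
    simp only [Function.comp_apply]
    set w := resolvent (schwartzL2 φ) with hw
    have hφ : schwartzL2 φ = (incl - lapL) w := (sub_lapL_resolvent _).symm
    have hn : ‖schwartzL2 φ‖ ≤ ‖(incl - lapL : H2 →L[ℂ] L2)‖ * ‖w‖ := by
      rw [hφ]; exact ContinuousLinearMap.le_opNorm _ _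
    have hb : ∀ᵐ x, ‖incl w x‖ ≤ C * ‖w‖ := by
      rw [hw, resolvent_schwartzL2, incl_schwartzH2]
      filter_upwards [coeFn_schwartzL2 (schwartzResolvent φ)] with x hx
      rw [hx, schwartzResolvent_apply, ← resolvent_schwartzL2, ← hw]
      calc _ ≤ ‖ker x‖ * ‖𝓕 (schwartzL2 φ)‖ := norm_inner_le_norm _ _
        _ = ‖ker 0‖ * ‖schwartzL2 φ‖ := by rw [norm_ker, Lp.norm_fourier_eq]
        _ ≤ ‖ker 0‖ * (‖(incl - lapL : H2 →L[ℂ] L2)‖ * ‖w‖) := by gcongr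
        _ ≤ C * ‖w‖ := by simp only [C]; nlinarith [norm_nonneg w]
    rw [eLpNorm_exponent_top]
    refine eLpNormEssSup_le_of_ae_bound hb
  exact ⟨C, by positivity, hC⟩

/-- The operator `f ↦ (x ↦ F x f)` on `L²` attached to a square-integrable family `F` of
functionals. -/
def hilbertSchmidt : Lp (L2 →L[ℂ] ℂ) 2 (volume : Measure E3) →L[ℂ] L2 →L[ℂ] L2 :=
  LinearMap.mkContinuous₂ (LinearMap.mk₂ ℂ
    (fun F f => (ContinuousLinearMap.apply ℂ ℂ f).compLp F)
    (fun F G f =>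
      (ContinuousLinearMap.compLpL 2 volume (ContinuousLinearMap.apply ℂ ℂ f)).map_add F G)
    (fun c F f =>
      (ContinuousLinearMap.compLpL 2 volume (ContinuousLinearMap.apply ℂ ℂ f)).map_smul c F)
    (fun F f g => by rw [map_add, ContinuousLinearMap.add_compLp])
    (fun c F f => by rw [map_smul, ContinuousLinearMap.smul_compLp])) 1 fun F f => by
      refine (ContinuousLinearMap.norm_compLp_le _ _).trans ?_
      rw [one_mul, mul_comm]
      gcongr
      exact ContinuousLinearMap.opNorm_le_bound _ (norm_nonneg _) fun L => by
        rw [mul_comm]; exact L.le_opNorm f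

theorem coeFn_hilbertSchmidt (F : Lp (L2 →L[ℂ] ℂ) 2 (volume : Measure E3)) (f : L2) :
    (hilbertSchmidt F f : E3 → ℂ) =ᵐ[volume] fun x => F x f :=
  (ContinuousLinearMap.apply ℂ ℂ f).coeFn_compLp F

/-- Hilbert-Schmidt operators are compact: this holds for simple families, where the operator has
finite rank, and passes to the limit. -/
theorem isCompactOperator_hilbertSchmidt (F : Lp (L2 →L[ℂ] ℂ) 2 (volume : Measure E3)) :
    IsCompactOperator (hilbertSchmidt F) := by
  refine Lp.induction ENNReal.ofNat_ne_top (fun F => IsCompactOperator (hilbertSchmidt F))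
    ?_ ?_ ?_ F
  · intro c s hs hμ
    have h : hilbertSchmidt (Lp.simpleFunc.indicatorConst 2 hs hμ.ne c : Lp (L2 →L[ℂ] ℂ) 2 volume)
        = (ContinuousLinearMap.toSpanSingleton ℂ (indicatorConstLp 2 hs hμ.ne (1 : ℂ))).comp c := by
      ext1 f
      apply Lp.ext
      rw [Lp.simpleFunc.coe_indicatorConst]
      have e1 := coeFn_hilbertSchmidt (indicatorConstLp 2 hs hμ.ne c) f
      have e2 := indicatorConstLp_coeFn (p := 2) (hs := hs) (hμs := hμ.ne) (c := c)
      have e3 := indicatorConstLp_coeFn (p := 2) (hs := hs) (hμs := hμ.ne) (c := (1 : ℂ))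
      have e4 := Lp.coeFn_smul (c f) (indicatorConstLp 2 hs hμ.ne (1 : ℂ))
      filter_upwards [e1, e2, e3, e4] with x e1 e2 e3 e4
      rw [e1, e2]
      simp only [ContinuousLinearMap.comp_apply, ContinuousLinearMap.toSpanSingleton_apply]
      rw [e4, Pi.smul_apply, e3]
      by_cases hx : x ∈ s <;> simp [hx]
    rw [h]
    have hc : IsCompactOperator c := isCompactOperator_of_locallyCompactSpace_dom c
    exact hc.clm_comp (ContinuousLinearMap.toSpanSingleton ℂ (indicatorConstLp 2 hs hμ.ne (1 : ℂ)))
  · intro f g hf hg _ h1 h2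
    rw [map_add]
    exact h1.add h2
  · exact (isClosed_setOfPred_isCompactOperator
      (σ₁₂ := RingHom.id ℂ) (M₁ := L2) (M₂ := L2)).preimage hilbertSchmidt.continuous

theorem memLp_indicator_const_ball (c : ℂ) (R : ℝ) :
    MemLp ((Metric.ball (0 : E3) R).indicator fun _ => c) ⊤ volume :=
  memLp_top_of_bound (aestronglyMeasurable_const.indicator Metric.isOpen_ball.measurableSet) ‖c‖
    (ae_of_all _ fun _ => norm_indicator_le_norm_self _ _)

/-- Multiplication by `c` times the indicator function of the ball of radius `R`. -/
def ballCLM (c : ℂ) (R : ℝ) : L2 →L[ℂ] L2 := mulCLM _ (memLp_indicator_const_ball c R)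

theorem coeFn_ballCLM (c : ℂ) (R : ℝ) (u : L2) : (ballCLM c R u : E3 → ℂ) =ᵐ[volume]
    fun x => (Metric.ball (0 : E3) R).indicator (fun _ => c) x * u x :=
  coeFn_mulCLM _ u

theorem memLp_indicator_ker (c : ℂ) (R : ℝ) : MemLp ((Metric.ball (0 : E3) R).indicator
    fun x => c • innerSL ℂ (ker x)) 2 volume := by
  refine (memLp_indicator_iff_restrict (ε := L2 →L[ℂ] ℂ) Metric.isOpen_ball.measurableSet).2 ?_
  have : IsFiniteMeasure (volume.restrict (Metric.ball (0 : E3) R)) :=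
    isFiniteMeasure_restrict.2 measure_ball_lt_top.ne
  refine MemLp.of_bound (C := ‖c‖ * ‖ker 0‖) ?_ (ae_of_all _ fun x => ?_)
  · exact (((innerSL ℂ).continuous.comp continuous_ker).const_smul c).aestronglyMeasurable
  · rw [norm_smul, innerSL_apply_norm, norm_ker]

/-- Rellich's theorem: restriction to a ball is compact from `H²` to `L²`. -/
theorem isCompactOperator_ballCLM_resolvent (c : ℂ) (R : ℝ) :
    IsCompactOperator (ballCLM c R ∘L incl ∘L resolvent) := by
  have h : ballCLM c R ∘L incl ∘L resolvent =
      (hilbertSchmidt (memLp_indicator_ker c R).toLp).comp fourierL.toContinuousLinearMap := by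
    apply ContinuousLinearMap.ext
    intro f
    refine denseRange_schwartzL2.induction_on f
      (isClosed_eq (ContinuousLinearMap.continuous _) (ContinuousLinearMap.continuous _))
      fun φ => ?_
    apply Lp.ext
    filter_upwards [coeFn_ballCLM c R (incl (resolvent (schwartzL2 φ))),
      coeFn_hilbertSchmidt (memLp_indicator_ker c R).toLp (fourierL (schwartzL2 φ)),
      (memLp_indicator_ker c R).coeFn_toLp, coeFn_schwartzL2 (schwartzResolvent φ)]
      with x h1 h2 h3 h4
    refine h1.trans (Eq.trans ?_ h2.symm)
    rw [h3, resolvent_schwartzL2, incl_schwartzH2, h4, schwartzResolvent_apply, fourierL_apply]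
    by_cases hx : x ∈ Metric.ball (0 : E3) R
    · simp [hx]
    · simp [hx]
  rw [h]
  exact (isCompactOperator_hilbertSchmidt _).comp_clm _

/-! ### Multiplication estimates for the coefficients -/

/-- Hölder's exponents `1 / 3 + 1 / 6 = 1 / 2`, pairing `L³` multipliers with the Sobolev
exponent. -/
instance holderTriple_three_six : ENNReal.HolderTriple 3 6 2 where
  inv_add_inv_eq_inv := by
    have h : ∀ n : ℕ, n ≠ 0 → ((n : ℝ≥0∞))⁻¹ = ENNReal.ofReal ((n : ℝ)⁻¹) := fun n hn => by
      rw [ENNReal.ofReal_inv_of_pos (by positivity), ENNReal.ofReal_natCast]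
    have h3 := h 3 (by norm_num)
    have h6 := h 6 (by norm_num)
    have h2 := h 2 (by norm_num)
    push_cast at h3 h6 h2
    rw [h3, h6, h2, ← ENNReal.ofReal_add (by norm_num) (by norm_num)]
    norm_num

/-- The large values of a nonnegative function. -/
def trunc (T : ℝ) (G : E3 → ℝ) (x : E3) : ℝ := if T < G x then G x else 0

theorem trunc_nonneg {T : ℝ} (hT : 0 ≤ T) (G : E3 → ℝ) (x : E3) : 0 ≤ trunc T G x := by
  unfold trunc
  split_ifs with h
  · exact hT.trans h.le
  · exact le_rfl

theorem le_trunc_add {T : ℝ} (hT : 0 ≤ T) (G : E3 → ℝ) (x : E3) : G x ≤ trunc T G x + T := by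
  unfold trunc
  split_ifs with h
  · linarith
  · linarith [not_lt.1 h]

theorem aestronglyMeasurable_trunc (T : ℝ) {G : E3 → ℝ} {ν : Measure E3}
    (hG : AEStronglyMeasurable G ν) : AEStronglyMeasurable (trunc T G) ν := by
  have hm : Measurable fun t : ℝ => if T < t then t else 0 :=
    Measurable.ite measurableSet_Ioi measurable_id measurable_const
  exact (hm.comp_aemeasurable hG.aemeasurable).aestronglyMeasurable

/-- The large values of a function in `L^Q`, `Q > 3`, lie in `L³`. -/
theorem eLpNorm_trunc_le {T Q : ℝ} (hT : 0 < T) (hQ : 3 < Q) (G : E3 → ℝ) (hG : ∀ x, 0 ≤ G x)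
    (ν : Measure E3) : eLpNorm (trunc T G) 3 ν ≤
      ENNReal.ofReal (T ^ (1 - Q / 3)) * eLpNorm G (ENNReal.ofReal Q) ν ^ (Q / 3) := by
  have h1 : eLpNorm (trunc T G) 3 ν ≤
      eLpNorm ((T ^ (1 - Q / 3)) • fun x => ‖G x‖ ^ (Q / 3)) 3 ν := by
    refine eLpNorm_mono_real fun x => ?_
    rw [Real.norm_of_nonneg (trunc_nonneg hT.le G x), Pi.smul_apply, smul_eq_mul,
      Real.norm_of_nonneg (hG x)]
    unfold trunc
    split_ifs with h
    · have hGx : 0 < G x := hT.trans h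
      calc G x = G x ^ (1 - Q / 3) * G x ^ (Q / 3) := by
            rw [← Real.rpow_add hGx]; norm_num
        _ ≤ T ^ (1 - Q / 3) * G x ^ (Q / 3) := by
            exact mul_le_mul_of_nonneg_right
              (Real.rpow_le_rpow_of_nonpos hT h.le (by linarith)) (by positivity)
    · have := hG x
      positivity
  refine h1.trans ?_
  rw [eLpNorm_const_smul, eLpNorm_norm_rpow _ (by positivity), Real.enorm_of_nonneg (by positivity)]
  have h3 : (3 : ℝ≥0∞) = ENNReal.ofReal 3 := by norm_num
  rw [h3, ← ENNReal.ofReal_mul (by norm_num), mul_div_cancel₀ _ (by norm_num : (3 : ℝ) ≠ 0)]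

theorem eLpNorm_trunc_eq_zero {T : ℝ} (hT : 0 ≤ T) (G : E3 → ℝ) (ν : Measure E3)
    (h : eLpNorm G ⊤ ν ≤ ENNReal.ofReal T) : eLpNorm (trunc T G) 3 ν = 0 := by
  have h0 : trunc T G =ᵐ[ν] 0 := by
    filter_upwards [ae_le_eLpNormEssSup (f := G) (μ := ν)] with x hx
    rw [eLpNorm_exponent_top] at h
    have h2 := hx.trans h
    rw [Real.enorm_eq_ofReal_abs, ENNReal.ofReal_le_ofReal_iff hT] at h2
    unfold trunc
    rw [if_neg (not_lt.2 ((le_abs_self _).trans h2))]; rfl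
  rw [eLpNorm_congr_ae h0, eLpNorm_zero]

/-- If the `L^q` norm is small, `q > 3`, then so is the `L³` norm of the large values. -/
theorem exists_eLpNorm_trunc_le_of_small {q : ℝ≥0∞} (hq : 3 < q) {T κ : ℝ} (hT : 0 < T)
    (hκ : 0 < κ) : ∃ ε : ℝ, 0 < ε ∧ ∀ (ν : Measure E3) (G : E3 → ℝ), (∀ x, 0 ≤ G x) →
      eLpNorm G q ν ≤ ENNReal.ofReal ε → eLpNorm (trunc T G) 3 ν ≤ ENNReal.ofReal κ := by
  by_cases hq' : q = ⊤
  · subst hq'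
    exact ⟨T, hT, fun ν G _ h => by rw [eLpNorm_trunc_eq_zero hT.le G ν h]; exact zero_le⟩
  · obtain ⟨Q, hQ0, rfl⟩ : ∃ Q : ℝ, 0 ≤ Q ∧ q = ENNReal.ofReal Q :=
      ⟨q.toReal, ENNReal.toReal_nonneg, (ENNReal.ofReal_toReal hq').symm⟩
    have hQ : 3 < Q := by
      have : ENNReal.ofReal 3 < ENNReal.ofReal Q := by simpa using hq
      exact (ENNReal.ofReal_lt_ofReal_iff_of_nonneg (by norm_num)).1 this
    have hc : 0 < T ^ (1 - Q / 3) := by positivity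
    refine ⟨(κ / T ^ (1 - Q / 3)) ^ (3 / Q), by positivity, fun ν G hG h => ?_⟩
    refine (eLpNorm_trunc_le hT hQ G hG ν).trans ?_
    calc _ ≤ ENNReal.ofReal (T ^ (1 - Q / 3)) *
          ENNReal.ofReal ((κ / T ^ (1 - Q / 3)) ^ (3 / Q)) ^ (Q / 3) := by gcongr
      _ = ENNReal.ofReal κ := by
          rw [ENNReal.ofReal_rpow_of_pos (by positivity), ← Real.rpow_mul (by positivity),
            div_mul_div_cancel₀ (by positivity : Q ≠ 0), div_self (by norm_num), Real.rpow_one,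
            ← ENNReal.ofReal_mul hc.le, mul_div_cancel₀ _ hc.ne']

/-- For a function in `L^q`, `q > 3`, the `L³` norm of the large values becomes small. -/
theorem exists_eLpNorm_trunc_le {q : ℝ≥0∞} (hq : 3 < q) {κ : ℝ} (hκ : 0 < κ) (ν : Measure E3)
    (G : E3 → ℝ) (hG : ∀ x, 0 ≤ G x) (hGq : eLpNorm G q ν ≠ ⊤) :
    ∃ T : ℝ, 0 < T ∧ eLpNorm (trunc T G) 3 ν ≤ ENNReal.ofReal κ := by
  by_cases hq' : q = ⊤
  · subst hq'
    refine ⟨(eLpNorm G ⊤ ν).toReal + 1, by positivity, ?_⟩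
    rw [eLpNorm_trunc_eq_zero (by positivity) G ν]
    · exact zero_le
    · calc _ = ENNReal.ofReal (eLpNorm G ⊤ ν).toReal := (ENNReal.ofReal_toReal hGq).symm
        _ ≤ _ := ENNReal.ofReal_le_ofReal (by linarith)
  · obtain ⟨Q, hQ0, rfl⟩ : ∃ Q : ℝ, 0 ≤ Q ∧ q = ENNReal.ofReal Q :=
      ⟨q.toReal, ENNReal.toReal_nonneg, (ENNReal.ofReal_toReal hq').symm⟩
    have hQ : 3 < Q := by
      have : ENNReal.ofReal 3 < ENNReal.ofReal Q := by simpa using hq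
      exact (ENNReal.ofReal_lt_ofReal_iff_of_nonneg (by norm_num)).1 this
    set K := (eLpNorm G (ENNReal.ofReal Q) ν ^ (Q / 3)).toReal with hK
    have hKt : eLpNorm G (ENNReal.ofReal Q) ν ^ (Q / 3) = ENNReal.ofReal K :=
      (ENNReal.ofReal_toReal (ENNReal.rpow_ne_top_of_nonneg (by positivity) hGq)).symm
    have hlim : Tendsto (fun T : ℝ => T ^ (-(Q / 3 - 1)) * K) atTop (𝓝 (0 * K)) :=
      (tendsto_rpow_neg_atTop (by linarith)).mul_const K
    rw [zero_mul] at hlim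
    obtain ⟨T, hT1, hT2⟩ := ((hlim.eventually (gt_mem_nhds hκ)).and (eventually_gt_atTop 0)).exists
    refine ⟨T, hT2, (eLpNorm_trunc_le hT2 hQ G hG ν).trans ?_⟩
    rw [hKt, ← ENNReal.ofReal_mul (by positivity)]
    apply ENNReal.ofReal_le_ofReal
    rw [neg_sub] at hT1
    exact hT1.le

/-- Hölder's inequality for a multiplier dominated by the sum of an `L^p` function, a constant and
a bounded function supported in a ball. -/
theorem eLpNorm_mul_le_of_le {p q : ℝ≥0∞} [ENNReal.HolderTriple p q 2] {f b : E3 → ℝ} {w : E3 → ℂ}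
    {K M R : ℝ} (hK : 0 ≤ K) (hM : 0 ≤ M) (hb : AEStronglyMeasurable b volume)
    (hw : AEStronglyMeasurable w volume)
    (h : ∀ᵐ x, |f x| ≤ b x + K + (Metric.ball (0 : E3) R).indicator (fun _ => M) x) :
    eLpNorm (fun x => (f x : ℂ) * w x) 2 volume ≤ eLpNorm b p volume * eLpNorm w q volume +
      ENNReal.ofReal K * eLpNorm w 2 volume +
      ENNReal.ofReal M * eLpNorm ((Metric.ball (0 : E3) R).indicator w) 2 volume := by
  have hi : AEStronglyMeasurable ((Metric.ball (0 : E3) R).indicator w) volume :=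
    hw.indicator Metric.isOpen_ball.measurableSet
  have h1 : eLpNorm (fun x => (f x : ℂ) * w x) 2 volume ≤
      eLpNorm ((b • fun x => ‖w x‖) + (K • fun x => ‖w x‖) +
        (M • fun x => ‖(Metric.ball (0 : E3) R).indicator w x‖)) 2 volume := by
    refine eLpNorm_mono_ae_real ?_
    filter_upwards [h] with x hx
    rw [norm_mul, Complex.norm_real, Real.norm_eq_abs]
    simp only [Pi.add_apply, Pi.smul_apply, Pi.mul_apply, smul_eq_mul]
    have := mul_le_mul_of_nonneg_right hx (norm_nonneg (w x))
    refine this.trans (le_of_eq ?_)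
    by_cases hxB : x ∈ Metric.ball (0 : E3) R
    · simp only [hxB, indicator_of_mem]; ring
    · simp only [hxB, not_false_eq_true, indicator_of_notMem, norm_zero]; ring
  refine h1.trans ?_
  refine (eLpNorm_add_le ((hb.smul hw.norm).add (hw.norm.const_smul K)) (hi.norm.const_smul M)
    one_le_two).trans ?_
  refine add_le_add ((eLpNorm_add_le (hb.smul hw.norm) (hw.norm.const_smul K)
    one_le_two).trans (add_le_add ?_ ?_)) ?_
  · refine (eLpNorm_smul_le_mul_eLpNorm hw.norm hb (p := p) (q := q)).trans ?_
    rw [eLpNorm_norm]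
  · rw [eLpNorm_const_smul, eLpNorm_norm, Real.enorm_of_nonneg hK]
  · rw [eLpNorm_const_smul, eLpNorm_norm, Real.enorm_of_nonneg hM]

/-- A multiplier in `L² + L^∞` is bounded from `L² ∩ L^∞` to `L²`, with arbitrarily small constant
in front of the `L^∞` norm. -/
theorem MemLpAdd.eLpNorm_mul_le {v : E3 → ℝ} (hv : MemLpAdd v 2 ⊤ volume) {κ : ℝ} (hκ : 0 < κ) :
    ∃ M : ℝ, 0 ≤ M ∧ ∀ w : E3 → ℂ, AEStronglyMeasurable w volume →
      eLpNorm (fun x => (v x : ℂ) * w x) 2 volume ≤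
        ENNReal.ofReal κ * eLpNorm w ⊤ volume + ENNReal.ofReal M * eLpNorm w 2 volume := by
  obtain ⟨g, h, hg, hh, hvgh⟩ := hv
  have hg' : MemLp (hg.1.mk g) 2 volume := hg.ae_eq hg.1.ae_eq_mk
  -- the part of `g` above a high level `T` is small in `L²`; the rest of `v` is bounded
  obtain ⟨T, hT⟩ := hg'.eLpNorm_indicator_norm_ge_le hg.1.stronglyMeasurable_mk hκ
  set b := ({x | T ≤ (‖hg.1.mk g x‖₊ : ℝ)}.indicator (hg.1.mk g)) with hb
  have hbm : AEStronglyMeasurable b volume := by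
    refine hg'.1.indicator ?_
    exact measurableSet_le measurable_const hg.1.stronglyMeasurable_mk.measurable.norm
  set K := max T 0 + (eLpNorm h ⊤ volume).toReal with hK
  have hK0 : 0 ≤ K := add_nonneg (le_max_right _ _) ENNReal.toReal_nonneg
  have hle : ∀ᵐ x, |v x| ≤ ‖b x‖ + K + (Metric.ball (0 : E3) 0).indicator (fun _ => (0 : ℝ)) x := by
    filter_upwards [hvgh, hg.1.ae_eq_mk, ae_le_eLpNormEssSup (f := h) (μ := volume)] with x h1 h2 h3
    rw [← eLpNorm_exponent_top] at h3
    have h4 : |h x| ≤ (eLpNorm h ⊤ volume).toReal := by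
      have := ENNReal.toReal_mono hh.2.ne h3
      simpa using this
    have h5 : |g x| ≤ ‖b x‖ + max T 0 := by
      rw [hb, h2]
      by_cases hx : T ≤ (‖hg.1.mk g x‖₊ : ℝ)
      · rw [indicator_of_mem (by exact hx)]
        have := le_max_right T 0
        rw [Real.norm_eq_abs]; linarith
      · rw [indicator_of_notMem (by exact hx), norm_zero, zero_add]
        have : |hg.1.mk g x| < T := not_le.1 hx
        exact this.le.trans (le_max_left _ _)
    rw [h1, Pi.add_apply]
    have := abs_add_le (g x) (h x)
    simp only [indicator_zero]
    rw [hK]; linarith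
  refine ⟨K, hK0, fun w hw => ?_⟩
  have := eLpNorm_mul_le_of_le (p := 2) (q := ⊤) hK0 le_rfl hbm.norm hw hle
  refine this.trans ?_
  rw [ENNReal.ofReal_zero, zero_mul, add_zero, eLpNorm_norm]
  gcongr

theorem MemLpAdd.aestronglyMeasurable {F : Type*} [NormedAddCommGroup F] {f : E3 → F}
    {p r : ℝ≥0∞} {μ : Measure E3} (h : MemLpAdd f p r μ) : AEStronglyMeasurable f μ := by
  obtain ⟨g, k, hg, hk, he⟩ := h
  exact (hg.1.add hk.1).congr he.symm

/-- A function dominated by the sum of an `L^q` function, `q > 3`, and a bounded function, with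
arbitrarily small norms outside large balls. -/
def SubcriticalDecay (f : E3 → ℝ) : Prop :=
  (∃ q : ℝ≥0∞, 3 < q ∧ ∃ G H : E3 → ℝ, (∀ x, 0 ≤ G x) ∧ MemLp G q volume ∧ MemLp H ⊤ volume ∧
    ∀ᵐ x, |f x| ≤ G x + |H x|) ∧
  ∃ q : ℝ≥0∞, 3 < q ∧ ∀ ε : ℝ, 0 < ε → ∃ (R : ℝ) (G H : E3 → ℝ), (∀ x, 0 ≤ G x) ∧
    AEStronglyMeasurable G (exterior R) ∧ eLpNorm G q (exterior R) ≤ ENNReal.ofReal ε ∧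
    eLpNorm H ⊤ (exterior R) ≤ ENNReal.ofReal ε ∧ ∀ᵐ x ∂(exterior R), |f x| ≤ G x + |H x|

/-- A multiplier with subcritical decay is bounded from `L² ∩ L⁶` to `L²` by an arbitrarily small
constant, up to a term that only sees a bounded region. -/
theorem SubcriticalDecay.eLpNorm_mul_le {f : E3 → ℝ} (hf : SubcriticalDecay f) {κ : ℝ}
    (hκ : 0 < κ) : ∃ M R : ℝ, 0 ≤ M ∧ ∀ w : E3 → ℂ, AEStronglyMeasurable w volume →
      eLpNorm (fun x => (f x : ℂ) * w x) 2 volume ≤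
        ENNReal.ofReal κ * eLpNorm w 6 volume + ENNReal.ofReal κ * eLpNorm w 2 volume +
          ENNReal.ofReal M * eLpNorm ((Metric.ball (0 : E3) R).indicator w) 2 volume := by
  obtain ⟨⟨q, hq, G, H, hG0, hG, hH, hGH⟩, q', hq', hext⟩ := hf
  obtain ⟨ε, hε, hsmall⟩ := exists_eLpNorm_trunc_le_of_small hq' (T := κ / 2) (κ := κ / 2)
    (by positivity) (by positivity)
  obtain ⟨R, g, h, hg0, hgm, hg, hh, hgh⟩ := hext (min ε (κ / 2)) (by positivity)
  obtain ⟨T, hT, hTG⟩ := exists_eLpNorm_trunc_le hq (κ := κ / 2) (by positivity) volume G hG0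
    hG.2.ne
  have hS : MeasurableSet {x : E3 | R < ‖x‖} := measurableSet_lt measurable_const measurable_norm
  set S := {x : E3 | R < ‖x‖} with hSdef
  -- `b` collects the large values near infinity and everywhere; what remains of `f` is at most `κ`
  -- near infinity and at most `M` on a ball
  set b : E3 → ℝ := S.indicator (trunc (κ / 2) g) + trunc T G with hb
  have hm1 : AEStronglyMeasurable (S.indicator (trunc (κ / 2) g)) volume := by
    rw [aestronglyMeasurable_indicator_iff hS]
    exact aestronglyMeasurable_trunc _ hgm
  have hm2 : AEStronglyMeasurable (trunc T G) volume := aestronglyMeasurable_trunc _ hG.1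
  have hb3 : eLpNorm b 3 volume ≤ ENNReal.ofReal κ := by
    refine (eLpNorm_add_le hm1 hm2 (by norm_num)).trans ?_
    rw [eLpNorm_indicator_eq_eLpNorm_restrict hS]
    have h1 := hsmall (exterior R) g hg0 (hg.trans (ENNReal.ofReal_le_ofReal (min_le_left _ _)))
    calc _ ≤ ENNReal.ofReal (κ / 2) + ENNReal.ofReal (κ / 2) := add_le_add h1 hTG
      _ = ENNReal.ofReal κ := by
          rw [← ENNReal.ofReal_add (by positivity) (by positivity), add_halves]
  set M := T + (eLpNorm H ⊤ volume).toReal with hM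
  have hM0 : 0 ≤ M := add_nonneg hT.le ENNReal.toReal_nonneg
  have hgh' : ∀ᵐ x, x ∈ S → |f x| ≤ g x + |h x| := (ae_restrict_iff' hS).1 hgh
  have hh' : ∀ᵐ x, x ∈ S → |h x| ≤ κ / 2 := by
    refine (ae_restrict_iff' hS).1 ?_
    filter_upwards [ae_le_eLpNormEssSup (f := h) (μ := exterior R)] with x hx
    rw [← eLpNorm_exponent_top] at hx
    have := (hx.trans hh).trans (ENNReal.ofReal_le_ofReal (min_le_right _ _))
    rwa [Real.enorm_eq_ofReal_abs, ENNReal.ofReal_le_ofReal_iff (by positivity)] at this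
  have hle : ∀ᵐ x, |f x| ≤ b x + κ + (Metric.ball (0 : E3) (R + 1)).indicator (fun _ => M) x := by
    filter_upwards [hgh', hh', hGH, ae_le_eLpNormEssSup (f := H) (μ := volume)] with x h1 h2 h3 h4
    rw [← eLpNorm_exponent_top] at h4
    have h4 : |H x| ≤ (eLpNorm H ⊤ volume).toReal := by
      have := ENNReal.toReal_mono hH.2.ne h4
      simpa using this
    have hi : 0 ≤ (Metric.ball (0 : E3) (R + 1)).indicator (fun _ => M) x :=
      indicator_nonneg (fun _ _ => hM0) x
    have t1 := trunc_nonneg hT.le G x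
    have t2 := le_trunc_add hT.le G x
    have t3 := le_trunc_add (by positivity : (0 : ℝ) ≤ κ / 2) g x
    simp only [hb, Pi.add_apply]
    by_cases hx : x ∈ S
    · have := h1 hx
      have := h2 hx
      rw [indicator_of_mem hx]
      linarith
    · rw [indicator_of_notMem hx]
      have hxB : x ∈ Metric.ball (0 : E3) (R + 1) := by
        simp only [hSdef, mem_ofPred_eq, not_lt] at hx
        simp only [mem_ball_zero_iff]; linarith
      rw [indicator_of_mem hxB]
      rw [hM]; linarith
  refine ⟨M, R + 1, hM0, fun w hw => ?_⟩
  refine (eLpNorm_mul_le_of_le (p := 3) (q := 6) hκ.le hM0 (hm1.add hm2) hw hle).trans ?_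
  gcongr

/-- If the `L^p + L^∞` norms outside large balls tend to zero, some exterior region carries a
decomposition with two small parts. -/
theorem exists_decomposition_of_tendsto {F : Type*} [NormedAddCommGroup F] {f : E3 → F}
    {p : ℝ≥0∞} (h : Tendsto (fun R : ℝ => eLpAddNorm f p ⊤ (exterior R)) atTop (𝓝 0)) {ε : ℝ}
    (hε : 0 < ε) : ∃ (R : ℝ) (g k : E3 → F), MemLp g p (exterior R) ∧
      eLpNorm g p (exterior R) ≤ ENNReal.ofReal ε ∧ eLpNorm k ⊤ (exterior R) ≤ ENNReal.ofReal ε ∧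
      f =ᵐ[exterior R] g + k := by
  obtain ⟨R, hR⟩ := (h.eventually (gt_mem_nhds (ENNReal.ofReal_pos.2 hε))).exists
  obtain ⟨_, ⟨g, k, hg, _, he, rfl⟩, ht⟩ := sInf_lt_iff.1 hR
  exact ⟨R, g, k, hg, le_self_add.trans ht.le, le_add_self.trans ht.le, he⟩

/-- The modulus of the magnetic potential has subcritical decay. -/
theorem subcriticalDecay_norm {A : E3 → E3} {q q' : ℝ≥0∞} (hq : 3 < q) (hA : MemLpAdd A q ⊤ volume)
    (hq' : 3 < q')
    (h : Tendsto (fun R : ℝ => eLpAddNorm A q' ⊤ (exterior R)) atTop (𝓝 0)) :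
    SubcriticalDecay fun x => ‖A x‖ := by
  refine ⟨?_, q', hq', fun ε hε => ?_⟩
  · obtain ⟨g, k, hg, hk, he⟩ := hA
    refine ⟨q, hq, fun x => ‖g x‖, fun x => ‖k x‖, fun x => norm_nonneg _, hg.norm, hk.norm, ?_⟩
    filter_upwards [he] with x hx
    rw [hx, abs_norm, abs_norm]
    exact norm_add_le _ _
  · obtain ⟨R, g, k, hg, h1, h2, he⟩ := exists_decomposition_of_tendsto h hε
    refine ⟨R, fun x => ‖g x‖, fun x => ‖k x‖, fun x => norm_nonneg _, hg.1.norm,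
      by rwa [eLpNorm_norm], by rwa [eLpNorm_norm], ?_⟩
    filter_upwards [he] with x hx
    rw [hx, abs_norm, abs_norm]
    exact norm_add_le _ _

theorem eLpNorm_sqrt_norm (g : E3 → ℝ) (p : ℝ≥0∞) (ν : Measure E3) :
    eLpNorm (fun x => √|g x|) p ν = eLpNorm g (p * ENNReal.ofReal (1 / 2)) ν ^ (1 / 2 : ℝ) := by
  rw [← eLpNorm_norm_rpow _ (by norm_num)]
  simp only [Real.sqrt_eq_rpow, Real.norm_eq_abs]

theorem four_mul_half : (4 : ℝ≥0∞) * ENNReal.ofReal (1 / 2) = 2 := by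
  have h4 : (4 : ℝ≥0∞) = ENNReal.ofReal 4 := by norm_num
  rw [h4, ← ENNReal.ofReal_mul (by norm_num)]
  norm_num

theorem top_mul_half : (⊤ : ℝ≥0∞) * ENNReal.ofReal (1 / 2) = ⊤ :=
  ENNReal.top_mul (by simp)

theorem sqrt_abs_add_le (a b : ℝ) : √|a + b| ≤ √|a| + √|b| := by
  refine (Real.sqrt_le_sqrt (abs_add_le a b)).trans ?_
  rw [Real.sqrt_le_left (by positivity)]
  nlinarith [Real.sq_sqrt (abs_nonneg a), Real.sq_sqrt (abs_nonneg b), Real.sqrt_nonneg |a|,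
    Real.sqrt_nonneg |b|]

/-- The square root of the negative part of the electric potential has subcritical decay: it lies in
`L⁴ + L^∞`, and `4 > 3`. The square root enters because only the quadratic form of `V₋` has to be
small. -/
theorem subcriticalDecay_sqrt {V : E3 → ℝ} (hV : MemLpAdd V 2 ⊤ volume)
    (h : Tendsto (fun R : ℝ => eLpAddNorm (fun x => max (-V x) 0) 2 ⊤ (exterior R)) atTop (𝓝 0)) :
    SubcriticalDecay fun x => √(max (-V x) 0) := by
  have h34 : (3 : ℝ≥0∞) < 4 := by norm_num
  have hm : ∀ {g : E3 → ℝ} {ν : Measure E3}, AEStronglyMeasurable g ν →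
      AEStronglyMeasurable (fun x => √|g x|) ν := fun hg =>
    (Real.continuous_sqrt.comp continuous_abs).comp_aestronglyMeasurable hg
  refine ⟨?_, 4, h34, fun ε hε => ?_⟩
  · obtain ⟨g, k, hg, hk, he⟩ := hV
    refine ⟨4, h34, fun x => √|g x|, fun x => √|k x|, fun x => Real.sqrt_nonneg _,
      ⟨hm hg.1, ?_⟩, ⟨hm hk.1, ?_⟩, ?_⟩
    · rw [eLpNorm_sqrt_norm, four_mul_half]
      exact ENNReal.rpow_lt_top_of_nonneg (by norm_num) hg.2.ne
    · rw [eLpNorm_sqrt_norm, top_mul_half]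
      exact ENNReal.rpow_lt_top_of_nonneg (by norm_num) hk.2.ne
    · filter_upwards [he] with x hx
      rw [abs_of_nonneg (Real.sqrt_nonneg _), abs_of_nonneg (Real.sqrt_nonneg _)]
      refine le_trans (Real.sqrt_le_sqrt ?_) (sqrt_abs_add_le _ _)
      rw [hx]
      exact max_le (neg_le_abs _) (abs_nonneg _)
  · obtain ⟨R, g, k, hg, h1, h2, he⟩ := exists_decomposition_of_tendsto h
      (ε := ε ^ 2) (by positivity)
    have hp : ENNReal.ofReal (ε ^ 2) ^ (1 / 2 : ℝ) = ENNReal.ofReal ε := by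
      rw [ENNReal.ofReal_rpow_of_pos (by positivity), ← Real.sqrt_eq_rpow, Real.sqrt_sq hε.le]
    refine ⟨R, fun x => √|g x|, fun x => √|k x|, fun x => Real.sqrt_nonneg _, hm hg.1, ?_, ?_, ?_⟩
    · rw [eLpNorm_sqrt_norm, four_mul_half, ← hp]
      gcongr
    · rw [eLpNorm_sqrt_norm, top_mul_half, ← hp]
      gcongr
    · filter_upwards [he] with x hx
      rw [abs_of_nonneg (Real.sqrt_nonneg _), abs_of_nonneg (Real.sqrt_nonneg _)]
      refine le_trans (Real.sqrt_le_sqrt ?_) (sqrt_abs_add_le _ _)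
      rw [hx]
      exact le_abs_self _

/-! ### Multiplication operators from `H²` to `L²` -/

/-- The bound making `u ↦ f • D u` an operator from `H²` to `L²`. -/
def MulBdd (f : E3 → ℂ) (D : H2 →L[ℂ] L2) : Prop :=
  AEStronglyMeasurable f volume ∧ ∃ C : ℝ, ∀ u : H2,
    eLpNorm (fun x => f x * D u x) 2 volume ≤ ENNReal.ofReal (C * ‖u‖)

theorem MulBdd.memLp {f : E3 → ℂ} {D : H2 →L[ℂ] L2} (h : MulBdd f D) (u : H2) :
    MemLp (fun x => f x * D u x) 2 volume := by
  obtain ⟨hf, C, hC⟩ := h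
  exact ⟨hf.mul (Lp.aestronglyMeasurable _), (hC u).trans_lt ENNReal.ofReal_lt_top⟩

/-- The operator `u ↦ f • D u` from `H²` to `L²`. -/
def mulOp (f : E3 → ℂ) (D : H2 →L[ℂ] L2) (h : MulBdd f D) : H2 →L[ℂ] L2 :=
  LinearMap.mkContinuousOfExistsBound
    { toFun := fun u => (h.memLp u).toLp
      map_add' := fun u v => by
        apply Lp.ext
        filter_upwards [(h.memLp (u + v)).coeFn_toLp, (h.memLp u).coeFn_toLp,
          (h.memLp v).coeFn_toLp, Lp.coeFn_add (h.memLp u).toLp (h.memLp v).toLp,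
          Lp.coeFn_add (D u) (D v)] with x h1 h2 h3 h4 h5
        rw [h1, h4, Pi.add_apply, h2, h3, map_add, h5, Pi.add_apply, mul_add]
      map_smul' := fun c u => by
        apply Lp.ext
        filter_upwards [(h.memLp (c • u)).coeFn_toLp, (h.memLp u).coeFn_toLp,
          Lp.coeFn_smul c (h.memLp u).toLp, Lp.coeFn_smul c (D u)] with x h1 h2 h3 h4
        rw [h1, RingHom.id_apply, h3, Pi.smul_apply, h2, map_smul, h4, Pi.smul_apply, smul_eq_mul,
          smul_eq_mul]
        ring }
    (by
      obtain ⟨C, hC⟩ := h.2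
      refine ⟨max C 0, fun u => ?_⟩
      change ‖(h.memLp u).toLp‖ ≤ _
      rw [Lp.norm_toLp]
      refine ENNReal.toReal_le_of_le_ofReal (by positivity) ((hC u).trans ?_)
      exact ENNReal.ofReal_le_ofReal (by gcongr; exact le_max_left _ _))

theorem coeFn_mulOp {f : E3 → ℂ} {D : H2 →L[ℂ] L2} (h : MulBdd f D) (u : H2) :
    (mulOp f D h u : E3 → ℂ) =ᵐ[volume] fun x => f x * D u x :=
  (h.memLp u).coeFn_toLp

theorem norm_mulOp_le {f : E3 → ℂ} {D : H2 →L[ℂ] L2} (h : MulBdd f D) (u : H2) {c : ℝ}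
    (hc : 0 ≤ c) (hle : eLpNorm (fun x => f x * D u x) 2 volume ≤ ENNReal.ofReal c) :
    ‖mulOp f D h u‖ ≤ c := by
  change ‖(h.memLp u).toLp‖ ≤ _
  rw [Lp.norm_toLp]
  exact ENNReal.toReal_le_of_le_ofReal hc hle

theorem eLpNorm_two_eq (u : L2) : eLpNorm u 2 volume = ENNReal.ofReal ‖u‖ := by
  rw [← Lp.enorm_def, ofReal_norm]

theorem norm_jet_le (a : JetIndex) (u : H2) : ‖jet a u‖ ≤ ‖u‖ := PiLp.norm_apply_le u.1 a

theorem norm_incl_le (u : H2) : ‖incl u‖ ≤ ‖u‖ := norm_jet_le _ u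

theorem norm_gradL_le (i : Fin 3) (u : H2) : ‖gradL i u‖ ≤ ‖u‖ := norm_jet_le _ u

theorem norm_hessL_le (i j : Fin 3) (u : H2) : ‖hessL i j u‖ ≤ ‖u‖ := norm_jet_le _ u

/-- The constant of the Sobolev inequality as a real number. -/
def sobolevReal : ℝ := sobolevConst.toReal

theorem sobolevReal_nonneg : 0 ≤ sobolevReal := ENNReal.toReal_nonneg

theorem sobolevConst_mul_sum {ι : Type*} [Fintype ι] (D : ι → H2 →L[ℂ] L2) (u : H2) :
    sobolevConst * ∑ j, ‖D j u‖ₑ = ENNReal.ofReal (sobolevReal * ∑ j, ‖D j u‖) := by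
  rw [ENNReal.ofReal_mul sobolevReal_nonneg, sobolevReal,
    ENNReal.ofReal_toReal sobolevConst_ne_top,
    ENNReal.ofReal_sum_of_nonneg fun _ _ => norm_nonneg _]
  simp only [ofReal_norm]

/-- A multiplier with subcritical decay acts on gradients with an arbitrarily small constant in
front of the `H²` norm. -/
theorem SubcriticalDecay.mul_gradL_le {f : E3 → ℝ} (hf : SubcriticalDecay f) {κ : ℝ} (hκ : 0 < κ) :
    ∃ M : ℝ, 0 ≤ M ∧ ∀ (j : Fin 3) (u : H2), eLpNorm (fun x => (f x : ℂ) * gradL j u x) 2 volume ≤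
      ENNReal.ofReal (κ * ‖u‖ + M * ‖gradL j u‖) := by
  have hs := sobolevReal_nonneg
  obtain ⟨M, R, hM, h⟩ := hf.eLpNorm_mul_le (κ := κ / (3 * sobolevReal + 1)) (by positivity)
  set κ' := κ / (3 * sobolevReal + 1) with hκ'
  have hκ'0 : 0 < κ' := by positivity
  refine ⟨κ' + M, by positivity, fun j u => ?_⟩
  refine (h _ (Lp.aestronglyMeasurable _)).trans ?_
  have h1 : eLpNorm ((Metric.ball (0 : E3) R).indicator (gradL j u)) 2 volume ≤
      ENNReal.ofReal ‖gradL j u‖ := by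
    rw [← eLpNorm_two_eq]
    exact eLpNorm_indicator_le _
  have h2 := eLpNorm_gradL_six_le j u
  rw [sobolevConst_mul_sum] at h2
  calc _ ≤ ENNReal.ofReal κ' * ENNReal.ofReal (sobolevReal * ∑ i, ‖hessL j i u‖) +
        ENNReal.ofReal κ' * ENNReal.ofReal ‖gradL j u‖ +
        ENNReal.ofReal M * ENNReal.ofReal ‖gradL j u‖ := by
        rw [eLpNorm_two_eq]
        gcongr
    _ = ENNReal.ofReal (κ' * (sobolevReal * ∑ i, ‖hessL j i u‖) + κ' * ‖gradL j u‖ +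
          M * ‖gradL j u‖) := by
        have : 0 ≤ ∑ i, ‖hessL j i u‖ := Finset.sum_nonneg fun _ _ => norm_nonneg _
        rw [ENNReal.ofReal_add (by positivity) (by positivity),
          ENNReal.ofReal_add (by positivity) (by positivity),
          ENNReal.ofReal_mul hκ'0.le, ENNReal.ofReal_mul hκ'0.le, ENNReal.ofReal_mul hM]
    _ ≤ _ := by
        apply ENNReal.ofReal_le_ofReal
        have h3 : ∑ i, ‖hessL j i u‖ ≤ 3 * ‖u‖ := by
          refine (Finset.sum_le_sum fun i _ => norm_hessL_le j i u).trans ?_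
          simp
        have h4 : κ' * (sobolevReal * ∑ i, ‖hessL j i u‖) ≤ κ * ‖u‖ := by
          calc _ ≤ κ' * (sobolevReal * (3 * ‖u‖)) := by gcongr
            _ ≤ κ' * ((3 * sobolevReal + 1) * ‖u‖) := by
                refine mul_le_mul_of_nonneg_left ?_ hκ'0.le
                nlinarith [norm_nonneg u]
            _ = κ * ‖u‖ := by rw [hκ']; field_simp
        linarith

theorem eLpNorm_indicator_ball (R : ℝ) (u : L2) :
    eLpNorm ((Metric.ball (0 : E3) R).indicator u) 2 volume = ENNReal.ofReal ‖ballCLM 1 R u‖ := by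
  rw [← eLpNorm_two_eq]
  refine eLpNorm_congr_ae ?_
  filter_upwards [coeFn_ballCLM 1 R u] with x hx
  rw [hx]
  by_cases h : x ∈ Metric.ball (0 : E3) R <;> simp [h]

theorem eLpNorm_indicator_ball_mono {R R' : ℝ} (h : R ≤ R') (w : E3 → ℂ) :
    eLpNorm ((Metric.ball (0 : E3) R).indicator w) 2 volume ≤
      eLpNorm ((Metric.ball (0 : E3) R').indicator w) 2 volume := by
  refine eLpNorm_mono fun x => ?_
  by_cases hx : x ∈ Metric.ball (0 : E3) R
  · rw [indicator_of_mem hx, indicator_of_mem (Metric.ball_subset_ball h hx)]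
  · rw [indicator_of_notMem hx, norm_zero]; exact norm_nonneg _

/-- A multiplier with subcritical decay is small relative to the `H¹` norm, up to a term supported
in a ball, whose radius may be enlarged at will. -/
theorem SubcriticalDecay.mul_incl_le {f : E3 → ℝ} (hf : SubcriticalDecay f) {κ : ℝ} (hκ : 0 < κ) :
    ∃ M R₀ : ℝ, 0 ≤ M ∧ ∀ R, R₀ ≤ R → ∀ u : H2,
      eLpNorm (fun x => (f x : ℂ) * incl u x) 2 volume ≤
        ENNReal.ofReal (κ * (∑ j, ‖gradL j u‖ + ‖incl u‖) + M * ‖ballCLM 1 R (incl u)‖) := by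
  have hs := sobolevReal_nonneg
  obtain ⟨M, R₀, hM, h⟩ := hf.eLpNorm_mul_le (κ := κ / (sobolevReal + 1)) (by positivity)
  set κ' := κ / (sobolevReal + 1) with hκ'
  have hκ'0 : 0 < κ' := by positivity
  refine ⟨M, R₀, hM, fun R hR u => ?_⟩
  refine (h _ (Lp.aestronglyMeasurable _)).trans ?_
  have h1 := eLpNorm_indicator_ball_mono hR (incl u)
  rw [eLpNorm_indicator_ball R] at h1
  have h2 := eLpNorm_incl_six_le u
  rw [sobolevConst_mul_sum] at h2
  have h0 : 0 ≤ ∑ j, ‖gradL j u‖ := Finset.sum_nonneg fun _ _ => norm_nonneg _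
  calc _ ≤ ENNReal.ofReal κ' * ENNReal.ofReal (sobolevReal * ∑ j, ‖gradL j u‖) +
        ENNReal.ofReal κ' * ENNReal.ofReal ‖incl u‖ +
        ENNReal.ofReal M * ENNReal.ofReal ‖ballCLM 1 R (incl u)‖ := by
        rw [eLpNorm_two_eq]
        gcongr
    _ = ENNReal.ofReal (κ' * (sobolevReal * ∑ j, ‖gradL j u‖) + κ' * ‖incl u‖ +
          M * ‖ballCLM 1 R (incl u)‖) := by
        rw [ENNReal.ofReal_add (by positivity) (by positivity),
          ENNReal.ofReal_add (by positivity) (by positivity),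
          ENNReal.ofReal_mul hκ'0.le, ENNReal.ofReal_mul hκ'0.le, ENNReal.ofReal_mul hM]
    _ ≤ _ := by
        apply ENNReal.ofReal_le_ofReal
        have h3 : κ' * sobolevReal + κ' = κ := by rw [hκ']; field_simp
        have h4 : κ' * (sobolevReal * ∑ j, ‖gradL j u‖) ≤ κ * ∑ j, ‖gradL j u‖ := by
          rw [← mul_assoc]; gcongr; linarith
        have h5 : κ' * ‖incl u‖ ≤ κ * ‖incl u‖ := by
          gcongr; nlinarith
        linarith

/-- A multiplier in `L² + L^∞` has relative bound zero with respect to the `H²` norm. -/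
theorem MemLpAdd.mul_incl_le {v : E3 → ℝ} (hv : MemLpAdd v 2 ⊤ volume) {κ : ℝ} (hκ : 0 < κ) :
    ∃ M : ℝ, 0 ≤ M ∧ ∀ u : H2, eLpNorm (fun x => (v x : ℂ) * incl u x) 2 volume ≤
      ENNReal.ofReal (κ * ‖u‖ + M * ‖incl u‖) := by
  obtain ⟨C, hC, hsup⟩ := eLpNorm_top_le
  obtain ⟨M, hM, h⟩ := hv.eLpNorm_mul_le (κ := κ / C) (by positivity)
  refine ⟨M, hM, fun u => (h _ (Lp.aestronglyMeasurable _)).trans ?_⟩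
  calc _ ≤ ENNReal.ofReal (κ / C) * ENNReal.ofReal (C * ‖u‖) +
        ENNReal.ofReal M * ENNReal.ofReal ‖incl u‖ := by
        rw [eLpNorm_two_eq]; gcongr; exact hsup u
    _ = _ := by
        rw [ENNReal.ofReal_add (by positivity) (by positivity), ENNReal.ofReal_mul hM,
          ← ENNReal.ofReal_mul (by positivity)]
        congr 2
        field_simp

/-! ### The magnetic Schrödinger operator -/

/-- The properties of the coefficients from which all estimates follow: `divA` is the weak
divergence of `A`, the functions `|A|` and `√V₋` have subcritical decay, and `∇ · A` and `V` lie in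
`L² + L^∞`. -/
structure Admissible (A : E3 → E3) (divA V : E3 → ℝ) : Prop where
  meas : AEStronglyMeasurable A volume
  normA : SubcriticalDecay fun x => ‖A x‖
  weakDiv : HasWeakDiv A divA
  divA_mem : MemLpAdd divA 2 ⊤ volume
  V_mem : MemLpAdd V 2 ⊤ volume
  sqrtV : SubcriticalDecay fun x => √(max (-V x) 0)

theorem admissible_of_assumptions {A : E3 → E3} {divA V : E3 → ℝ}
    (hSA : SelfAdjointAssumption A divA V) (hDecay : DecayAssumption A V) :
    Admissible A divA V := by
  obtain ⟨⟨q, hq, hA⟩, hdiv, hdivm, hV⟩ := hSA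
  obtain ⟨q', hq', ht⟩ := hDecay
  have h1 := tendsto_of_tendsto_of_tendsto_of_le_of_le tendsto_const_nhds ht
    (fun _ => zero_le) (fun _ => le_self_add)
  have h2 := tendsto_of_tendsto_of_tendsto_of_le_of_le tendsto_const_nhds ht
    (fun _ => zero_le) (fun _ => le_add_self)
  exact ⟨hA.aestronglyMeasurable, subcriticalDecay_norm hq hA hq' h1, hdiv, hdivm, hV,
    subcriticalDecay_sqrt hV h2⟩

section Operator

variable {A : E3 → E3} {divA V : E3 → ℝ}

theorem Admissible.meas_coord (h : Admissible A divA V) (j : Fin 3) :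
    AEStronglyMeasurable (fun x => ((A x j : ℝ) : ℂ)) volume := by
  have : Continuous fun v : E3 => ((v j : ℝ) : ℂ) := by fun_prop
  exact this.comp_aestronglyMeasurable h.meas

theorem Admissible.meas_sqrtV (h : Admissible A divA V) :
    AEStronglyMeasurable (fun x => ((√(max (-V x) 0) : ℝ) : ℂ)) volume := by
  have : Continuous fun v : ℝ => ((√(max (-v) 0) : ℝ) : ℂ) := by fun_prop
  exact this.comp_aestronglyMeasurable h.V_mem.aestronglyMeasurable

theorem eLpNorm_coord_mul_le (j : Fin 3) (w : E3 → ℂ) :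
    eLpNorm (fun x => (A x j : ℂ) * w x) 2 volume ≤
    eLpNorm (fun x => ((‖A x‖ : ℝ) : ℂ) * w x) 2 volume := by
  refine eLpNorm_mono fun x => ?_
  rw [norm_mul, norm_mul, Complex.norm_real, Complex.norm_real, norm_norm]
  gcongr
  exact PiLp.norm_apply_le (A x) j

theorem Admissible.mulBdd_grad (h : Admissible A divA V) (i j : Fin 3) :
    MulBdd (fun x => (A x i : ℂ)) (gradL j) := by
  refine ⟨h.meas_coord i, ?_⟩
  obtain ⟨M, hM, hle⟩ := h.normA.mul_gradL_le one_pos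
  refine ⟨1 + M, fun u => (eLpNorm_coord_mul_le i _).trans ((hle j u).trans ?_)⟩
  apply ENNReal.ofReal_le_ofReal
  have := mul_le_mul_of_nonneg_left (norm_gradL_le j u) hM
  linarith

theorem SubcriticalDecay.mulBdd_of_norm_le {g : E3 → ℂ}
    (hg : AEStronglyMeasurable g volume) {f : E3 → ℝ}
    (hf : SubcriticalDecay f) (hle : ∀ x, ‖g x‖ ≤ |f x|) : MulBdd g incl := by
  refine ⟨hg, ?_⟩
  obtain ⟨M, R, hM, hb⟩ := hf.mul_incl_le one_pos
  refine ⟨4 + M * ‖ballCLM 1 R‖, fun u => ?_⟩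
  have h1 : eLpNorm (fun x => g x * incl u x) 2 volume ≤
      eLpNorm (fun x => (f x : ℂ) * incl u x) 2 volume := by
    refine eLpNorm_mono fun x => ?_
    rw [norm_mul, norm_mul, Complex.norm_real]
    gcongr
    exact hle x
  refine h1.trans ((hb R le_rfl u).trans (ENNReal.ofReal_le_ofReal ?_))
  have h2 : ∑ j, ‖gradL j u‖ ≤ 3 * ‖u‖ := by
    refine (Finset.sum_le_sum fun i _ => norm_gradL_le i u).trans ?_
    simp
  have h3 := norm_incl_le u
  have h4 : ‖ballCLM 1 R (incl u)‖ ≤ ‖ballCLM 1 R‖ * ‖u‖ :=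
    ((ballCLM 1 R).le_opNorm _).trans (by gcongr)
  have h5 := mul_le_mul_of_nonneg_left h4 hM
  linarith

theorem Admissible.mulBdd_incl (h : Admissible A divA V) (i : Fin 3) :
    MulBdd (fun x => (A x i : ℂ)) incl := by
  refine h.normA.mulBdd_of_norm_le (h.meas_coord i) fun x => ?_
  rw [Complex.norm_real, abs_norm]
  exact PiLp.norm_apply_le (A x) i

theorem Admissible.mulBdd_sqrtV (h : Admissible A divA V) :
    MulBdd (fun x => ((√(max (-V x) 0) : ℝ) : ℂ)) incl :=
  h.sqrtV.mulBdd_of_norm_le h.meas_sqrtV fun x => by rw [Complex.norm_real, Real.norm_eq_abs]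

theorem MemLpAdd.mulBdd {v : E3 → ℝ} (hv : MemLpAdd v 2 ⊤ volume) :
    MulBdd (fun x => (v x : ℂ)) incl := by
  refine ⟨Complex.continuous_ofReal.comp_aestronglyMeasurable hv.aestronglyMeasurable, ?_⟩
  obtain ⟨M, hM, hle⟩ := hv.mul_incl_le one_pos
  refine ⟨1 + M, fun u => (hle u).trans (ENNReal.ofReal_le_ofReal ?_)⟩
  have := mul_le_mul_of_nonneg_left (norm_incl_le u) hM
  linarith

/-- The operator `u ↦ A_j ∂_j u`. -/
def advOp (h : Admissible A divA V) (j : Fin 3) : H2 →L[ℂ] L2 := mulOp _ _ (h.mulBdd_grad j j)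

/-- The operator `u ↦ A_j u`. -/
def coordOp (h : Admissible A divA V) (j : Fin 3) : H2 →L[ℂ] L2 := mulOp _ _ (h.mulBdd_incl j)

/-- The operator `u ↦ √V₋ u`. -/
def sqrtOp (h : Admissible A divA V) : H2 →L[ℂ] L2 := mulOp _ _ h.mulBdd_sqrtV

/-- The operator `u ↦ (∇ · A) u`. -/
def divOp (h : Admissible A divA V) : H2 →L[ℂ] L2 := mulOp _ _ h.divA_mem.mulBdd

/-- The operator `u ↦ V u`. -/
def potOp (h : Admissible A divA V) : H2 →L[ℂ] L2 := mulOp _ _ h.V_mem.mulBdd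

/-- The part of lower order of the magnetic Schrödinger operator. -/
def lowerOp (h : Admissible A divA V) : H2 →L[ℂ] L2 :=
  (2 * Complex.I) • ∑ j, advOp h j + Complex.I • divOp h + potOp h

/-- The magnetic Schrödinger operator as a bounded operator from `H²` to `L²`. -/
def magOp (h : Admissible A divA V) : H2 →L[ℂ] L2 := lowerOp h - lapL

theorem coeFn_lapL (u : H2) : (lapL u : E3 → ℂ) =ᵐ[volume] fun x => ∑ j, u.hess j j x := by
  rw [lapL_apply]
  filter_upwards [Lp.coeFn_finsetSum Finset.univ (fun j => hessL j j u)] with x hx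
  rw [hx, Finset.sum_apply]; rfl

theorem coeFn_magOp (h : Admissible A divA V) (u : H2) :
    (magOp h u : E3 → ℂ) =ᵐ[volume] magH A divA V u := by
  have e : magOp h u = (2 * Complex.I) • (∑ j, advOp h j u) + Complex.I • divOp h u +
      potOp h u - lapL u := by
    simp [magOp, lowerOp]
  rw [e]
  have h1 : ∀ᵐ x, ∀ j, advOp h j u x = (A x j : ℂ) * u.grad j x := by
    rw [ae_all_iff]
    exact fun j => coeFn_mulOp (h.mulBdd_grad j j) u
  filter_upwards [Lp.coeFn_sub ((2 * Complex.I) • (∑ j, advOp h j u) + Complex.I • divOp h u +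
      potOp h u) (lapL u), Lp.coeFn_add ((2 * Complex.I) • (∑ j, advOp h j u) +
      Complex.I • divOp h u) (potOp h u), Lp.coeFn_add ((2 * Complex.I) • (∑ j, advOp h j u))
      (Complex.I • divOp h u), Lp.coeFn_smul (2 * Complex.I) (∑ j, advOp h j u),
      Lp.coeFn_smul Complex.I (divOp h u), Lp.coeFn_finsetSum Finset.univ (fun j => advOp h j u),
      h1, coeFn_mulOp h.divA_mem.mulBdd u, coeFn_mulOp h.V_mem.mulBdd u, coeFn_lapL u]
    with x e1 e2 e3 e4 e5 e6 e7 e8 e9 e10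
  rw [e1, Pi.sub_apply, e2, Pi.add_apply, e3, Pi.add_apply, e4, e5, Pi.smul_apply, Pi.smul_apply,
    e6, Finset.sum_apply, e10]
  rw [divOp, potOp, e8, e9]
  simp only [e7, magH, coeFn_incl, smul_eq_mul]
  ring

end Operator

/-! ### Symmetry of the magnetic Schrödinger operator -/

theorem sum_coord_smul_basisVec (v : E3) : ∑ j, v j • basisVec j = v := by
  ext i
  simp [basisVec, Finset.sum_apply, Pi.single_apply]

theorem map_eq_sum_coord {F : Type*} [NormedAddCommGroup F] [NormedSpace ℝ F] (L : E3 →L[ℝ] F)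
    (v : E3) : L v = ∑ j, v j • L (basisVec j) := by
  conv_lhs => rw [← sum_coord_smul_basisVec v]
  simp

theorem HasWeakDiv.integrable_fderiv {A : E3 → E3} {d : E3 → ℝ} (h : HasWeakDiv A d)
    {η : E3 → ℝ} (hη : ContDiff ℝ (⊤ : ℕ∞) η) (hc : HasCompactSupport η) :
    Integrable (fun x => fderiv ℝ η x (A x)) volume := by
  have e : (fun x => fderiv ℝ η x (A x)) =
      fun x => ∑ j, fderiv ℝ η x (basisVec j) • A x j := by
    ext x
    rw [map_eq_sum_coord]
    exact Finset.sum_congr rfl fun j _ => by rw [smul_eq_mul, smul_eq_mul, mul_comm]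
  rw [e]
  refine integrable_finsetSum _ fun j _ => ?_
  have hl : LocallyIntegrable (fun x => A x j) volume := by
    refine h.1.mono ?_ (ae_of_all _ fun x => PiLp.norm_apply_le (A x) j)
    have : Continuous fun v : E3 => v j := by fun_prop
    exact this.comp_aestronglyMeasurable h.1.aestronglyMeasurable
  exact hl.integrable_smul_left_of_hasCompactSupport
    ((hη.continuous_fderiv (by simp)).clm_apply continuous_const) (hc.fderiv_apply (𝕜 := ℝ) _)

/-- The weak divergence can be tested against complex-valued test functions. -/
theorem HasWeakDiv.integral_complex {A : E3 → E3} {d : E3 → ℝ} (h : HasWeakDiv A d)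
    {η : E3 → ℂ} (hη : ContDiff ℝ (⊤ : ℕ∞) η) (hc : HasCompactSupport η) :
    ∫ x, fderiv ℝ η x (A x) = - ∫ x, η x * d x := by
  have ha : ContDiff ℝ (⊤ : ℕ∞) fun x => (η x).re := Complex.reCLM.contDiff.comp hη
  have hb : ContDiff ℝ (⊤ : ℕ∞) fun x => (η x).im := Complex.imCLM.contDiff.comp hη
  have hac : HasCompactSupport fun x => (η x).re := hc.comp_left (g := Complex.re) rfl
  have hbc : HasCompactSupport fun x => (η x).im := hc.comp_left (g := Complex.im) rfl
  have hd : ∀ x v, fderiv ℝ η x v = (fderiv ℝ (fun x => (η x).re) x v : ℂ) +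
      Complex.I * (fderiv ℝ (fun x => (η x).im) x v : ℂ) := by
    intro x v
    have h1 := ((hη.differentiable (by simp)) x).hasFDerivAt
    have e1 : fderiv ℝ (fun x => (η x).re) x = Complex.reCLM.comp (fderiv ℝ η x) :=
      (Complex.reCLM.hasFDerivAt.comp x h1).fderiv
    have e2 : fderiv ℝ (fun x => (η x).im) x = Complex.imCLM.comp (fderiv ℝ η x) :=
      (Complex.imCLM.hasFDerivAt.comp x h1).fderiv
    rw [e1, e2, mul_comm]
    exact (Complex.re_add_im _).symm
  have i1 := (h.integrable_fderiv ha hac)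
  have i2 := (h.integrable_fderiv hb hbc)
  have j1 : Integrable (fun x => (η x).re * d x) volume :=
    h.2.1.integrable_smul_left_of_hasCompactSupport ha.continuous hac
  have j2 : Integrable (fun x => (η x).im * d x) volume :=
    h.2.1.integrable_smul_left_of_hasCompactSupport hb.continuous hbc
  have hη' : ∀ x, η x * d x = (((η x).re * d x : ℝ) : ℂ) +
      Complex.I * (((η x).im * d x : ℝ) : ℂ) := by
    intro x
    conv_lhs => rw [← Complex.re_add_im (η x)]
    push_cast
    ring
  simp only [hd, hη']
  rw [integral_add i1.ofReal (i2.ofReal.const_mul _), integral_const_mul, integral_complex_ofReal,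
    integral_complex_ofReal, h.2.2 _ ha hac, h.2.2 _ hb hbc,
    integral_add j1.ofReal (j2.ofReal.const_mul _), integral_const_mul, integral_complex_ofReal,
    integral_complex_ofReal]
  push_cast
  ring

theorem inner_mulOp_real {f : E3 → ℝ} (hf : MulBdd (fun x => (f x : ℂ)) incl) (u v : H2) :
    inner ℂ (incl u) (mulOp _ _ hf v) = inner ℂ (mulOp _ _ hf u) (incl v) := by
  rw [L2.inner_def, L2.inner_def]
  refine integral_congr_ae ?_
  filter_upwards [coeFn_mulOp hf u, coeFn_mulOp hf v] with x h1 h2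
  rw [h1, h2]
  simp only [RCLike.inner_apply, map_mul, Complex.conj_ofReal]
  ring

section Operator

variable {A : E3 → E3} {divA V : E3 → ℝ}

theorem inner_advOp (h : Admissible A divA V) (j : Fin 3) (u v : H2) :
    inner ℂ (incl u) (advOp h j v) = inner ℂ (coordOp h j u) (gradL j v) := by
  rw [L2.inner_def, L2.inner_def]
  refine integral_congr_ae ?_
  filter_upwards [coeFn_mulOp (h.mulBdd_grad j j) v, coeFn_mulOp (h.mulBdd_incl j) u] with x h1 h2
  rw [advOp, coordOp, h1, h2]
  simp only [RCLike.inner_apply, map_mul, Complex.conj_ofReal]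
  ring

theorem coeFn_sum_advOp_schwartzH2 (h : Admissible A divA V) (φ : 𝓢(E3, ℂ)) :
    ((∑ j, advOp h j) (schwartzH2 φ) : E3 → ℂ) =ᵐ[volume] fun x => fderiv ℝ φ x (A x) := by
  have h1 : ∀ᵐ x, ∀ j, advOp h j (schwartzH2 φ) x = (A x j : ℂ) * (∂_{basisVec j} φ) x := by
    rw [ae_all_iff]
    intro j
    filter_upwards [coeFn_mulOp (h.mulBdd_grad j j) (schwartzH2 φ),
      coeFn_schwartzL2 (∂_{basisVec j} φ)] with x h1 h2
    rw [advOp, h1, gradL_schwartzH2, h2]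
  have e : (∑ j, advOp h j) (schwartzH2 φ) = ∑ j, advOp h j (schwartzH2 φ) := by simp
  rw [e]
  filter_upwards [h1, Lp.coeFn_finsetSum Finset.univ (fun j => advOp h j (schwartzH2 φ))]
    with x h1 h2
  rw [h2, Finset.sum_apply, map_eq_sum_coord]
  refine Finset.sum_congr rfl fun j _ => ?_
  rw [h1, SchwartzMap.lineDerivOp_apply_eq_fderiv, Complex.real_smul]

theorem fderiv_conj_mul (φ ψ : 𝓢(E3, ℂ)) (x v : E3) :
    fderiv ℝ (fun x => (starRingEnd ℂ) (φ x) * ψ x) x v =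
      (starRingEnd ℂ) (φ x) * fderiv ℝ ψ x v + (starRingEnd ℂ) (fderiv ℝ φ x v) * ψ x := by
  have h1 := (φ.differentiable x).hasFDerivAt
  have h2 := (ψ.differentiable x).hasFDerivAt
  have h3 : HasFDerivAt (fun x => (starRingEnd ℂ) (φ x))
      ((Complex.conjCLE : ℂ →L[ℝ] ℂ).comp (fderiv ℝ φ x)) x :=
    (Complex.conjCLE : ℂ →L[ℝ] ℂ).hasFDerivAt.comp x h1
  rw [(h3.fun_mul h2).fderiv]
  simp [mul_comm]

/-- The first-order part `A · ∇` is antisymmetric up to the divergence term. For test functions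
`φ` and `ψ` this is the definition of the weak divergence, tested against the product of `ψ` with
the conjugate of `φ`; the general case follows by density. -/
theorem inner_sum_advOp (h : Admissible A divA V) (u v : H2) :
    inner ℂ (incl u) ((∑ j, advOp h j) v) + inner ℂ ((∑ j, advOp h j) u) (incl v) =
      - inner ℂ (incl u) (divOp h v) := by
  have hcl : ∀ v, IsClosed {u : H2 | (inner ℂ (incl u) ((∑ j, advOp h j) v) +
      inner ℂ ((∑ j, advOp h j) u) (incl v) : ℂ) = - inner ℂ (incl u) (divOp h v)} := fun v =>
    isClosed_eq (by fun_prop) (by fun_prop)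
  have hcl' : ∀ u, IsClosed {v : H2 | (inner ℂ (incl u) ((∑ j, advOp h j) v) +
      inner ℂ ((∑ j, advOp h j) u) (incl v) : ℂ) = - inner ℂ (incl u) (divOp h v)} := fun u =>
    isClosed_eq (by fun_prop) (by fun_prop)
  refine H2.induction_test (hcl v) (fun φ hφ => ?_) u
  refine H2.induction_test (hcl' (schwartzH2 φ)) (fun ψ hψ => ?_) v
  have hsm : ContDiff ℝ (⊤ : ℕ∞) fun x => (starRingEnd ℂ) (φ x) * ψ x :=
    ((Complex.conjCLE : ℂ →L[ℝ] ℂ).contDiff.comp (φ.smooth ⊤)).mul (ψ.smooth ⊤)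
  have hcs : HasCompactSupport fun x => (starRingEnd ℂ) (φ x) * ψ x := hψ.mul_left
  have key := h.weakDiv.integral_complex hsm hcs
  rw [L2.inner_def, L2.inner_def, L2.inner_def, ← integral_add (L2.integrable_inner _ _)
    (L2.integrable_inner _ _)]
  refine Eq.trans ?_ (key.trans ?_)
  · refine integral_congr_ae ?_
    filter_upwards [coeFn_sum_advOp_schwartzH2 h φ, coeFn_sum_advOp_schwartzH2 h ψ,
      coeFn_schwartzL2 φ, coeFn_schwartzL2 ψ] with x h1 h2 h3 h4
    rw [h1, h2, incl_schwartzH2, incl_schwartzH2, h3, h4, fderiv_conj_mul]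
    simp only [RCLike.inner_apply]
    ring
  · congr 1
    refine integral_congr_ae ?_
    filter_upwards [coeFn_mulOp h.divA_mem.mulBdd (schwartzH2 ψ),
      coeFn_schwartzL2 φ, coeFn_schwartzL2 ψ] with x h1 h3 h4
    rw [divOp, h1, incl_schwartzH2, incl_schwartzH2, h3, h4]
    simp only [RCLike.inner_apply]
    ring

/-- The magnetic Schrödinger operator is symmetric: the term `i (∇ · A)` compensates the failure of
`2i A · ∇` to be symmetric. -/
theorem inner_magOp (h : Admissible A divA V) (u v : H2) :
    inner ℂ (incl u) (magOp h v) = inner ℂ (magOp h u) (incl v) := by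
  have h1 := inner_sum_advOp h u v
  have h2 : inner ℂ (incl u) (divOp h v) = inner ℂ (divOp h u) (incl v) := inner_mulOp_real _ u v
  have h3 : inner ℂ (incl u) (potOp h v) = inner ℂ (potOp h u) (incl v) := inner_mulOp_real _ u v
  have h4 : inner ℂ (incl u) (lapL v) = inner ℂ (lapL u) (incl v) := by
    rw [← inner_conj_symm (lapL u), inner_lapL, inner_lapL]
    simp only [map_neg, map_sum, inner_conj_symm]
  have e : ∀ w, magOp h w = (2 * Complex.I) • ((∑ j, advOp h j) w) + Complex.I • divOp h w +
      potOp h w - lapL w := fun w => by simp [magOp, lowerOp]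
  rw [e u, e v]
  simp only [inner_sub_left, inner_sub_right, inner_add_left, inner_add_right, inner_smul_left,
    inner_smul_right, map_mul, Complex.conj_I, map_ofNat]
  rw [h3, h4, ← h2]
  linear_combination (2 * Complex.I) * h1

/-! ### Lower bounds and relative bounds -/

theorem sq_sum_gradL_le (u : H2) : (∑ j, ‖gradL j u‖) ^ 2 ≤ 3 * ∑ j, ‖gradL j u‖ ^ 2 := by
  have := sq_sum_le_card_mul_sum_sq (s := Finset.univ) (f := fun j : Fin 3 => ‖gradL j u‖)
  simpa using this

theorem re_inner_lapL (u : H2) :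
    (inner ℂ (incl u) (lapL u) : ℂ).re = - ∑ j, ‖gradL j u‖ ^ 2 := by
  rw [inner_lapL]
  simp only [inner_self_eq_norm_sq_to_K]
  rw [← Complex.ofReal_re (-∑ j, ‖gradL j u‖ ^ 2)]
  congr 1
  push_cast
  rfl

/-- The term `i (∇ · A)` does not contribute to the real part of the quadratic form. -/
theorem re_inner_divOp (h : Admissible A divA V) (u : H2) :
    (inner ℂ (incl u) (Complex.I • divOp h u) : ℂ).re = 0 := by
  have h2 : inner ℂ (incl u) (divOp h u) = inner ℂ (divOp h u) (incl u) := inner_mulOp_real _ u u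
  have h3 : (inner ℂ (incl u) (divOp h u) : ℂ).im = 0 := by
    have := congrArg Complex.im h2
    rw [← inner_conj_symm (divOp h u) (incl u), Complex.conj_im] at this
    linarith
  rw [inner_smul_right]
  simp [h3]

/-- The quadratic form of `V` is at least that of `-V₋`. -/
theorem neg_norm_sqrtOp_le (h : Admissible A divA V) (u : H2) :
    - ‖sqrtOp h u‖ ^ 2 ≤ (inner ℂ (incl u) (potOp h u) : ℂ).re := by
  have h1 : (inner ℂ (incl u) (potOp h u) : ℂ).re + ‖sqrtOp h u‖ ^ 2 =
      (inner ℂ (incl u) (potOp h u) + inner ℂ (sqrtOp h u) (sqrtOp h u) : ℂ).re := by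
    rw [Complex.add_re, inner_self_eq_norm_sq_to_K]
    congr 1
    norm_cast
  have h2 : 0 ≤ (inner ℂ (incl u) (potOp h u) + inner ℂ (sqrtOp h u) (sqrtOp h u) : ℂ).re := by
    rw [L2.inner_def, L2.inner_def, ← integral_add (L2.integrable_inner _ _)
      (L2.integrable_inner _ _)]
    have hi := (L2.integrable_inner (𝕜 := ℂ) (incl u) (potOp h u)).add
      (L2.integrable_inner (𝕜 := ℂ) (sqrtOp h u) (sqrtOp h u))
    have := integral_re hi
    simp only [Pi.add_apply, RCLike.re_eq_complex_re] at this
    rw [← this]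
    refine integral_nonneg_of_ae ?_
    filter_upwards [coeFn_mulOp h.V_mem.mulBdd u, coeFn_mulOp h.mulBdd_sqrtV u] with x h1 h2
    rw [potOp, sqrtOp, h1, h2]
    have h3 : ((√(max (-V x) 0) : ℝ) : ℂ) * ((√(max (-V x) 0) : ℝ) : ℂ) = (max (-V x) 0 : ℝ) := by
      rw [← Complex.ofReal_mul, Real.mul_self_sqrt (le_max_right _ _)]
    have h4 : (inner ℂ (incl u x) ((V x : ℂ) * incl u x) +
        inner ℂ (((√(max (-V x) 0) : ℝ) : ℂ) * incl u x)
          (((√(max (-V x) 0) : ℝ) : ℂ) * incl u x) : ℂ) =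
        (((V x + max (-V x) 0) * Complex.normSq (incl u x) : ℝ) : ℂ) := by
      simp only [RCLike.inner_apply, map_mul, Complex.conj_ofReal]
      push_cast [Complex.normSq_eq_conj_mul_self]
      linear_combination (incl u x * (starRingEnd ℂ) (incl u x)) * h3
    rw [h4, Complex.ofReal_re]
    exact mul_nonneg (by linarith [le_max_left (-V x) 0]) (Complex.normSq_nonneg _)
  linarith

theorem inner_ballCLM (W R : ℝ) (f : L2) :
    (inner ℂ f (ballCLM W R f) : ℂ).re = W * ‖ballCLM 1 R f‖ ^ 2 := by
  have : (inner ℂ f (ballCLM W R f) : ℂ) = W * inner ℂ (ballCLM 1 R f) (ballCLM 1 R f) := by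
    rw [L2.inner_def, L2.inner_def, ← integral_const_mul]
    refine integral_congr_ae ?_
    filter_upwards [coeFn_ballCLM W R f, coeFn_ballCLM 1 R f] with x h1 h2
    rw [h1, h2]
    by_cases hx : x ∈ Metric.ball (0 : E3) R
    · simp only [indicator_of_mem hx, RCLike.inner_apply, map_mul, map_one]
      ring
    · simp [hx]
  rw [this, inner_self_eq_norm_sq_to_K, Complex.re_ofReal_mul]
  congr 1
  norm_cast

/-- Lower bound for the quadratic form of `2i A · ∇`, by moving `A` to the other argument. -/
theorem re_inner_sum_advOp (h : Admissible A divA V) (u : H2) {s : ℝ}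
    (hs : ∀ j, ‖coordOp h j u‖ ≤ s) : -(2 * s * ∑ j, ‖gradL j u‖) ≤
      (inner ℂ (incl u) ((2 * Complex.I) • ((∑ j, advOp h j) u)) : ℂ).re := by
  have h1 : ‖(inner ℂ (incl u) ((2 * Complex.I) • ((∑ j, advOp h j) u)) : ℂ)‖ ≤
      2 * s * ∑ j, ‖gradL j u‖ := by
    rw [inner_smul_right, sum_apply, inner_sum, norm_mul]
    have : ‖(2 * Complex.I : ℂ)‖ = 2 := by simp
    rw [this, mul_assoc, Finset.mul_sum]
    gcongr
    refine (norm_sum_le _ _).trans (Finset.sum_le_sum fun j _ => ?_)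
    rw [inner_advOp]
    exact (norm_inner_le_norm _ _).trans (by gcongr; exact hs j)
  exact (neg_le_neg h1).trans (neg_le_of_abs_le (Complex.abs_re_le_norm _))

theorem norm_coordOp_le (h : Admissible A divA V) (j : Fin 3) (u : H2) {c : ℝ} (hc : 0 ≤ c)
    (hle : eLpNorm (fun x => ((‖A x‖ : ℝ) : ℂ) * incl u x) 2 volume ≤ ENNReal.ofReal c) :
    ‖coordOp h j u‖ ≤ c :=
  norm_mulOp_le (h.mulBdd_incl j) u hc ((eLpNorm_coord_mul_le j _).trans hle)

theorem norm_sqrtOp_le (h : Admissible A divA V) (u : H2) {c : ℝ} (hc : 0 ≤ c)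
    (hle : eLpNorm (fun x => ((√(max (-V x) 0) : ℝ) : ℂ) * incl u x) 2 volume ≤
      ENNReal.ofReal c) : ‖sqrtOp h u‖ ≤ c :=
  norm_mulOp_le h.mulBdd_sqrtV u hc hle

/-- The absorption argument of Gårding's inequality. Here `G` and `N` are the sum of the norms of
the partial derivatives and the sum of their squares, `n` is the `L²` norm, `m` is the contribution
of a ball, and `κ (G + n) + m` bounds `A u` and `√V₋ u`. -/
theorem garding_arith {κ ε G N n m : ℝ} (hκ0 : 0 < κ) (hκ1 : κ ≤ 1 / 100) (hκ2 : κ ≤ ε / 2)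
    (hN : G ^ 2 ≤ 3 * N) : 1 / 2 * N - ε * n ^ 2 ≤
      N - 2 * (κ * (G + n) + m) * G - (κ * (G + n) + m) ^ 2 + 27 * m ^ 2 := by
  have b5 : 2 * (κ * (G + n) + m) * G ≤ 3 * κ * G ^ 2 + κ * n ^ 2 + 24 * m ^ 2 + G ^ 2 / 24 := by
    nlinarith [mul_nonneg hκ0.le (sq_nonneg (n - G)), sq_nonneg (24 * m - G)]
  have b6 : (κ * (G + n) + m) ^ 2 ≤ 3 * (κ ^ 2 * G ^ 2 + κ ^ 2 * n ^ 2 + m ^ 2) := by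
    nlinarith [sq_nonneg (κ * G - κ * n), sq_nonneg (κ * G - m), sq_nonneg (κ * n - m)]
  have k1 : κ ^ 2 ≤ κ / 100 := by nlinarith
  have b7 : κ ^ 2 * G ^ 2 ≤ κ / 100 * G ^ 2 := by gcongr
  have b8 : κ * G ^ 2 ≤ 1 / 100 * G ^ 2 := by gcongr
  have b9 : κ ^ 2 * n ^ 2 ≤ κ / 100 * n ^ 2 := by gcongr
  have b10 : κ * n ^ 2 ≤ ε / 2 * n ^ 2 := by gcongr
  have b11 : 0 ≤ κ * n ^ 2 := by positivity
  linarith [sq_nonneg G]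

/-- Gårding's inequality: up to a repulsive potential of bounded support, the operator is bounded
below by half of the Laplacian and an arbitrarily small negative constant. -/
theorem exists_le_re_inner_magOp (h : Admissible A divA V) {ε : ℝ} (hε : 0 < ε) :
    ∃ W R : ℝ, 0 ≤ W ∧ ∀ u : H2, 1 / 2 * ∑ j, ‖gradL j u‖ ^ 2 - ε * ‖incl u‖ ^ 2 ≤
      (inner ℂ (incl u) (magOp h u) : ℂ).re + W * ‖ballCLM 1 R (incl u)‖ ^ 2 := by
  set κ : ℝ := min (1 / 100) (ε / 2) with hκ
  have hκ0 : 0 < κ := by positivity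
  obtain ⟨M₁, R₁, hM₁, h1⟩ := h.normA.mul_incl_le hκ0
  obtain ⟨M₂, R₂, hM₂, h2⟩ := h.sqrtV.mul_incl_le hκ0
  have hM : 0 ≤ max M₁ M₂ := hM₁.trans (le_max_left _ _)
  refine ⟨27 * (max M₁ M₂) ^ 2, max R₁ R₂, by positivity, fun u => ?_⟩
  have hG0 : 0 ≤ ∑ j, ‖gradL j u‖ := Finset.sum_nonneg fun _ _ => norm_nonneg _
  have hb0 : 0 ≤ ‖ballCLM 1 (max R₁ R₂) (incl u)‖ := norm_nonneg _
  have hs0 : 0 ≤ κ * (∑ j, ‖gradL j u‖ + ‖incl u‖) +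
      max M₁ M₂ * ‖ballCLM 1 (max R₁ R₂) (incl u)‖ :=
    add_nonneg (mul_nonneg hκ0.le (add_nonneg hG0 (norm_nonneg _))) (mul_nonneg hM hb0)
  have hc := fun j => norm_coordOp_le h j u hs0 ((h1 _ (le_max_left _ R₂) u).trans
    (ENNReal.ofReal_le_ofReal (add_le_add le_rfl
      (mul_le_mul_of_nonneg_right (le_max_left M₁ M₂) hb0))))
  have hq := norm_sqrtOp_le h u hs0 ((h2 _ (le_max_right R₁ _) u).trans
    (ENNReal.ofReal_le_ofReal (add_le_add le_rfl
      (mul_le_mul_of_nonneg_right (le_max_right M₁ M₂) hb0))))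
  have e : magOp h u = (2 * Complex.I) • ((∑ j, advOp h j) u) + Complex.I • divOp h u +
      potOp h u - lapL u := by simp [magOp, lowerOp]
  rw [e, inner_sub_right, inner_add_right, inner_add_right, Complex.sub_re, Complex.add_re,
    Complex.add_re, re_inner_divOp, re_inner_lapL]
  have b1 := re_inner_sum_advOp h u hc
  have b2 := neg_norm_sqrtOp_le h u
  have b3 := pow_le_pow_left₀ (norm_nonneg _) hq 2
  have b4 := garding_arith (n := ‖incl u‖)
    (m := max M₁ M₂ * ‖ballCLM 1 (max R₁ R₂) (incl u)‖) hκ0 (min_le_left _ _) (min_le_right _ _)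
    (sq_sum_gradL_le u)
  have b5 : 27 * (max M₁ M₂) ^ 2 * ‖ballCLM 1 (max R₁ R₂) (incl u)‖ ^ 2 =
      27 * (max M₁ M₂ * ‖ballCLM 1 (max R₁ R₂) (incl u)‖) ^ 2 := by ring
  rw [b5]
  linarith

theorem norm_lapL_le (u : H2) : ‖lapL u‖ ≤ 3 * ‖u‖ := by
  rw [lapL_apply]
  refine (norm_sum_le _ _).trans ((Finset.sum_le_sum fun j _ => norm_hessL_le j j u).trans ?_)
  simp

/-- Interpolation: the gradient is bounded by a small multiple of the `H²` norm and the `L²`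
norm. -/
theorem norm_gradL_interpolation {τ : ℝ} (hτ : 0 < τ) (j : Fin 3) (u : H2) :
    ‖gradL j u‖ ≤ τ * ‖u‖ + 3 / (4 * τ) * ‖incl u‖ := by
  have h1 : ‖gradL j u‖ ^ 2 ≤ ∑ j, ‖gradL j u‖ ^ 2 :=
    Finset.single_le_sum (f := fun j => ‖gradL j u‖ ^ 2) (fun _ _ => sq_nonneg _)
      (Finset.mem_univ j)
  have h2 : ∑ j, ‖gradL j u‖ ^ 2 ≤ ‖incl u‖ * (3 * ‖u‖) := by
    have e := re_inner_lapL u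
    have e2 : ‖(inner ℂ (incl u) (lapL u) : ℂ)‖ ≤ ‖incl u‖ * (3 * ‖u‖) :=
      (norm_inner_le_norm _ _).trans (by gcongr; exact norm_lapL_le u)
    have e3 := Complex.abs_re_le_norm (inner ℂ (incl u) (lapL u))
    have e4 := neg_le_abs (inner ℂ (incl u) (lapL u) : ℂ).re
    linarith
  have h3 : 4 * ((τ * ‖u‖) * (3 / (4 * τ) * ‖incl u‖)) = ‖incl u‖ * (3 * ‖u‖) := by
    field_simp
  refine abs_le_of_sq_le_sq' ?_ (by positivity) |>.2
  nlinarith [sq_nonneg (τ * ‖u‖ - 3 / (4 * τ) * ‖incl u‖)]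

/-- The operator `A_j ∂_j` has relative bound zero with respect to the Laplacian. -/
theorem exists_norm_advOp_le (h : Admissible A divA V) {κ : ℝ} (hκ : 0 < κ) :
    ∃ M : ℝ, 0 ≤ M ∧ ∀ (j : Fin 3) (u : H2), ‖advOp h j u‖ ≤ κ * ‖u‖ + M * ‖incl u‖ := by
  obtain ⟨M, hM, hle⟩ := h.normA.mul_gradL_le (κ := κ / 2) (by positivity)
  set τ := κ / (2 * (M + 1)) with hτ
  have hτ0 : 0 < τ := by positivity
  refine ⟨M * (3 / (4 * τ)), by positivity, fun j u => ?_⟩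
  have h1 : ‖advOp h j u‖ ≤ κ / 2 * ‖u‖ + M * ‖gradL j u‖ :=
    norm_mulOp_le _ u (by positivity) ((eLpNorm_coord_mul_le j _).trans (hle j u))
  have h2 := mul_le_mul_of_nonneg_left (norm_gradL_interpolation hτ0 j u) hM
  have h3 : M * (τ * ‖u‖) ≤ κ / 2 * ‖u‖ := by
    rw [← mul_assoc]
    gcongr
    rw [hτ, mul_div_assoc', div_le_div_iff₀ (by positivity) (by positivity)]
    nlinarith
  linarith

/-- The lower-order part of the operator has relative bound zero with respect to the Laplacian. -/
theorem exists_norm_lowerOp_le (h : Admissible A divA V) {κ : ℝ} (hκ : 0 < κ) :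
    ∃ M : ℝ, 0 ≤ M ∧ ∀ u : H2, ‖lowerOp h u‖ ≤ κ * ‖u‖ + M * ‖incl u‖ := by
  obtain ⟨M₁, hM₁, h1⟩ := exists_norm_advOp_le h (κ := κ / 12) (by positivity)
  obtain ⟨M₂, hM₂, h2⟩ := h.divA_mem.mul_incl_le (κ := κ / 4) (by positivity)
  obtain ⟨M₃, hM₃, h3⟩ := h.V_mem.mul_incl_le (κ := κ / 4) (by positivity)
  refine ⟨6 * M₁ + M₂ + M₃, by positivity, fun u => ?_⟩
  have e : lowerOp h u = (2 * Complex.I) • (∑ j, advOp h j u) + Complex.I • divOp h u +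
      potOp h u := by simp [lowerOp]
  have a1 : ‖∑ j, advOp h j u‖ ≤ 3 * (κ / 12 * ‖u‖ + M₁ * ‖incl u‖) := by
    refine (norm_sum_le _ _).trans ((Finset.sum_le_sum fun j _ => h1 j u).trans_eq ?_)
    rw [Finset.sum_const, Finset.card_univ, Fintype.card_fin, nsmul_eq_mul]
    norm_num
  have a2 : ‖divOp h u‖ ≤ κ / 4 * ‖u‖ + M₂ * ‖incl u‖ :=
    norm_mulOp_le _ u (by positivity) (h2 u)
  have a3 : ‖potOp h u‖ ≤ κ / 4 * ‖u‖ + M₃ * ‖incl u‖ :=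
    norm_mulOp_le _ u (by positivity) (h3 u)
  rw [e]
  refine (norm_add₃_le).trans ?_
  rw [norm_smul, norm_smul]
  have e1 : ‖(2 * Complex.I : ℂ)‖ = 2 := by simp
  rw [e1, Complex.norm_I]
  linarith

end Operator

/-! ### Invertibility of the operator with a repulsive core -/

section Perturbation

variable {X Y : Type*} [NormedAddCommGroup X] [NormedSpace ℂ X] [CompleteSpace X]
  [NormedAddCommGroup Y] [NormedSpace ℂ Y]

/-- Neumann series: invertibility is stable under small perturbations. -/
theorem exists_equiv_add (e : X ≃L[ℂ] Y) (P : X →L[ℂ] Y) {C : ℝ} (hC : ∀ u, ‖u‖ ≤ C * ‖e u‖)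
    (h0 : 0 ≤ C) (h : C * ‖P‖ < 1) : ∃ e' : X ≃L[ℂ] Y, (e' : X →L[ℂ] Y) = e + P := by
  have hs : ‖-((e.symm : Y →L[ℂ] X) ∘L P)‖ < 1 := by
    rw [norm_neg]
    refine lt_of_le_of_lt (ContinuousLinearMap.opNorm_le_bound _ (by positivity) fun u => ?_) h
    refine (hC _).trans ?_
    have : e (((e.symm : Y →L[ℂ] X) ∘L P) u) = P u := by simp
    rw [this, mul_assoc]
    gcongr
    exact P.le_opNorm u
  refine ⟨(ContinuousLinearEquiv.unitsEquiv ℂ X (Units.oneSub _ hs)).trans e, ?_⟩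
  ext u
  change e ((1 - -((e.symm : Y →L[ℂ] X) ∘L P)) u) = _
  simp

/-- Invertibility is stable under small perturbations, with smallness in terms of a bound. -/
theorem exists_equiv_add_of_bound (e : X ≃L[ℂ] Y) (P : X →L[ℂ] Y) {C c : ℝ}
    (hC : ∀ u, ‖u‖ ≤ C * ‖e u‖) (h0 : 0 ≤ C) (hc : 0 ≤ c) (hP : ∀ u, ‖P u‖ ≤ c * ‖u‖)
    (h : C * c < 1) : ∃ e' : X ≃L[ℂ] Y, (e' : X →L[ℂ] Y) = e + P :=
  exists_equiv_add e P hC h0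
    ((mul_le_mul_of_nonneg_left (P.opNorm_le_bound hc hP) h0).trans_lt h)

/-- The method of continuity: an a priori bound along a segment of operators starting at an
isomorphism makes the end point an isomorphism. -/
theorem exists_equiv_of_apriori (e : X ≃L[ℂ] Y) (T : X →L[ℂ] Y) {C : ℝ} (h0 : 0 ≤ C)
    (hC : ∀ t : ℝ, 0 ≤ t → t ≤ 1 → ∀ u, ‖u‖ ≤ C * ‖e u + (t : ℂ) • (T u - e u)‖) :
    ∃ e' : X ≃L[ℂ] Y, (e' : X →L[ℂ] Y) = T := by
  -- cut the segment into pieces short enough for the Neumann series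
  obtain ⟨N, hN⟩ := exists_nat_gt (C * ‖T - (e : X →L[ℂ] Y)‖)
  have hN0 : (0 : ℝ) < N := lt_of_le_of_lt (by positivity) hN
  have hstep : ∀ k : ℕ, k ≤ N → ∃ e' : X ≃L[ℂ] Y,
      (e' : X →L[ℂ] Y) = e + ((k / N : ℝ) : ℂ) • (T - (e : X →L[ℂ] Y)) := by
    intro k
    induction k with
    | zero => exact fun _ => ⟨e, by simp⟩
    | succ k ih =>
      intro hk
      obtain ⟨e', he'⟩ := ih (by omega)
      have hb : ∀ u, ‖u‖ ≤ C * ‖e' u‖ := by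
        intro u
        have h1 : e' u = e u + ((k / N : ℝ) : ℂ) • (T u - e u) := by
          have := congrArg (fun L : X →L[ℂ] Y => L u) he'
          simpa using this
        rw [h1]
        refine hC _ (by positivity) ?_ u
        rw [div_le_one hN0]
        exact_mod_cast (by omega : k ≤ N)
      obtain ⟨e'', he''⟩ := exists_equiv_add e' (((1 / N : ℝ) : ℂ) • (T - (e : X →L[ℂ] Y))) hb h0
        (by
          rw [norm_smul, Complex.norm_real, Real.norm_of_nonneg (by positivity)]
          have : C * (1 / N * ‖T - (e : X →L[ℂ] Y)‖) = C * ‖T - (e : X →L[ℂ] Y)‖ / N := by ring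
          rw [this, div_lt_one hN0]
          exact hN)
      refine ⟨e'', ?_⟩
      rw [he'', he', add_assoc, ← add_smul]
      congr 2
      push_cast
      ring
  obtain ⟨e', he'⟩ := hstep N le_rfl
  refine ⟨e', ?_⟩
  rw [he', div_self hN0.ne']
  simp

end Perturbation

instance : CompleteSpace H2 :=
  (completeSpace_congr (e := oneSubLap.toEquiv) oneSubLap.isUniformEmbedding).2 inferInstance

section Operator

variable {A : E3 → E3} {divA V : E3 → ℝ}

theorem magOp_apply (h : Admissible A divA V) (u : H2) :
    magOp h u = lowerOp h u - lapL u := rfl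

/-- The operator `H + W 1_{|x| < R} - e₀`. -/
def wellOp (h : Admissible A divA V) (e₀ W R : ℝ) : H2 →L[ℂ] L2 :=
  magOp h + ballCLM W R ∘L incl - (e₀ : ℂ) • incl

theorem wellOp_apply (h : Admissible A divA V) (e₀ W R : ℝ) (u : H2) :
    wellOp h e₀ W R u = magOp h u + ballCLM W R (incl u) - (e₀ : ℂ) • incl u := rfl

/-- A suitable repulsive potential on a ball pushes the spectrum above `e₀ < 0`, so that the
resulting operator is invertible. The proof follows the segment from `1 - Δ` to `wellOp`:
coercivity bounds the `L²` norm of `u` by that of the image `y`, and since the lower-order terms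
have relative bound zero, this bounds the `H²` norm as well. -/
theorem exists_wellOp_equiv (h : Admissible A divA V) {e₀ : ℝ} (he₀ : e₀ < 0) :
    ∃ (W R : ℝ) (T : H2 ≃L[ℂ] L2), (T : H2 →L[ℂ] L2) = wellOp h e₀ W R := by
  obtain ⟨W, R, hW, hG⟩ := exists_le_re_inner_magOp h (ε := -e₀ / 2) (by linarith)
  refine ⟨W, R, ?_⟩
  set c : ℝ := min 1 (-e₀ / 2) with hc
  have hc0 : 0 < c := lt_min one_pos (by linarith)
  set C₀ : ℝ := ‖(oneSubLap.symm : L2 →L[ℂ] H2)‖ + 1 with hC₀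
  have hC₀0 : 0 < C₀ := by positivity
  have hb0 : ∀ u, ‖u‖ ≤ C₀ * ‖oneSubLap u‖ := by
    intro u
    have := (oneSubLap.symm : L2 →L[ℂ] H2).le_opNorm (oneSubLap u)
    simp only [ContinuousLinearEquiv.coe_coe, ContinuousLinearEquiv.symm_apply_apply] at this
    refine this.trans ?_
    gcongr
    linarith
  obtain ⟨M, hM, hlow⟩ := exists_norm_lowerOp_le h (κ := 1 / (2 * C₀)) (by positivity)
  set M' : ℝ := M + ‖ballCLM W R‖ + ‖((e₀ + 1 : ℝ) : ℂ)‖ with hM'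
  have hM'0 : 0 ≤ M' := by positivity
  have hB : ∀ u, ‖wellOp h e₀ W R u - oneSubLap u‖ ≤ 1 / (2 * C₀) * ‖u‖ + M' * ‖incl u‖ := by
    intro u
    have e : wellOp h e₀ W R u - oneSubLap u = lowerOp h u + ballCLM W R (incl u) -
        ((e₀ + 1 : ℝ) : ℂ) • incl u := by
      rw [wellOp_apply, oneSubLap_apply, magOp_apply]
      push_cast
      rw [add_smul, one_smul]
      abel
    rw [e]
    refine (norm_sub_le _ _).trans ((add_le_add_left (norm_add_le _ _) _).trans ?_)
    rw [norm_smul]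
    have := hlow u
    have := (ballCLM W R).le_opNorm (incl u)
    rw [hM', add_mul, add_mul]
    linarith
  refine exists_equiv_of_apriori oneSubLap (wellOp h e₀ W R) (C := 2 * C₀ * (1 + M' / c))
    (by positivity) fun t ht0 ht1 u => ?_
  set y := oneSubLap u + (t : ℂ) • (wellOp h e₀ W R u - oneSubLap u) with hy
  have hre1 : (inner ℂ (incl u) (oneSubLap u) : ℂ).re = ‖incl u‖ ^ 2 + ∑ j, ‖gradL j u‖ ^ 2 := by
    rw [oneSubLap_apply, inner_sub_right, Complex.sub_re, re_inner_lapL,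
      inner_self_eq_norm_sq_to_K]
    rw [sub_neg_eq_add]
    congr 1
    exact Complex.ofReal_re (‖incl u‖ ^ 2) ▸ congrArg Complex.re (Complex.ofReal_pow _ _).symm
  have hN0 : 0 ≤ ∑ j, ‖gradL j u‖ ^ 2 := Finset.sum_nonneg fun _ _ => sq_nonneg _
  have hre2 : -e₀ / 2 * ‖incl u‖ ^ 2 ≤ (inner ℂ (incl u) (wellOp h e₀ W R u) : ℂ).re := by
    rw [wellOp_apply, inner_sub_right, inner_add_right, inner_smul_right, Complex.sub_re,
      Complex.add_re, inner_ballCLM, Complex.re_ofReal_mul, inner_self_eq_norm_sq_to_K]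
    have := hG u
    have e : (((‖incl u‖ : ℝ) : ℂ) ^ 2).re = ‖incl u‖ ^ 2 := by norm_cast
    have e' : ((RCLike.ofReal ‖incl u‖ : ℂ) ^ 2).re = ‖incl u‖ ^ 2 := e
    rw [e']
    linarith
  have hre : c * ‖incl u‖ ^ 2 ≤ (inner ℂ (incl u) y : ℂ).re := by
    rw [hy, inner_add_right, inner_smul_right, inner_sub_right, Complex.add_re,
      Complex.re_ofReal_mul, Complex.sub_re, hre1]
    have h1 : c * ‖incl u‖ ^ 2 ≤ ‖incl u‖ ^ 2 + ∑ j, ‖gradL j u‖ ^ 2 := by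
      nlinarith [min_le_left 1 (-e₀ / 2), sq_nonneg ‖incl u‖]
    have h2 : c * ‖incl u‖ ^ 2 ≤ (inner ℂ (incl u) (wellOp h e₀ W R u) : ℂ).re :=
      (mul_le_mul_of_nonneg_right (min_le_right _ _) (sq_nonneg _)).trans hre2
    nlinarith
  have hinc : ‖incl u‖ ≤ ‖y‖ / c := by
    rw [le_div_iff₀ hc0]
    by_contra! hlt
    have h1 := (Complex.abs_re_le_norm _).trans (norm_inner_le_norm (𝕜 := ℂ) (incl u) y)
    have h2 := hre.trans ((le_abs_self _).trans h1)
    have h3 : 0 < ‖incl u‖ := by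
      rcases (norm_nonneg (incl u)).lt_or_eq with h | h
      · exact h
      · rw [← h, zero_mul] at hlt
        exact absurd hlt (norm_nonneg _).not_gt
    nlinarith
  have h1 : oneSubLap u = y - (t : ℂ) • (wellOp h e₀ W R u - oneSubLap u) := by rw [hy]; abel
  have h2 : ‖oneSubLap u‖ ≤ ‖y‖ + (1 / (2 * C₀) * ‖u‖ + M' * (‖y‖ / c)) := by
    rw [h1]
    refine (norm_sub_le _ _).trans (add_le_add le_rfl ?_)
    rw [norm_smul, Complex.norm_real, Real.norm_of_nonneg ht0]
    refine (mul_le_of_le_one_left (norm_nonneg _) ht1).trans ((hB u).trans ?_)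
    gcongr
  have h3 := (hb0 u).trans (mul_le_mul_of_nonneg_left h2 hC₀0.le)
  have h4 : C₀ * (‖y‖ + (1 / (2 * C₀) * ‖u‖ + M' * (‖y‖ / c))) =
      ‖u‖ / 2 + C₀ * (1 + M' / c) * ‖y‖ := by
    field_simp
    ring
  rw [h4] at h3
  linarith

end Operator

/-! ### The Fredholm alternative at the eigenvalue -/

section Operator

variable {A : E3 → E3} {divA V : E3 → ℝ}

/-- A nondegenerate eigenvalue `e₀` of the magnetic Schrödinger operator with normalized
eigenfunction `φ₀`. -/
structure SimpleEigenvalue (h : Admissible A divA V) (e₀ : ℝ) (φ₀ : H2) : Prop where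
  norm_eq : ‖incl φ₀‖ = 1
  eig : magOp h φ₀ = (e₀ : ℂ) • incl φ₀
  simple : ∀ ψ : H2, magOp h ψ = (e₀ : ℂ) • incl ψ → ∃ c : ℂ, ψ = c • φ₀

/-- The coefficient `⟨φ₀, u⟩`. -/
def coeff (φ₀ : H2) : H2 →L[ℂ] ℂ := (innerSL ℂ (incl φ₀)) ∘L incl

theorem coeff_apply (φ₀ u : H2) : coeff φ₀ u = inner ℂ (incl φ₀) (incl u) := rfl

/-- The operator `H - e₀ + |φ₀⟩⟨φ₀|`. -/
def linOp (h : Admissible A divA V) (e₀ : ℝ) (φ₀ : H2) : H2 →L[ℂ] L2 :=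
  magOp h - (e₀ : ℂ) • incl + (coeff φ₀).smulRight (incl φ₀)

theorem linOp_apply (h : Admissible A divA V) (e₀ : ℝ) (φ₀ u : H2) :
    linOp h e₀ φ₀ u = magOp h u - (e₀ : ℂ) • incl u + coeff φ₀ u • incl φ₀ := rfl

namespace SimpleEigenvalue

variable {h : Admissible A divA V} {e₀ : ℝ} {φ₀ : H2}

theorem coeff_self (hs : SimpleEigenvalue h e₀ φ₀) : coeff φ₀ φ₀ = 1 := by
  rw [coeff_apply, inner_self_eq_norm_sq_to_K, hs.norm_eq]
  simp

theorem inner_magOp_left (hs : SimpleEigenvalue h e₀ φ₀) (u : H2) :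
    inner ℂ (incl φ₀) (magOp h u) = e₀ * coeff φ₀ u := by
  rw [inner_magOp, hs.eig, inner_smul_left, Complex.conj_ofReal, coeff_apply]

theorem inner_linOp (hs : SimpleEigenvalue h e₀ φ₀) (u : H2) :
    inner ℂ (incl φ₀) (linOp h e₀ φ₀ u) = coeff φ₀ u := by
  have h1 := hs.coeff_self
  rw [coeff_apply] at h1
  rw [linOp_apply, inner_add_right, inner_sub_right, hs.inner_magOp_left, inner_smul_right,
    inner_smul_right, h1, ← coeff_apply]
  ring

/-- Pairing with `φ₀` shows that an element `u` of the kernel is orthogonal to `φ₀`; then it is an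
eigenfunction, hence a multiple of `φ₀`, hence zero. -/
theorem linOp_injective (hs : SimpleEigenvalue h e₀ φ₀) : Function.Injective (linOp h e₀ φ₀) := by
  refine (injective_iff_map_eq_zero _).2 fun u hu => ?_
  have h1 : coeff φ₀ u = 0 := by rw [← hs.inner_linOp, hu, inner_zero_right]
  rw [linOp_apply, h1, zero_smul, add_zero, sub_eq_zero] at hu
  obtain ⟨c, rfl⟩ := hs.simple u hu
  rw [map_smul, hs.coeff_self, smul_eq_mul, mul_one] at h1
  rw [h1, zero_smul]

/-- By the Fredholm alternative, `H - e₀ + |φ₀⟩⟨φ₀|` is an isomorphism: it is `(1 - K) T` with `T`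
the invertible operator `wellOp` and `K` compact by Rellich's theorem. -/
theorem exists_linOp_equiv (hs : SimpleEigenvalue h e₀ φ₀) (he₀ : e₀ < 0) :
    ∃ L : H2 ≃L[ℂ] L2, (L : H2 →L[ℂ] L2) = linOp h e₀ φ₀ := by
  obtain ⟨W, R, T, hT⟩ := exists_wellOp_equiv h he₀
  have hTa : ∀ u, T u = wellOp h e₀ W R u := fun u => congrArg (fun L : H2 →L[ℂ] L2 => L u) hT
  set K : L2 →L[ℂ] L2 := (ballCLM W R ∘L incl - (coeff φ₀).smulRight (incl φ₀)) ∘L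
    (T.symm : L2 →L[ℂ] H2) with hK
  have hlin : ∀ u, linOp h e₀ φ₀ u = T u - K (T u) := by
    intro u
    have : K (T u) = ballCLM W R (incl u) - coeff φ₀ u • incl φ₀ := by simp [hK]
    rw [this, hTa, wellOp_apply, linOp_apply]
    abel
  have hc1 : IsCompactOperator (ballCLM W R ∘L incl ∘L (T.symm : L2 →L[ℂ] H2)) := by
    have := (isCompactOperator_ballCLM_resolvent W R).comp_clm
      ((oneSubLap : H2 →L[ℂ] L2) ∘L (T.symm : L2 →L[ℂ] H2))
    refine (congrArg IsCompactOperator (funext fun f => ?_)).mp this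
    simp [← oneSubLap_symm_apply]
  have hc2 : IsCompactOperator ((coeff φ₀).smulRight (incl φ₀) ∘L (T.symm : L2 →L[ℂ] H2)) := by
    have h1 : IsCompactOperator (coeff φ₀ ∘L (T.symm : L2 →L[ℂ] H2)) :=
      isCompactOperator_of_locallyCompactSpace_dom _
    exact h1.clm_comp ((ContinuousLinearMap.id ℂ ℂ).smulRight (incl φ₀))
  have hKc : IsCompactOperator K := hc1.sub hc2
  have hbij : Function.Bijective (linOp h e₀ φ₀) := by
    rcases hKc.hasEigenvalue_or_mem_resolventSet (one_ne_zero (α := ℂ)) with h1 | h1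
    · obtain ⟨f, hf⟩ := h1.exists_hasEigenvector
      have h2 : K f = f := by simpa using hf.apply_eq_smul
      refine absurd ?_ hf.2
      have h3 : linOp h e₀ φ₀ (T.symm f) = 0 := by
        rw [hlin, T.apply_symm_apply, h2, sub_self]
      have h4 : T.symm f = 0 := (injective_iff_map_eq_zero _).1 hs.linOp_injective _ h3
      simpa using h4
    · rw [spectrum.mem_resolventSet_iff, ContinuousLinearMap.isUnit_iff_bijective] at h1
      have h2 : (linOp h e₀ φ₀ : H2 → L2) = (algebraMap ℂ (L2 →L[ℂ] L2) 1 - K) ∘ T := by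
        ext1 u
        rw [hlin]
        simp
      rw [h2]
      exact h1.comp T.bijective
  exact ⟨ContinuousLinearEquiv.ofBijective (linOp h e₀ φ₀) (LinearMap.ker_eq_bot.2 hbij.1)
    (LinearMap.range_eq_top.2 hbij.2), rfl⟩

end SimpleEigenvalue

end Operator

/-! ### The cubic nonlinearity on `H²` -/

theorem memLp_top_incl (u : H2) : MemLp (incl u) ⊤ volume := by
  obtain ⟨C, -, hC⟩ := eLpNorm_top_le
  exact ⟨Lp.aestronglyMeasurable _, (hC u).trans_lt ENNReal.ofReal_lt_top⟩

/-- The embedding of `H²` in `L^∞`. -/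
def supL : H2 →L[ℂ] Lp ℂ ⊤ (volume : Measure E3) :=
  LinearMap.mkContinuousOfExistsBound
    { toFun := fun u => (memLp_top_incl u).toLp
      map_add' := fun u v => by
        apply Lp.ext
        filter_upwards [(memLp_top_incl (u + v)).coeFn_toLp, (memLp_top_incl u).coeFn_toLp,
          (memLp_top_incl v).coeFn_toLp, Lp.coeFn_add (memLp_top_incl u).toLp
          (memLp_top_incl v).toLp, Lp.coeFn_add (incl u) (incl v)] with x h1 h2 h3 h4 h5
        rw [h1, h4, Pi.add_apply, h2, h3, map_add, h5, Pi.add_apply]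
      map_smul' := fun c u => by
        apply Lp.ext
        filter_upwards [(memLp_top_incl (c • u)).coeFn_toLp, (memLp_top_incl u).coeFn_toLp,
          Lp.coeFn_smul c (memLp_top_incl u).toLp, Lp.coeFn_smul c (incl u)] with x h1 h2 h3 h4
        rw [h1, RingHom.id_apply, h3, Pi.smul_apply, h2, map_smul, h4, Pi.smul_apply] }
    (by
      obtain ⟨C, hC0, hC⟩ := eLpNorm_top_le
      refine ⟨C, fun u => ?_⟩
      change ‖(memLp_top_incl u).toLp‖ ≤ _
      rw [Lp.norm_toLp]
      exact ENNReal.toReal_le_of_le_ofReal (by positivity) (hC u))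

theorem coeFn_supL (u : H2) : (supL u : E3 → ℂ) =ᵐ[volume] incl u :=
  (memLp_top_incl u).coeFn_toLp

/-- Complex conjugation on `L^∞`. -/
def conjSup : Lp ℂ ⊤ (volume : Measure E3) →L[ℝ] Lp ℂ ⊤ (volume : Measure E3) :=
  (Complex.conjCLE : ℂ →L[ℝ] ℂ).compLpL ⊤ volume

/-- The function `|u|²` in `L^∞`. -/
def density (u : H2) : Lp ℂ ⊤ (volume : Measure E3) :=
  (ContinuousLinearMap.mul ℝ ℂ).holderL volume ⊤ ⊤ ⊤ (conjSup (supL u)) (supL u)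

theorem coeFn_density (u : H2) :
    (density u : E3 → ℂ) =ᵐ[volume] fun x => (‖u.fn x‖ : ℂ) ^ 2 := by
  have h := (ContinuousLinearMap.mul ℝ ℂ).coeFn_holder (r := ⊤) (conjSup (supL u)) (supL u)
  filter_upwards [h, coeFn_supL u,
    (Complex.conjCLE : ℂ →L[ℝ] ℂ).coeFn_compLp (supL u)] with x h1 h2 h3
  refine h1.trans ?_
  have h4 : conjSup (supL u) x = (starRingEnd ℂ) (supL u x) := h3
  rw [h4, h2]
  exact Complex.conj_mul' _

/-- Multiplication of elements of `L²` by elements of `L^∞`. -/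
def mulSup : Lp ℂ ⊤ (volume : Measure E3) →L[ℂ] L2 →L[ℂ] L2 :=
  (ContinuousLinearMap.mul ℂ ℂ).holderL volume ⊤ 2 2

theorem coeFn_mulSup (m : Lp ℂ ⊤ (volume : Measure E3)) (u : L2) :
    (mulSup m u : E3 → ℂ) =ᵐ[volume] fun x => m x * u x :=
  (ContinuousLinearMap.mul ℂ ℂ).coeFn_holder (r := 2) m u

/-- The nonlinearity `|u|² u`. -/
def cubic (u : H2) : L2 := mulSup (density u) (incl u)

theorem coeFn_cubic (u : H2) :
    (cubic u : E3 → ℂ) =ᵐ[volume] fun x => (‖u.fn x‖ : ℂ) ^ 2 * u.fn x := by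
  filter_upwards [coeFn_mulSup (density u) (incl u), coeFn_density u] with x h1 h2
  rw [cubic, h1, h2]
  rfl

/-- The density is a quadratic map, hence smooth over the reals. -/
theorem contDiff_density : ContDiff ℝ (⊤ : ℕ∞) density := by
  have h1 : ContDiff ℝ (⊤ : ℕ∞) fun u => supL u := (supL.restrictScalars ℝ).contDiff
  have h2 : ContDiff ℝ (⊤ : ℕ∞) fun u => conjSup (supL u) := conjSup.contDiff.comp h1
  exact (((ContinuousLinearMap.mul ℝ ℂ).holderL volume ⊤ ⊤ ⊤).contDiff.comp h2).clm_apply h1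

theorem contDiff_cubic : ContDiff ℝ (⊤ : ℕ∞) cubic := by
  have h1 : ContDiff ℝ (⊤ : ℕ∞) fun u => incl u := (incl.restrictScalars ℝ).contDiff
  have h2 : ContDiff ℝ (⊤ : ℕ∞) fun u =>
      (ContinuousLinearMap.mul ℝ ℂ).holderL volume ⊤ 2 2 (density u) :=
    ((ContinuousLinearMap.mul ℝ ℂ).holderL volume ⊤ 2 2).contDiff.comp contDiff_density
  exact h2.clm_apply h1

/-- Gauge covariance of the nonlinearity. -/
theorem cubic_smul (z : ℂ) (u : H2) : cubic (z • u) = ((‖z‖ : ℂ) ^ 2 * z) • cubic u := by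
  apply Lp.ext
  have h : (incl (z • u) : E3 → ℂ) =ᵐ[volume] fun x => z * incl u x := by
    rw [map_smul]
    exact Lp.coeFn_smul z (incl u)
  filter_upwards [coeFn_cubic (z • u), coeFn_cubic u, h,
    Lp.coeFn_smul ((‖z‖ : ℂ) ^ 2 * z) (cubic u)] with x h1 h2 h3 h4
  rw [coeFn_incl, coeFn_incl] at h3
  rw [h1, h4, Pi.smul_apply, h2, h3, norm_mul, smul_eq_mul]
  push_cast
  ring

/-! ### The bifurcating branch -/

section Operator

variable {A : E3 → E3} {divA V : E3 → ℝ} {h : Admissible A divA V} {e₀ : ℝ} {φ₀ : H2}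

/-- The projection `u ↦ u - ⟨φ₀, u⟩ φ₀`. -/
def perp (φ₀ : H2) : H2 →L[ℂ] H2 := ContinuousLinearMap.id ℂ H2 - (coeff φ₀).smulRight φ₀

theorem perp_apply (φ₀ u : H2) : perp φ₀ u = u - coeff φ₀ u • φ₀ := rfl

/-- The left-hand side of the reduced equation `reduced (s, w) = 0`, where `s` stands for `|z|²`.
The unknown `w` carries both the correction `perp φ₀ w` of the profile and, in the component
`⟨φ₀, w⟩`, the negative of the correction of the energy. -/
def reduced (h : Admissible A divA V) (e₀ : ℝ) (φ₀ : H2) (σ : ℝ) (p : ℝ × H2) : L2 :=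
  linOp h e₀ φ₀ p.2 + coeff φ₀ p.2 • incl (perp φ₀ p.2) +
    (p.1 * σ) • cubic (φ₀ + perp φ₀ p.2)

theorem contDiff_reduced (σ : ℝ) : ContDiff ℝ 2 (reduced h e₀ φ₀ σ) := by
  have h1 : ContDiff ℝ 2 fun w => linOp h e₀ φ₀ w := ((linOp h e₀ φ₀).restrictScalars ℝ).contDiff
  have h2 : ContDiff ℝ 2 fun w => coeff φ₀ w := ((coeff φ₀).restrictScalars ℝ).contDiff
  have h3 : ContDiff ℝ 2 fun w => incl (perp φ₀ w) :=
    ((incl ∘L perp φ₀).restrictScalars ℝ).contDiff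
  have h4 : ContDiff ℝ 2 fun w => φ₀ + perp φ₀ w :=
    contDiff_const.add ((perp φ₀).restrictScalars ℝ).contDiff
  have h5 : ContDiff ℝ 2 fun w => cubic (φ₀ + perp φ₀ w) :=
    (contDiff_cubic.of_le (WithTop.coe_le_coe.2 le_top)).comp h4
  exact ((h1.comp contDiff_snd).add ((h2.smul h3).comp contDiff_snd)).add
    ((contDiff_fst.mul contDiff_const).smul (h5.comp contDiff_snd))

theorem reduced_zero_zero (σ : ℝ) : reduced h e₀ φ₀ σ 0 = 0 := by
  simp [reduced]

/-- The linearization in `w` at the origin is the isomorphism `linOp`; the product of the two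
corrections is quadratic and drops out. -/
theorem hasFDerivAt_reduced_zero (σ : ℝ) : HasFDerivAt (fun w => reduced h e₀ φ₀ σ (0, w))
    ((linOp h e₀ φ₀).restrictScalars ℝ) 0 := by
  have e : (fun w => reduced h e₀ φ₀ σ (0, w)) =
      fun w => linOp h e₀ φ₀ w + coeff φ₀ w • incl (perp φ₀ w) := by
    ext1 w
    simp [reduced]
  have h1 : HasFDerivAt (fun w => linOp h e₀ φ₀ w) ((linOp h e₀ φ₀).restrictScalars ℝ) 0 :=
    ((linOp h e₀ φ₀).restrictScalars ℝ).hasFDerivAt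
  have h2 : HasFDerivAt (fun w => coeff φ₀ w) ((coeff φ₀).restrictScalars ℝ) 0 :=
    ((coeff φ₀).restrictScalars ℝ).hasFDerivAt
  have h3 : HasFDerivAt (fun w => incl (perp φ₀ w)) ((incl ∘L perp φ₀).restrictScalars ℝ) 0 :=
    ((incl ∘L perp φ₀).restrictScalars ℝ).hasFDerivAt
  rw [e]
  refine (h1.add (h2.smul h3)).congr_fderiv ?_
  ext1 w
  simp

/-- The branch of solutions in reduced form, as a function of `s = |z|²`: the profile
`φ₀ + η s` and the energy `e₀ + ν s`. -/
theorem SimpleEigenvalue.exists_branch (hs : SimpleEigenvalue h e₀ φ₀) (he₀ : e₀ < 0) (σ : ℝ) :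
    ∃ (η : ℝ → H2) (ν : ℝ → ℂ), ContDiffAt ℝ 2 η 0 ∧ η 0 = 0 ∧ ContDiffAt ℝ 2 ν 0 ∧ ν 0 = 0 ∧
      (∀ s, coeff φ₀ (η s) = 0) ∧ ∀ᶠ s : ℝ in 𝓝 0,
        magOp h (φ₀ + η s) + ((s * σ : ℝ) : ℂ) • cubic (φ₀ + η s) =
          ((e₀ : ℂ) + ν s) • incl (φ₀ + η s) := by
  obtain ⟨L, hL⟩ := hs.exists_linOp_equiv he₀
  have cdf : ContDiffAt ℝ 2 (reduced h e₀ φ₀ σ) ((0 : ℝ), (0 : H2)) :=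
    (contDiff_reduced σ).contDiffAt
  have hinv : (fderiv ℝ (reduced h e₀ φ₀ σ) ((0 : ℝ), (0 : H2)) ∘L
      ContinuousLinearMap.inr ℝ ℝ H2).IsInvertible := by
    have h1 : HasFDerivAt (reduced h e₀ φ₀ σ) (fderiv ℝ (reduced h e₀ φ₀ σ) ((0 : ℝ), (0 : H2)))
        (ContinuousLinearMap.inr ℝ ℝ H2 0) :=
      (cdf.differentiableAt (by simp)).hasFDerivAt
    have h2 := h1.comp (0 : H2) (ContinuousLinearMap.inr ℝ ℝ H2).hasFDerivAt
    have h3 := h2.unique (hasFDerivAt_reduced_zero σ)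
    rw [h3, ← hL]
    exact ⟨ContinuousLinearEquiv.equivOfInverse ((L : H2 →L[ℂ] L2).restrictScalars ℝ)
      ((L.symm : L2 →L[ℂ] H2).restrictScalars ℝ) L.symm_apply_apply L.apply_symm_apply, rfl⟩
  set w := cdf.implicitFunction (by simp) hinv with hw
  have hw2 : ContDiffAt ℝ 2 w 0 := cdf.contDiffAt_implicitFunction (by simp) hinv
  have hw0 : w 0 = 0 := cdf.implicitFunction_apply_self (by simp) hinv
  refine ⟨fun s => perp φ₀ (w s), fun s => - coeff φ₀ (w s),
    ((perp φ₀).restrictScalars ℝ).contDiff.contDiffAt.comp 0 hw2, by simp [hw0],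
    (((coeff φ₀).restrictScalars ℝ).contDiff.contDiffAt.comp 0 hw2).neg, by simp [hw0],
    fun s => ?_, ?_⟩
  · dsimp only
    rw [perp_apply, map_sub, map_smul, hs.coeff_self, smul_eq_mul, mul_one, sub_self]
  · filter_upwards [cdf.eventually_apply_implicitFunction (by simp) hinv] with s hs'
    have h1 : reduced h e₀ φ₀ σ (s, w s) = 0 := hs'.trans (reduced_zero_zero σ)
    have h2 : linOp h e₀ φ₀ (w s) = magOp h (perp φ₀ (w s)) - (e₀ : ℂ) • incl (perp φ₀ (w s)) +
        coeff φ₀ (w s) • incl φ₀ := by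
      rw [linOp_apply, perp_apply, map_sub, map_sub, map_smul, map_smul, hs.eig]
      module
    rw [reduced, h2] at h1
    have h3 : ((s * σ : ℝ) : ℂ) • cubic (φ₀ + perp φ₀ (w s)) =
        (s * σ) • cubic (φ₀ + perp φ₀ (w s)) := Complex.coe_smul _ _
    rw [h3]
    rw [← sub_eq_zero, ← h1, map_add, map_add, hs.eig]
    dsimp only
    module

end Operator

/-! ### Differentiability of the branch in the complex parameter -/

theorem isLittleO_norm_sq : (fun z : ℂ => ‖z‖ ^ 2) =o[𝓝 0] fun z : ℂ => z := by
  have h : (fun z : ℂ => ‖z‖ ^ 2) =o[𝓝 0] fun z : ℂ => ‖z‖ :=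
    (isLittleO_pow_id (𝕜 := ℝ) one_lt_two).comp_tendsto (by
      simpa using (continuous_norm (E := ℂ)).tendsto 0)
  exact h.of_norm_right

theorem apply_zero_of_isLittleO {X : Type*} [NormedAddCommGroup X] {g : ℂ → X} {c : X}
    (h : (fun z => g z - c) =o[𝓝 0] fun z : ℂ => z) : g 0 = c := by
  have h1 := (h.def one_pos).self_of_nhds
  rw [norm_zero, mul_zero] at h1
  exact sub_eq_zero.1 (norm_le_zero_iff.1 h1)

section RealExpansion

variable {X : Type*} [NormedAddCommGroup X] [NormedSpace ℝ X]

/-- A function of `|z|²` that vanishes at the origin vanishes there to second order in `z`. -/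
theorem isLittleO_comp_norm_sq {f : ℝ → X} (hf : DifferentiableAt ℝ f 0) (h0 : f 0 = 0) :
    (fun z : ℂ => f (‖z‖ ^ 2)) =o[𝓝 0] fun z : ℂ => z := by
  have h1 : (fun s => f s) =O[𝓝 0] fun s : ℝ => s := by
    simpa [h0] using hf.isBigO_sub
  have h2 : Tendsto (fun z : ℂ => ‖z‖ ^ 2) (𝓝 0) (𝓝 0) := by
    have : Continuous fun z : ℂ => ‖z‖ ^ 2 := by fun_prop
    simpa using this.tendsto 0
  exact (h1.comp_tendsto h2).trans_isLittleO isLittleO_norm_sq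

theorem contDiffAt_comp_norm_sq {f : ℝ → X} (hf : ContDiffAt ℝ 2 f 0) :
    ContDiffAt ℝ 2 (fun z : ℂ => f (‖z‖ ^ 2)) 0 := by
  have h1 : ContDiffAt ℝ 2 (fun z : ℂ => ‖z‖ ^ 2) 0 := (contDiff_norm_sq ℝ).contDiffAt
  refine ContDiffAt.comp (g := f) (0 : ℂ) ?_ h1
  simpa using hf

theorem hasFDerivAt_zero_of_isLittleO {g : ℂ → X} {c : X}
    (h : (fun z => g z - c) =o[𝓝 0] fun z : ℂ => z) : HasFDerivAt g (0 : ℂ →L[ℝ] X) 0 := by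
  rw [hasFDerivAt_iff_isLittleO_nhds_zero]
  refine h.congr_left fun z => ?_
  rw [apply_zero_of_isLittleO h, zero_add, zero_apply, sub_zero]

end RealExpansion

section Expansion

variable {X : Type*} [NormedAddCommGroup X] [NormedSpace ℂ X]

theorem isLittleO_smul_add {F : ℂ → X} (φ : X) (hF0 : F =o[𝓝 0] fun z : ℂ => z) :
    (fun z : ℂ => z • (φ + F z) - z • φ) =o[𝓝 0] fun z : ℂ => z ^ 2 := by
  have h : (fun z : ℂ => z • F z) =o[𝓝 0] fun z : ℂ => z • z :=
    (isBigO_refl _ _).smul_isLittleO hF0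
  refine h.congr (fun z => ?_) fun z => ?_
  · rw [smul_add]; abel
  · rw [smul_eq_mul, sq]

variable [NormedSpace ℝ X] [IsScalarTower ℝ ℂ X] {F : ℂ → X} (φ : X)

theorem contDiffAt_smul_add (hF : ContDiffAt ℝ 2 F 0) :
    ContDiffAt ℝ 2 (fun z : ℂ => z • (φ + F z)) 0 :=
  contDiffAt_id.smul (contDiffAt_const.add hF)

/-- First-order expansion of the directional derivatives of `z (φ + F z)`. -/
theorem isLittleO_lineDeriv_smul_add (hF : ContDiffAt ℝ 2 F 0)
    (hF0 : F =o[𝓝 0] fun z : ℂ => z) (d : ℂ) :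
    (fun z : ℂ => lineDeriv ℝ (fun z : ℂ => z • (φ + F z)) z d - d • φ) =o[𝓝 0]
      fun z : ℂ => z := by
  have hd0 : HasFDerivAt F (0 : ℂ →L[ℝ] X) 0 :=
    hasFDerivAt_zero_of_isLittleO (c := 0) (by simpa using hF0)
  have h1 : DifferentiableAt ℝ (fderiv ℝ F) 0 :=
    (hF.fderiv_right (m := 1) (by norm_num)).differentiableAt (by simp)
  have h2 : (fun z : ℂ => fderiv ℝ F z) =O[𝓝 0] fun z : ℂ => z := by
    simpa [hd0.fderiv] using h1.isBigO_sub
  have h3 : (fun z : ℂ => fderiv ℝ F z d) =O[𝓝 0] fun z : ℂ => z := by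
    refine IsBigO.trans (IsBigO.of_bound ‖d‖ (Eventually.of_forall fun z => ?_)) h2
    rw [mul_comm]
    exact (fderiv ℝ F z).le_opNorm d
  have h4 : (fun z : ℂ => z • fderiv ℝ F z d) =o[𝓝 0] fun z : ℂ => z := by
    have a : (fun z : ℂ => z) =o[𝓝 0] fun _ : ℂ => (1 : ℂ) :=
      (isLittleO_one_iff ℂ).2 tendsto_id
    simpa using a.smul_isBigO h3
  refine (((hF0.const_smul_left d).add h4)).congr' ?_ EventuallyEq.rfl
  filter_upwards [hF.eventually (by simp)] with z hz
  have hFz : HasFDerivAt F (fderiv ℝ F z) z := (hz.differentiableAt (by simp)).hasFDerivAt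
  have h5 := (hasFDerivAt_id (𝕜 := ℝ) z).smul (hFz.const_add φ)
  have h6 := h5.hasLineDerivAt d
  have h7 : lineDeriv ℝ (fun z : ℂ => z • (φ + F z)) z d = _ := h6.lineDeriv
  rw [h7]
  simp [smul_add]
  abel

/-- The second derivatives of `z (φ + F z)` vanish at the origin and are continuous. -/
theorem tendsto_lineDeriv_lineDeriv_smul_add (hF : ContDiffAt ℝ 2 F 0)
    (hF0 : F =o[𝓝 0] fun z : ℂ => z) (d d' : ℂ) :
    Tendsto (fun z : ℂ => lineDeriv ℝ
      (fun z => lineDeriv ℝ (fun z : ℂ => z • (φ + F z)) z d) z d') (𝓝 0) (𝓝 0) := by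
  set Q : ℂ → X := fun z => z • (φ + F z) with hQ
  set g : ℂ → X := fun z => lineDeriv ℝ Q z d with hg
  have hQ2 : ContDiffAt ℝ 2 Q 0 := contDiffAt_smul_add φ hF
  have hg0 := isLittleO_lineDeriv_smul_add φ hF hF0 d
  have hg1 : ContDiffAt ℝ 1 g 0 := by
    have h1 : ContDiffAt ℝ 1 (fun z => fderiv ℝ Q z d) 0 :=
      (hQ2.fderiv_right (m := 1) (by norm_num)).clm_apply contDiffAt_const
    refine h1.congr_of_eventuallyEq ?_
    filter_upwards [hQ2.eventually (by simp)] with z hz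
    exact (hz.differentiableAt (by simp)).lineDeriv_eq_fderiv
  have hd0 : HasFDerivAt g (0 : ℂ →L[ℝ] X) 0 := hasFDerivAt_zero_of_isLittleO hg0
  have hc : ContinuousAt (fun z => fderiv ℝ g z d') 0 :=
    ((hg1.fderiv_right (m := 0) (by norm_num)).continuousAt).clm_apply continuousAt_const
  have ht : Tendsto (fun z => fderiv ℝ g z d') (𝓝 0) (𝓝 0) := by
    simpa [ContinuousAt, hd0.fderiv] using hc
  refine ht.congr' ?_
  filter_upwards [hg1.eventually (by simp)] with z hz
  exact (hz.differentiableAt (by simp)).lineDeriv_eq_fderiv.symm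

end Expansion

/-! ### The nonlinear bound states -/

section Operator

variable {A : E3 → E3} {divA V : E3 → ℝ} {h : Admissible A divA V} {e₀ : ℝ} {φ₀ : H2}

theorem inner_cubic (u : H2) : inner ℂ (incl u) (cubic u) = inner ℂ (cubic u) (incl u) := by
  rw [L2.inner_def, L2.inner_def]
  refine integral_congr_ae ?_
  filter_upwards [coeFn_cubic u] with x h1
  rw [h1, coeFn_incl]
  simp only [RCLike.inner_apply, map_mul, map_pow, Complex.conj_ofReal]
  ring

/-- The eigenvalue of a nonlinear bound state is real because `H` is symmetric. -/
theorem im_eq_zero_of_bound_state {u : H2} (hu : u ≠ 0) {σ : ℝ} {c : ℂ}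
    (heq : magOp h u + (σ : ℂ) • cubic u = c • incl u) : c.im = 0 := by
  have h1 : inner ℂ (incl u) (c • incl u) = inner ℂ (c • incl u) (incl u) := by
    rw [← heq, inner_add_left, inner_add_right, inner_magOp, inner_smul_left, inner_smul_right,
      inner_cubic, Complex.conj_ofReal]
  rw [inner_smul_left, inner_smul_right] at h1
  have h2 : inner ℂ (incl u) (incl u) ≠ (0 : ℂ) := by
    rw [inner_self_ne_zero]
    exact fun h0 => hu (H2.ext_incl (by rw [h0, map_zero]))
  exact Complex.conj_eq_iff_im.1 (mul_right_cancel₀ h2 h1).symm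

theorem SimpleEigenvalue.ne_zero_of_coeff (hs : SimpleEigenvalue h e₀ φ₀) {z : ℂ} (hz : z ≠ 0)
    {u : H2} (hu : coeff φ₀ u = 0) : z • (φ₀ + u) ≠ 0 := by
  intro h0
  have h1 := congrArg (coeff φ₀) h0
  rw [map_smul, map_add, hs.coeff_self, hu, add_zero, map_zero, smul_eq_mul, mul_one] at h1
  exact hz h1

/-- The branch of nonlinear bound states `z (φ₀ + F z)` with energies `E z`. -/
theorem SimpleEigenvalue.exists_bound_states (hs : SimpleEigenvalue h e₀ φ₀) (he₀ : e₀ < 0)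
    (σ : ℝ) : ∃ (F : ℂ → H2) (E : ℂ → ℝ), ContDiffAt ℝ 2 F 0 ∧ (F =o[𝓝 0] fun z : ℂ => z) ∧
      ((fun z => E z - e₀) =o[𝓝 0] fun z : ℂ => z) ∧ (∀ z, coeff φ₀ (F z) = 0) ∧
      ∀ᶠ z in 𝓝 0, magOp h (z • (φ₀ + F z)) + (σ : ℂ) • cubic (z • (φ₀ + F z)) =
        (E z : ℂ) • incl (z • (φ₀ + F z)) := by
  obtain ⟨η, ν, hη, hη0, hν, hν0, hperp, hev⟩ := hs.exists_branch he₀ σ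
  have hre : DifferentiableAt ℝ (fun s => (ν s).re) 0 :=
    Complex.reCLM.differentiableAt.comp 0 (hν.differentiableAt (by simp))
  refine ⟨fun z => η (‖z‖ ^ 2), fun z => e₀ + (ν (‖z‖ ^ 2)).re, contDiffAt_comp_norm_sq hη,
    isLittleO_comp_norm_sq (hη.differentiableAt (by simp)) hη0, ?_, fun z => hperp _, ?_⟩
  · have := isLittleO_comp_norm_sq hre (by simp [hν0])
    simpa using this
  · have ht : Tendsto (fun z : ℂ => ‖z‖ ^ 2) (𝓝 0) (𝓝 0) := by
      have : Continuous fun z : ℂ => ‖z‖ ^ 2 := by fun_prop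
      simpa using this.tendsto 0
    filter_upwards [ht.eventually hev] with z hz
    have h1 : magOp h (z • (φ₀ + η (‖z‖ ^ 2))) + (σ : ℂ) • cubic (z • (φ₀ + η (‖z‖ ^ 2))) =
        ((e₀ : ℂ) + ν (‖z‖ ^ 2)) • incl (z • (φ₀ + η (‖z‖ ^ 2))) := by
      rw [cubic_smul, map_smul, map_smul, smul_comm _ z, ← hz]
      push_cast
      module
    rcases eq_or_ne z 0 with rfl | hz0
    · simp [cubic]
    · have h2 := im_eq_zero_of_bound_state (hs.ne_zero_of_coeff hz0 (hperp _)) h1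
      rw [h1]
      congr 1
      apply Complex.ext
      · simp
      · simpa using h2

end Operator

/-! ### The Leibniz rule for weak derivatives -/

/-- The Leibniz rule for the product of a smooth function and a weakly differentiable function. -/
theorem HasWeakPartial.smooth_smul {j : Fin 3} {u v : E3 → ℂ} (h : HasWeakPartial j u v)
    {g : E3 → ℝ} (hg : ContDiff ℝ (⊤ : ℕ∞) g) :
    HasWeakPartial j (fun x => g x • u x)
      (fun x => fderiv ℝ g x (basisVec j) • u x + g x • v x) := by
  have hg' : Continuous fun x => fderiv ℝ g x (basisVec j) :=
    (hg.continuous_fderiv (by simp)).clm_apply continuous_const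
  have l1 : LocallyIntegrable (fun x => g x • u x) volume := h.1.continuous_smul hg.continuous
  have l2 : LocallyIntegrable (fun x => fderiv ℝ g x (basisVec j) • u x) volume :=
    h.1.continuous_smul hg'
  have l3 : LocallyIntegrable (fun x => g x • v x) volume := h.2.1.continuous_smul hg.continuous
  refine ⟨l1, l2.add l3, fun η hη hc => ?_⟩
  have key := h.2.2 (fun x => g x * η x) (hg.mul hη) hc.mul_left
  have e1 : ∀ x, fderiv ℝ (fun x => g x * η x) x (basisVec j) • u x =
      fderiv ℝ η x (basisVec j) • g x • u x + η x • fderiv ℝ g x (basisVec j) • u x := by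
    intro x
    have d1 := (hg.differentiable (by simp) x).hasFDerivAt
    have d2 := (hη.differentiable (by simp) x).hasFDerivAt
    have d3 : fderiv ℝ (fun x => g x * η x) x = _ := (d1.mul d2).fderiv
    rw [d3]
    simp only [add_apply, smul_apply, smul_eq_mul]
    module
  have e2 : ∀ x, (g x * η x) • v x = η x • g x • v x := fun x => by rw [mul_comm, mul_smul]
  simp only [e1, e2] at key
  have i1 := integrable_fderiv_smul hη hc (basisVec j) l1
  have i2 := l2.integrable_smul_left_of_hasCompactSupport hη.continuous hc
  have i3 := l3.integrable_smul_left_of_hasCompactSupport hη.continuous hc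
  rw [integral_add i1 i2] at key
  simp only [smul_add]
  rw [integral_add i2 i3, neg_add, ← key]
  abel

/-- Multiplication by a bounded real function, as an operator on `L²`. -/
def mulReal (g : E3 → ℝ) (hg : MemLp (fun x => (g x : ℂ)) ⊤ volume) : L2 →L[ℂ] L2 := mulCLM _ hg

theorem coeFn_mulReal {g : E3 → ℝ} (hg : MemLp (fun x => (g x : ℂ)) ⊤ volume) (u : L2) :
    (mulReal g hg u : E3 → ℂ) =ᵐ[volume] fun x => (g x : ℂ) * u x :=
  coeFn_mulCLM hg u

theorem HasWeakPartial.mulReal {j : Fin 3} {u v : L2} (h : HasWeakPartial j u v)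
    {g g' : E3 → ℝ} (hs : ContDiff ℝ (⊤ : ℕ∞) g) (hg : MemLp (fun x => (g x : ℂ)) ⊤ volume)
    (hg' : MemLp (fun x => (g' x : ℂ)) ⊤ volume)
    (hd : ∀ x, fderiv ℝ g x (basisVec j) = g' x) :
    HasWeakPartial j (mulReal g hg u) (mulReal g' hg' u + mulReal g hg v : L2) := by
  refine (h.smooth_smul hs).congr ?_ ?_
  · filter_upwards [coeFn_mulReal hg u] with x h1
    rw [h1, Complex.real_smul]
  · filter_upwards [coeFn_mulReal hg v, coeFn_mulReal hg' u,
      Lp.coeFn_add (MagneticNLS.mulReal g' hg' u) (MagneticNLS.mulReal g hg v)] with x h1 h2 h3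
    rw [h3, Pi.add_apply, h1, h2, hd, Complex.real_smul, Complex.real_smul]

theorem HasWeakPartial.sub_smul {j : Fin 3} {u v u' v' : L2} (h : HasWeakPartial j u v)
    (h' : HasWeakPartial j u' v') (c : ℂ) :
    HasWeakPartial j (u - c • u' : L2) (v - c • v' : L2) := by
  refine (h.add (h'.const_smul (-c))).congr ?_ ?_
  · filter_upwards [Lp.coeFn_sub u (c • u'), Lp.coeFn_smul c u'] with x h1 h2
    rw [h1, Pi.sub_apply, h2, Pi.add_apply, Pi.smul_apply, Pi.smul_apply, neg_smul, sub_eq_add_neg]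
  · filter_upwards [Lp.coeFn_sub v (c • v'), Lp.coeFn_smul c v'] with x h1 h2
    rw [h1, Pi.sub_apply, h2, Pi.add_apply, Pi.smul_apply, Pi.smul_apply, neg_smul, sub_eq_add_neg]

/-! ### The regularized distance to the origin -/

/-- The smooth approximation `√(a² + |x|²)` of `|x|`. -/
def smoothAbs (a : ℝ) (x : E3) : ℝ := √(a ^ 2 + ‖x‖ ^ 2)

/-- The component `x_j / √(a² + |x|²)` of the gradient of `smoothAbs a`. For `a = 0` its value at
the origin is `0 / 0 = 0`, which is also the limit as `a → 0`. -/
def slope (a : ℝ) (j : Fin 3) (x : E3) : ℝ := x j / smoothAbs a x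

theorem norm_le_smoothAbs (a : ℝ) (x : E3) : ‖x‖ ≤ smoothAbs a x :=
  Real.le_sqrt_of_sq_le (by nlinarith [sq_nonneg a])

theorem smoothAbs_mono {a b : ℝ} (ha : 0 ≤ a) (h : a ≤ b) (x : E3) :
    smoothAbs a x ≤ smoothAbs b x :=
  Real.sqrt_le_sqrt (by nlinarith)

theorem smoothAbs_pos {a : ℝ} (ha : a ≠ 0) (x : E3) : 0 < smoothAbs a x :=
  Real.sqrt_pos.2 (by positivity)

theorem smoothAbs_nonneg (a : ℝ) (x : E3) : 0 ≤ smoothAbs a x := Real.sqrt_nonneg _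

theorem one_le_smoothAbs (x : E3) : 1 ≤ smoothAbs 1 x :=
  Real.le_sqrt_of_sq_le (by nlinarith [sq_nonneg ‖x‖])

theorem contDiff_smoothAbs {a : ℝ} (ha : a ≠ 0) : ContDiff ℝ (⊤ : ℕ∞) (smoothAbs a) :=
  (contDiff_const.add (contDiff_norm_sq ℝ)).sqrt fun x => by positivity

theorem hasFDerivAt_smoothAbs {a : ℝ} (ha : a ≠ 0) (x : E3) :
    HasFDerivAt (smoothAbs a) ((smoothAbs a x)⁻¹ • innerSL ℝ x) x := by
  have h1 : HasFDerivAt (fun x : E3 => a ^ 2 + ‖x‖ ^ 2) (2 • innerSL ℝ x) x :=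
    (hasStrictFDerivAt_norm_sq x).hasFDerivAt.const_add _
  refine (h1.sqrt (by positivity)).congr_fderiv ?_
  ext v
  have := (smoothAbs_pos ha x).ne'
  simp only [smul_apply, smul_eq_mul, innerSL_apply_apply, smoothAbs, nsmul_eq_mul]
  push_cast
  field_simp

theorem abs_slope_le (a : ℝ) (j : Fin 3) (x : E3) : |slope a j x| ≤ 1 := by
  rw [slope, abs_div, abs_of_nonneg (smoothAbs_nonneg a x)]
  refine div_le_one_of_le₀ ?_ (smoothAbs_nonneg a x)
  exact (PiLp.norm_apply_le x j).trans (norm_le_smoothAbs a x)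

theorem contDiff_slope {a : ℝ} (ha : a ≠ 0) (j : Fin 3) : ContDiff ℝ (⊤ : ℕ∞) (slope a j) := by
  have h1 : ContDiff ℝ (⊤ : ℕ∞) fun x : E3 => x j := (EuclideanSpace.proj (𝕜 := ℝ) j).contDiff
  exact h1.div (contDiff_smoothAbs ha) fun x => (smoothAbs_pos ha x).ne'

/-- The second derivative `∂_j ∂_i` of `√(1 + |x|²)`. -/
def curv (i j : Fin 3) (x : E3) : ℝ :=
  ((basisVec j) i - slope 1 i x * slope 1 j x) / smoothAbs 1 x

theorem fderiv_slope (i j : Fin 3) (x : E3) :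
    fderiv ℝ (slope 1 i) x (basisVec j) = curv i j x := by
  have h1 : HasFDerivAt (fun x : E3 => x i) (EuclideanSpace.proj (𝕜 := ℝ) i) x :=
    (EuclideanSpace.proj (𝕜 := ℝ) i).hasFDerivAt
  have hp := (smoothAbs_pos one_ne_zero x).ne'
  have h2 := (hasDerivAt_inv hp).comp_hasFDerivAt x (hasFDerivAt_smoothAbs one_ne_zero x)
  have h3 : fderiv ℝ (slope 1 i) x = _ := (h1.mul h2).fderiv
  have h4 : (EuclideanSpace.proj (𝕜 := ℝ) i : E3 →L[ℝ] ℝ) (basisVec j) = (basisVec j) i := rfl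
  rw [h3]
  simp only [add_apply, smul_apply, innerSL_apply_apply, inner_basisVec, smul_eq_mul, curv, slope,
    h4, Function.comp_apply]
  field_simp
  ring

theorem abs_curv_le (i j : Fin 3) (x : E3) : |curv i j x| ≤ 2 := by
  rw [curv, abs_div, abs_of_nonneg (smoothAbs_nonneg 1 x)]
  refine (div_le_self (abs_nonneg _) (one_le_smoothAbs x)).trans ?_
  have h1 : |(basisVec j) i| ≤ 1 := by
    refine (PiLp.norm_apply_le (basisVec j) i).trans ?_
    simp [basisVec]
  have h2 : |slope 1 i x * slope 1 j x| ≤ 1 := by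
    rw [abs_mul]
    exact mul_le_one₀ (abs_slope_le 1 i x) (abs_nonneg _) (abs_slope_le 1 j x)
  exact (abs_sub _ _).trans (by linarith)

theorem continuous_curv (i j : Fin 3) : Continuous (curv i j) := by
  have : curv i j = fun x => fderiv ℝ (slope 1 i) x (basisVec j) :=
    funext fun x => (fderiv_slope i j x).symm
  rw [this]
  exact ((contDiff_slope one_ne_zero i).continuous_fderiv (by simp)).clm_apply continuous_const

theorem memLp_top_ofReal {g : E3 → ℝ} (hg : Continuous g) {C : ℝ} (hC : ∀ x, |g x| ≤ C) :
    MemLp (fun x => (g x : ℂ)) ⊤ volume :=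
  memLp_top_of_bound (Complex.continuous_ofReal.comp hg).aestronglyMeasurable C
    (ae_of_all _ fun x => by rw [Complex.norm_real]; exact hC x)

/-- Multiplication by the gradient of `√(1 + |x|²)`. -/
def slopeM (i : Fin 3) : L2 →L[ℂ] L2 := mulReal (slope 1 i)
  (memLp_top_ofReal (contDiff_slope one_ne_zero i).continuous (abs_slope_le 1 i))

/-- Multiplication by the second derivatives of `√(1 + |x|²)`. -/
def curvM (i j : Fin 3) : L2 →L[ℂ] L2 := mulReal (curv i j)
  (memLp_top_ofReal (continuous_curv i j) (abs_curv_le i j))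

/-- The weight `exp (-β √(1 + |x|²))`. -/
def weight (β : ℝ) (x : E3) : ℝ := Real.exp (-(β * smoothAbs 1 x))

theorem contDiff_weight (β : ℝ) : ContDiff ℝ (⊤ : ℕ∞) (weight β) :=
  (contDiff_const.mul (contDiff_smoothAbs one_ne_zero)).neg.exp

theorem memLp_weight {β : ℝ} (hβ : 0 ≤ β) : MemLp (fun x => (weight β x : ℂ)) ⊤ volume := by
  refine memLp_top_ofReal (contDiff_weight β).continuous (C := 1) fun x => ?_
  rw [weight, abs_of_pos (Real.exp_pos _), Real.exp_le_one_iff]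
  have := mul_nonneg hβ (smoothAbs_nonneg 1 x)
  linarith

theorem fderiv_weight (β : ℝ) (x : E3) (j : Fin 3) :
    fderiv ℝ (weight β) x (basisVec j) = -(β * slope 1 j x * weight β x) := by
  have h1 := ((hasFDerivAt_smoothAbs one_ne_zero x).const_mul β).fun_neg.exp
  have h3 : fderiv ℝ (weight β) x = _ := h1.fderiv
  rw [h3]
  simp only [smul_apply, neg_apply, innerSL_apply_apply, inner_basisVec, smul_eq_mul, slope, weight]
  ring

/-- Multiplication by the weight `exp (-β √(1 + |x|²))`. -/
def weightM {β : ℝ} (hβ : 0 ≤ β) : L2 →L[ℂ] L2 := mulReal (weight β) (memLp_weight hβ)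

theorem coeFn_weightM {β : ℝ} (hβ : 0 ≤ β) (u : L2) :
    (weightM hβ u : E3 → ℂ) =ᵐ[volume] fun x => (weight β x : ℂ) * u x :=
  coeFn_mulReal _ u

/-- The Leibniz rule for the exponential weight, with the weight as a common factor. -/
theorem HasWeakPartial.weightM {β : ℝ} (hβ : 0 ≤ β) {j : Fin 3} {u v : L2}
    (h : HasWeakPartial j u v) :
    HasWeakPartial j (weightM hβ u) (weightM hβ (v - (β : ℂ) • slopeM j u)) := by
  have hb : MemLp (fun x => ((-(β * slope 1 j x * weight β x) : ℝ) : ℂ)) ⊤ volume := by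
    refine memLp_top_ofReal (C := β * 1 * 1) ?_ fun x => ?_
    · exact ((continuous_const.mul (contDiff_slope one_ne_zero j).continuous).mul
        (contDiff_weight β).continuous).neg
    · rw [abs_neg, abs_mul, abs_mul, abs_of_nonneg hβ]
      gcongr
      · exact abs_slope_le 1 j x
      · rw [weight, abs_of_pos (Real.exp_pos _), Real.exp_le_one_iff]
        have := mul_nonneg hβ (smoothAbs_nonneg 1 x)
        linarith
  have h1 := h.mulReal (contDiff_weight β) (memLp_weight hβ) hb fun x => fderiv_weight β x j
  refine h1.congr EventuallyEq.rfl (Eventually.of_forall fun x => ?_)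
  congr 2
  apply Lp.ext
  filter_upwards [Lp.coeFn_add (MagneticNLS.mulReal _ hb u)
    (MagneticNLS.mulReal _ (memLp_weight hβ) v), coeFn_mulReal hb u,
    coeFn_mulReal (memLp_weight hβ) v, coeFn_weightM hβ (v - (β : ℂ) • slopeM j u),
    Lp.coeFn_sub v ((β : ℂ) • slopeM j u), Lp.coeFn_smul (β : ℂ) (slopeM j u),
    coeFn_mulReal (memLp_top_ofReal (contDiff_slope one_ne_zero j).continuous
      (abs_slope_le 1 j)) u] with x h1 h2 h3 h4 h5 h6 h7
  rw [h1, Pi.add_apply, h2, h3, h4, h5, Pi.sub_apply, h6, Pi.smul_apply, slopeM, h7, smul_eq_mul]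
  push_cast
  ring

/-! ### Conjugation of the operator by an exponential weight -/

/-- The derivatives of `exp (-β √(1 + |x|²)) v`, with the common exponential factor removed. -/
def conjJet (β : ℝ) (v : H2) : JetIndex → L2
  | .inl _ => incl v
  | .inr (.inl i) => gradL i v - (β : ℂ) • slopeM i (incl v)
  | .inr (.inr (i, j)) => hessL i j v - (β : ℂ) • (curvM i j (incl v) + slopeM i (gradL j v)) -
      (β : ℂ) • slopeM j (gradL i v - (β : ℂ) • slopeM i (incl v))

theorem hasWeakPartial_gradL (i : Fin 3) (u : H2) : HasWeakPartial i (incl u) (gradL i u) := u.2.1 i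

theorem hasWeakPartial_hessL (i j : Fin 3) (u : H2) :
    HasWeakPartial j (gradL i u) (hessL i j u) := u.2.2 i j

theorem hasWeakPartial_conjJet (β : ℝ) (v : H2) (i j : Fin 3) :
    HasWeakPartial j (gradL i v - (β : ℂ) • slopeM i (incl v) : L2)
      (hessL i j v - (β : ℂ) • (curvM i j (incl v) + slopeM i (gradL j v)) : L2) :=
  (hasWeakPartial_hessL i j v).sub_smul
    ((hasWeakPartial_gradL j v).mulReal (contDiff_slope one_ne_zero i) _ _ (fderiv_slope i j)) _

/-- The product `exp (-β √(1 + |x|²)) v` as an element of `H²`. -/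
def conjH2 {β : ℝ} (hβ : 0 ≤ β) (v : H2) : H2 :=
  ⟨WithLp.toLp 2 fun a => weightM hβ (conjJet β v a),
    fun i => (hasWeakPartial_gradL i v).weightM hβ,
    fun i j => (hasWeakPartial_conjJet β v i j).weightM hβ⟩

section Operator

variable {A : E3 → E3} {divA V : E3 → ℝ} (h : Admissible A divA V) {β : ℝ} (hβ : 0 ≤ β) (v : H2)

theorem incl_conjH2 : incl (conjH2 hβ v) = weightM hβ (incl v) := rfl

theorem gradL_conjH2 (i : Fin 3) :
    gradL i (conjH2 hβ v) = weightM hβ (gradL i v - (β : ℂ) • slopeM i (incl v)) := rfl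

theorem hessL_conjH2 (i j : Fin 3) : hessL i j (conjH2 hβ v) = weightM hβ (hessL i j v -
    (β : ℂ) • (curvM i j (incl v) + slopeM i (gradL j v)) -
      (β : ℂ) • slopeM j (gradL i v - (β : ℂ) • slopeM i (incl v))) := rfl

/-- The part of `exp (β√(1+|x|²)) H exp (-β√(1+|x|²)) - H` of first order in `β`. -/
def tiltOne : H2 →L[ℂ] L2 := ∑ i, ((2 : ℂ) • slopeM i ∘L gradL i + curvM i i ∘L incl -
  (2 * Complex.I) • slopeM i ∘L coordOp h i)

/-- The part of `exp (β√(1+|x|²)) H exp (-β√(1+|x|²)) - H` of second order in `β`. -/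
def tiltTwo : H2 →L[ℂ] L2 := - ∑ i, slopeM i ∘L slopeM i ∘L incl

/-- The operator `exp (β√(1+|x|²)) H exp (-β√(1+|x|²)) - H`. -/
def tilt (β : ℝ) : H2 →L[ℂ] L2 := (β : ℂ) • tiltOne h + ((β : ℂ) ^ 2) • tiltTwo

/-- Multiplication operators commute with the weight. -/
theorem mulOp_conj {f : E3 → ℂ} {D : H2 →L[ℂ] L2} (hf : MulBdd f D) {w : L2}
    (hw : D (conjH2 hβ v) = weightM hβ w) {y : L2}
    (hy : (y : E3 → ℂ) =ᵐ[volume] fun x => f x * w x) :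
    mulOp f D hf (conjH2 hβ v) = weightM hβ y := by
  apply Lp.ext
  filter_upwards [coeFn_mulOp hf (conjH2 hβ v), coeFn_weightM hβ w, coeFn_weightM hβ y, hy]
    with x h1 h2 h3 h4
  rw [h1, hw, h2, h3, h4]
  ring

theorem advOp_conjH2 (j : Fin 3) : advOp h j (conjH2 hβ v) =
    weightM hβ (advOp h j v - (β : ℂ) • slopeM j (coordOp h j v)) := by
  refine mulOp_conj hβ v _ (gradL_conjH2 hβ v j) ?_
  filter_upwards [Lp.coeFn_sub (advOp h j v) ((β : ℂ) • slopeM j (coordOp h j v)),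
    Lp.coeFn_smul (β : ℂ) (slopeM j (coordOp h j v)), Lp.coeFn_sub (gradL j v)
    ((β : ℂ) • slopeM j (incl v)), Lp.coeFn_smul (β : ℂ) (slopeM j (incl v)),
    coeFn_mulReal (memLp_top_ofReal (contDiff_slope one_ne_zero j).continuous
      (abs_slope_le 1 j)) (incl v), coeFn_mulReal (memLp_top_ofReal
      (contDiff_slope one_ne_zero j).continuous (abs_slope_le 1 j)) (coordOp h j v),
    coeFn_mulOp (h.mulBdd_grad j j) v, coeFn_mulOp (h.mulBdd_incl j) v]
    with x h1 h2 h3 h4 h5 h6 h7 h8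
  rw [h1, Pi.sub_apply, h2, Pi.smul_apply, h3, Pi.sub_apply, h4, Pi.smul_apply, slopeM, h5, h6,
    advOp, h7, coordOp, h8, smul_eq_mul, smul_eq_mul]
  ring

/-- The Leibniz rule for the magnetic Schrödinger operator and an exponential weight. -/
theorem magOp_conjH2 : magOp h (conjH2 hβ v) = weightM hβ (magOp h v + tilt h β v) := by
  have h1 : divOp h (conjH2 hβ v) = weightM hβ (divOp h v) :=
    mulOp_conj hβ v _ (incl_conjH2 hβ v) (coeFn_mulOp h.divA_mem.mulBdd v)
  have h2 : potOp h (conjH2 hβ v) = weightM hβ (potOp h v) :=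
    mulOp_conj hβ v _ (incl_conjH2 hβ v) (coeFn_mulOp h.V_mem.mulBdd v)
  have e : ∀ w, magOp h w = (2 * Complex.I) • (∑ j, advOp h j w) + Complex.I • divOp h w +
      potOp h w - ∑ j, hessL j j w := fun w => by simp [magOp, lowerOp, lapL]
  have e1 : tilt h β v = (β : ℂ) • ∑ i, ((2 : ℂ) • slopeM i (gradL i v) + curvM i i (incl v) -
      (2 * Complex.I) • slopeM i (coordOp h i v)) -
      ((β : ℂ) ^ 2) • ∑ i, slopeM i (slopeM i (incl v)) := by
    simp [tilt, tiltOne, tiltTwo, sub_eq_add_neg]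
  rw [e, e v, h1, h2, e1]
  simp only [advOp_conjH2, hessL_conjH2, ← map_sum, ← map_smul, ← map_add, ← map_sub]
  congr 1
  simp only [map_sub, map_smul, Fin.sum_univ_three]
  module

theorem mulCLM_weightM {m : E3 → ℂ} (hm : MemLp m ⊤ volume) (u : L2) :
    mulCLM m hm (weightM hβ u) = weightM hβ (mulCLM m hm u) := by
  apply Lp.ext
  filter_upwards [coeFn_mulCLM hm (weightM hβ u), coeFn_weightM hβ u,
    coeFn_weightM hβ (mulCLM m hm u), coeFn_mulCLM hm u] with x h1 h2 h3 h4
  rw [h1, h2, h3, h4]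
  ring

theorem mulSup_weightM (m : Lp ℂ ⊤ (volume : Measure E3)) (u : L2) :
    mulSup m (weightM hβ u) = weightM hβ (mulSup m u) := by
  apply Lp.ext
  filter_upwards [coeFn_mulSup m (weightM hβ u), coeFn_weightM hβ u,
    coeFn_weightM hβ (mulSup m u), coeFn_mulSup m u] with x h1 h2 h3 h4
  rw [h1, h2, h3, h4]
  ring

/-- The operator `H + W 1_{|x| < R} - E + σ ρ` with a bounded potential `ρ`, written as a
perturbation of `wellOp`. -/
def stateOp (e₀ W R E σ : ℝ) (ρ : Lp ℂ ⊤ (volume : Measure E3)) : H2 →L[ℂ] L2 :=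
  wellOp h e₀ W R + (((e₀ - E : ℝ) : ℂ) • incl + (σ : ℂ) • mulSup ρ ∘L incl)

theorem stateOp_apply (e₀ W R E σ : ℝ) (ρ : Lp ℂ ⊤ (volume : Measure E3)) :
    stateOp h e₀ W R E σ ρ v = magOp h v + ballCLM W R (incl v) - (E : ℂ) • incl v +
      (σ : ℂ) • mulSup ρ (incl v) := by
  have : stateOp h e₀ W R E σ ρ v = wellOp h e₀ W R v +
    (((e₀ - E : ℝ) : ℂ) • incl v + (σ : ℂ) • mulSup ρ (incl v)) := rfl
  rw [this, wellOp_apply]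
  push_cast
  module

theorem stateOp_conjH2 (e₀ W R E σ : ℝ) (ρ : Lp ℂ ⊤ (volume : Measure E3)) :
    stateOp h e₀ W R E σ ρ (conjH2 hβ v) =
      weightM hβ (stateOp h e₀ W R E σ ρ v + tilt h β v) := by
  rw [stateOp_apply, stateOp_apply, magOp_conjH2, incl_conjH2, ballCLM, mulCLM_weightM,
    mulSup_weightM]
  simp only [map_add, map_sub, map_smul]
  abel

/-- A function supported in a ball is in the range of the multiplication by the weight. -/
theorem exists_weightM_eq_ballCLM (W R : ℝ) (u : L2) :
    ∃ f : L2, weightM hβ f = ballCLM W R u := by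
  have hm : MemLp ((Metric.ball (0 : E3) R).indicator fun x => ((W * (weight β x)⁻¹ : ℝ) : ℂ)) ⊤
      volume := by
    have hc : Continuous fun x => ((W * (weight β x)⁻¹ : ℝ) : ℂ) :=
      Complex.continuous_ofReal.comp (continuous_const.mul
        ((contDiff_weight β).continuous.inv₀ fun x => (Real.exp_pos _).ne'))
    obtain ⟨C, hC⟩ := (isCompact_closedBall (0 : E3) R).exists_bound_of_continuousOn hc.continuousOn
    refine memLp_top_of_bound
      (hc.aestronglyMeasurable.indicator Metric.isOpen_ball.measurableSet) (max C 0)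
      (ae_of_all _ fun x => ?_)
    by_cases hx : x ∈ Metric.ball (0 : E3) R
    · rw [indicator_of_mem hx]
      exact (hC x (Metric.ball_subset_closedBall hx)).trans (le_max_left _ _)
    · rw [indicator_of_notMem hx, norm_zero]
      exact le_max_right _ _
  refine ⟨mulCLM _ hm u, ?_⟩
  apply Lp.ext
  filter_upwards [coeFn_weightM hβ (mulCLM _ hm u), coeFn_mulCLM hm u, coeFn_ballCLM W R u]
    with x h1 h2 h3
  rw [h1, h2, h3]
  by_cases hx : x ∈ Metric.ball (0 : E3) R
  · have : (weight β x : ℂ) ≠ 0 := by exact_mod_cast (Real.exp_pos _).ne'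
    simp only [indicator_of_mem hx]
    push_cast
    field_simp
  · simp [hx]

end Operator

/-! ### Exponential decay of the bound states -/

section Operator

variable {A : E3 → E3} {divA V : E3 → ℝ}

/-- A bound state close to the linear one is an element of `H²` times a decaying exponential
weight. The rate `β` does not depend on the bound state. -/
theorem exists_conjH2_eq (h : Admissible A divA V) {e₀ : ℝ} (he₀ : e₀ < 0) (σ : ℝ) :
    ∃ (β : ℝ) (hβ : 0 < β) (r : ℝ), 0 < r ∧ ∀ (u : H2) (E : ℝ), |E - e₀| < r → ‖density u‖ < r →
      magOp h u + (σ : ℂ) • cubic u = (E : ℂ) • incl u → ∃ v : H2, u = conjH2 hβ.le v := by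
  obtain ⟨W, R, T, hT⟩ := exists_wellOp_equiv h he₀
  obtain ⟨C, hC0, hC⟩ := (T.symm : L2 →L[ℂ] H2).bound
  have hTb : ∀ u, ‖u‖ ≤ C * ‖T u‖ := by
    intro u
    simpa using hC (T u)
  obtain ⟨M₁, hM₁, h1⟩ := (tiltOne h).bound
  obtain ⟨M₂, hM₂, h2⟩ := (tiltTwo).bound
  -- the two perturbations are each of relative size less than `1 / 2`
  set β : ℝ := min 1 (1 / (2 * (C + 1) * (M₁ + M₂))) with hβ
  have hβ0 : 0 < β := by positivity
  have htilt : ∀ u, ‖tilt h β u‖ ≤ 1 / (2 * (C + 1)) * ‖u‖ := by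
    intro u
    have e : tilt h β u = (β : ℂ) • tiltOne h u + ((β : ℂ) ^ 2) • tiltTwo u := rfl
    rw [e]
    refine (norm_add_le _ _).trans ?_
    rw [norm_smul, norm_smul, norm_pow, Complex.norm_real, Real.norm_of_nonneg hβ0.le]
    have a1 : β ^ 2 ≤ β := by nlinarith [min_le_left 1 (1 / (2 * (C + 1) * (M₁ + M₂)))]
    have a2 : β * (M₁ + M₂) ≤ 1 / (2 * (C + 1)) := by
      refine (mul_le_mul_of_nonneg_right (min_le_right _ _) (by positivity)).trans_eq ?_
      field_simp
    calc β * ‖tiltOne h u‖ + β ^ 2 * ‖tiltTwo u‖ ≤ β * (M₁ * ‖u‖) + β * (M₂ * ‖u‖) := by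
          gcongr
          · exact h1 u
          · exact h2 u
      _ = β * (M₁ + M₂) * ‖u‖ := by ring
      _ ≤ _ := by gcongr
  set D : ℝ := 1 + |σ| * ‖mulSup‖ with hD
  have hD0 : 0 < D := by positivity
  set r : ℝ := 1 / (2 * (C + 1) * D) with hr
  have hr0 : 0 < r := by positivity
  refine ⟨β, hβ0, r, hr0, fun u E hE hu heq => ?_⟩
  set P : H2 →L[ℂ] L2 := ((e₀ - E : ℝ) : ℂ) • incl + (σ : ℂ) • mulSup (density u) ∘L incl with hP
  have hPb : ∀ w, ‖P w‖ ≤ 1 / (2 * (C + 1)) * ‖w‖ := by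
    intro w
    have e : P w = ((e₀ - E : ℝ) : ℂ) • incl w + (σ : ℂ) • mulSup (density u) (incl w) := rfl
    rw [e]
    refine (norm_add_le _ _).trans ?_
    rw [norm_smul, norm_smul, Complex.norm_real, Complex.norm_real, Real.norm_eq_abs,
      Real.norm_eq_abs, abs_sub_comm]
    have a1 := mulSup.le_opNorm₂ (density u) (incl w)
    calc |E - e₀| * ‖incl w‖ + |σ| * ‖mulSup (density u) (incl w)‖
        ≤ r * ‖w‖ + |σ| * (‖mulSup‖ * r * ‖w‖) := by
          gcongr
          · exact norm_incl_le w
          · refine a1.trans ?_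
            gcongr
            exact norm_incl_le w
      _ = r * D * ‖w‖ := by rw [hD]; ring
      _ = _ := by rw [hr]; field_simp
  have hsmall : C * (1 / (2 * (C + 1)) + 1 / (2 * (C + 1))) < 1 := by
    have : C * (1 / (2 * (C + 1)) + 1 / (2 * (C + 1))) = C / (C + 1) := by field_simp; ring
    rw [this, div_lt_one (by positivity)]
    linarith
  have hpos : 0 < 1 / (2 * (C + 1)) := by positivity
  -- `S` is the operator `stateOp` of the bound state, `S'` its conjugate by the weight
  obtain ⟨S, hS⟩ := exists_equiv_add_of_bound T P hTb hC0.le hpos.le hPb (by nlinarith)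
  obtain ⟨S', hS'⟩ := exists_equiv_add_of_bound T (P + tilt h β) hTb hC0.le (by positivity)
    (fun w => (norm_add_le (P w) (tilt h β w)).trans
      ((add_le_add (hPb w) (htilt w)).trans_eq (add_mul _ _ _).symm)) hsmall
  have hSa : ∀ w, S w = stateOp h e₀ W R E σ (density u) w := fun w => by
    have := congrArg (fun L : H2 →L[ℂ] L2 => L w) hS
    rw [hT] at this
    exact this
  have hSa' : ∀ w, S' w = stateOp h e₀ W R E σ (density u) w + tilt h β w := fun w => by
    have := congrArg (fun L : H2 →L[ℂ] L2 => L w) hS'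
    rw [hT, ← add_assoc] at this
    exact this
  -- the equation reads `S u = W 1_{|x| < R} u`, and the right-hand side is `f` times the weight
  obtain ⟨f, hf⟩ := exists_weightM_eq_ballCLM hβ0.le W R (incl u)
  refine ⟨S'.symm f, S.injective ?_⟩
  rw [hSa, hSa, stateOp_conjH2, ← hSa', S'.apply_symm_apply, hf, stateOp_apply]
  have h1 : mulSup (density u) (incl u) = cubic u := rfl
  rw [h1, ← heq]
  abel

end Operator

/-! ### From the smooth weight to the weight `exp (-β |x|)` -/

/-- The factor `exp (β √(a² + |x|²) - β √(1 + |x|²))`, which for `a = 0` is the product of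
`exp (β |x|)` with the smooth weight. It is bounded by one for `0 ≤ a ≤ 1`. -/
def ratio (β a : ℝ) (x : E3) : ℝ := Real.exp (β * (smoothAbs a x - smoothAbs 1 x))

theorem ratio_le_one {β a : ℝ} (hβ : 0 ≤ β) (ha : 0 ≤ a) (ha1 : a ≤ 1) (x : E3) :
    |ratio β a x| ≤ 1 := by
  rw [ratio, abs_of_pos (Real.exp_pos _), Real.exp_le_one_iff]
  exact mul_nonpos_of_nonneg_of_nonpos hβ (sub_nonpos.2 (smoothAbs_mono ha ha1 x))

theorem contDiff_ratio {β a : ℝ} (ha : a ≠ 0) : ContDiff ℝ (⊤ : ℕ∞) (ratio β a) :=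
  (contDiff_const.mul ((contDiff_smoothAbs ha).sub (contDiff_smoothAbs one_ne_zero))).exp

theorem continuous_smoothAbs (a : ℝ) : Continuous (smoothAbs a) := by
  unfold smoothAbs; fun_prop

theorem continuous_ratio (β a : ℝ) : Continuous (ratio β a) := by
  have := continuous_smoothAbs a
  have := continuous_smoothAbs 1
  unfold ratio; fun_prop

theorem measurable_slope (a : ℝ) (j : Fin 3) : Measurable (slope a j) := by
  have h1 : Measurable fun x : E3 => x j := (EuclideanSpace.proj (𝕜 := ℝ) j).continuous.measurable
  exact h1.div (continuous_smoothAbs a).measurable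

theorem fderiv_ratio {β a : ℝ} (ha : a ≠ 0) (x : E3) (j : Fin 3) :
    fderiv ℝ (ratio β a) x (basisVec j) = β * (slope a j x - slope 1 j x) * ratio β a x := by
  have h1 := (((hasFDerivAt_smoothAbs ha x).fun_sub
    (hasFDerivAt_smoothAbs one_ne_zero x)).const_mul β).exp
  have h3 : fderiv ℝ (ratio β a) x = _ := h1.fderiv
  rw [h3]
  simp only [smul_apply, sub_apply, innerSL_apply_apply, inner_basisVec, smul_eq_mul, slope, ratio]
  ring

theorem tendsto_smoothAbs (x : E3) :
    Tendsto (fun a => smoothAbs a x) (𝓝 0) (𝓝 (smoothAbs 0 x)) := by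
  have : Continuous fun a => smoothAbs a x := by unfold smoothAbs; fun_prop
  exact this.tendsto 0

theorem tendsto_ratio (β : ℝ) (x : E3) :
    Tendsto (fun a => ratio β a x) (𝓝 0) (𝓝 (ratio β 0 x)) :=
  (Real.continuous_exp.tendsto _).comp
    (((tendsto_smoothAbs x).sub tendsto_const_nhds).const_mul β)

theorem tendsto_slope (x : E3) (j : Fin 3) :
    Tendsto (fun a => slope a j x) (𝓝 0) (𝓝 (slope 0 j x)) := by
  rcases eq_or_ne x 0 with rfl | hx
  · simp [slope]
  · refine tendsto_const_nhds.div (tendsto_smoothAbs x) ?_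
    exact ((norm_pos_iff.2 hx).trans_le (norm_le_smoothAbs 0 x)).ne'

/-- The Leibniz rule for the Lipschitz factor `ratio β 0`, by smooth approximation. -/
theorem HasWeakPartial.ratio_smul {j : Fin 3} {u v : E3 → ℂ} (h : HasWeakPartial j u v) {β : ℝ}
    (hβ : 0 ≤ β) : HasWeakPartial j (fun x => ratio β 0 x • u x)
      (fun x => (β * (slope 0 j x - slope 1 j x) * ratio β 0 x) • u x + ratio β 0 x • v x) := by
  have hm : Measurable fun x => β * (slope 0 j x - slope 1 j x) * ratio β 0 x :=
    (((measurable_slope 0 j).sub (measurable_slope 1 j)).const_mul β).mul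
      (continuous_ratio β 0).measurable
  have hb : ∀ a : ℝ, 0 ≤ a → a ≤ 1 → ∀ x,
      |β * (slope a j x - slope 1 j x) * ratio β a x| ≤ 2 * β := by
    intro a ha ha1 x
    rw [abs_mul, abs_mul, abs_of_nonneg hβ]
    have h1 : |slope a j x - slope 1 j x| ≤ 2 :=
      (abs_sub _ _).trans (by linarith [abs_slope_le a j x, abs_slope_le 1 j x])
    calc β * |slope a j x - slope 1 j x| * |ratio β a x| ≤ β * 2 * 1 := by
          gcongr
          exact ratio_le_one hβ ha ha1 x
      _ = 2 * β := by ring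
  have l1 : LocallyIntegrable (fun x => ratio β 0 x • u x) volume :=
    h.1.continuous_smul (continuous_ratio β 0)
  have l3 : LocallyIntegrable (fun x => ratio β 0 x • v x) volume :=
    h.2.1.continuous_smul (continuous_ratio β 0)
  have l2 : LocallyIntegrable (fun x => (β * (slope 0 j x - slope 1 j x) * ratio β 0 x) • u x)
      volume := by
    refine (h.1.smul (2 * β)).mono (hm.aestronglyMeasurable.smul h.1.aestronglyMeasurable)
      (ae_of_all _ fun x => ?_)
    rw [Pi.smul_apply, norm_smul, norm_smul, Real.norm_eq_abs, Real.norm_of_nonneg (by positivity)]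
    gcongr
    exact hb 0 le_rfl zero_le_one x
  refine ⟨l1, l2.add l3, fun η hη hc => ?_⟩
  -- the smooth factors `ratio β a` with `a = 1 / (n + 1)`
  have hlim : Tendsto (fun n : ℕ => 1 / ((n : ℝ) + 1)) atTop (𝓝 0) :=
    tendsto_one_div_add_atTop_nhds_zero_nat
  have ha0 : ∀ n : ℕ, 0 < 1 / ((n : ℝ) + 1) := fun n => by positivity
  have ha1 : ∀ n : ℕ, 1 / ((n : ℝ) + 1) ≤ 1 := fun n => by
    rw [div_le_one (by positivity)]
    linarith [n.cast_nonneg (α := ℝ)]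
  have hn : ∀ n : ℕ, _ := fun n =>
    (h.smooth_smul (contDiff_ratio (β := β) (ha0 n).ne')).2.2 η hη hc
  have i1 := integrable_fderiv_smul hη hc (basisVec j) h.1
  have i2 := (h.1.integrable_smul_left_of_hasCompactSupport hη.continuous hc)
  have i3 := (h.2.1.integrable_smul_left_of_hasCompactSupport hη.continuous hc)
  have t1 : Tendsto (fun n : ℕ => ∫ x, fderiv ℝ η x (basisVec j) •
      ratio β (1 / ((n : ℝ) + 1)) x • u x) atTop
      (𝓝 (∫ x, fderiv ℝ η x (basisVec j) • ratio β 0 x • u x)) := by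
    refine tendsto_integral_of_dominated_convergence _ (fun n => ?_) i1.norm
      (fun n => ae_of_all _ fun x => ?_) (ae_of_all _ fun x => ?_)
    · exact (integrable_fderiv_smul hη hc (basisVec j)
        (h.1.continuous_smul (continuous_ratio β _))).aestronglyMeasurable
    · rw [smul_comm, norm_smul]
      exact mul_le_of_le_one_left (norm_nonneg _) (ratio_le_one hβ (ha0 n).le (ha1 n) x)
    · exact tendsto_const_nhds.smul (((tendsto_ratio β x).comp hlim).smul tendsto_const_nhds)
  have t2 : Tendsto (fun n : ℕ => ∫ x, η x •
      (fderiv ℝ (ratio β (1 / ((n : ℝ) + 1))) x (basisVec j) • u x +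
        ratio β (1 / ((n : ℝ) + 1)) x • v x)) atTop
      (𝓝 (∫ x, η x • ((β * (slope 0 j x - slope 1 j x) * ratio β 0 x) • u x +
        ratio β 0 x • v x))) := by
    refine tendsto_integral_of_dominated_convergence _ (fun n => ?_)
      ((i2.norm.const_mul (2 * β)).add i3.norm)
      (fun n => ae_of_all _ fun x => ?_) (ae_of_all _ fun x => ?_)
    · exact ((h.smooth_smul (contDiff_ratio (β := β) (ha0 n).ne')).2.1
        |>.integrable_smul_left_of_hasCompactSupport hη.continuous hc).aestronglyMeasurable
    · rw [smul_add, smul_comm, smul_comm (η x) (ratio _ _ _), fderiv_ratio (ha0 n).ne']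
      refine (norm_add_le _ _).trans (add_le_add ?_ ?_)
      · rw [norm_smul]
        exact mul_le_mul_of_nonneg_right (hb _ (ha0 n).le (ha1 n) x) (norm_nonneg _)
      · rw [norm_smul]
        exact mul_le_of_le_one_left (norm_nonneg _) (ratio_le_one hβ (ha0 n).le (ha1 n) x)
    · simp only [fderiv_ratio (ha0 _).ne']
      refine tendsto_const_nhds.smul (Tendsto.add (Tendsto.smul ?_ tendsto_const_nhds)
        (((tendsto_ratio β x).comp hlim).smul tendsto_const_nhds))
      exact ((((tendsto_slope x j).comp hlim).sub tendsto_const_nhds).const_mul β).mul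
        ((tendsto_ratio β x).comp hlim)
  simp only [hn] at t1
  exact tendsto_nhds_unique t1 t2.neg

theorem memLp_smul_of_bound {g : E3 → ℝ} (hg : Measurable g) {C : ℝ} (hC : ∀ x, |g x| ≤ C)
    {p : ℝ≥0∞} {u : E3 → ℂ} (hu : MemLp u p volume) : MemLp (fun x => g x • u x) p volume :=
  hu.of_le_mul (hg.aestronglyMeasurable.smul hu.1) (ae_of_all _ fun x => by
    rw [norm_smul]
    exact mul_le_mul_of_nonneg_right (hC x) (norm_nonneg _))

theorem ratio_mul_weight (β : ℝ) (x : E3) :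
    ratio β 0 x = Real.exp (β * ‖x‖) * weight β x := by
  have : smoothAbs 0 x = ‖x‖ := by simp [smoothAbs]
  rw [ratio, weight, ← Real.exp_add, this]
  congr 1
  ring

/-- Multiplying `conjH2 v` by `exp (β |x|)` leaves `v` times a bounded Lipschitz factor. -/
theorem exp_mul_conjH2 {β : ℝ} (hβ : 0 ≤ β) (v : H2) :
    (fun x => ratio β 0 x • incl v x) =ᵐ[volume]
      fun x => (Real.exp (β * ‖x‖) : ℂ) * (conjH2 hβ v).fn x := by
  filter_upwards [coeFn_weightM hβ (incl v)] with x hx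
  have : (conjH2 hβ v).fn x = weightM hβ (incl v) x := rfl
  rw [this, hx, ratio_mul_weight, Complex.real_smul]
  push_cast
  ring

theorem memLp_top_exp_mul_conjH2 {β : ℝ} (hβ : 0 ≤ β) (v : H2) :
    MemLp (fun x => (Real.exp (β * ‖x‖) : ℂ) * (conjH2 hβ v).fn x) ⊤ volume :=
  (memLp_congr_ae (exp_mul_conjH2 hβ v)).1 (memLp_smul_of_bound (continuous_ratio β 0).measurable
    (ratio_le_one hβ le_rfl zero_le_one) (memLp_top_incl v))

theorem memH1_exp_mul_conjH2 {β : ℝ} (hβ : 0 ≤ β) (v : H2) :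
    MemH1 (fun x => (Real.exp (β * ‖x‖) : ℂ) * (conjH2 hβ v).fn x) := by
  have hr := fun {p : ℝ≥0∞} {u : E3 → ℂ} => memLp_smul_of_bound (p := p) (u := u)
    (continuous_ratio β 0).measurable (ratio_le_one hβ le_rfl zero_le_one)
  refine ⟨(memLp_congr_ae (exp_mul_conjH2 hβ v)).1 (hr (Lp.memLp _)), fun j => ?_⟩
  refine ⟨_, ?_, ((hasWeakPartial_gradL j v).ratio_smul hβ).congr (exp_mul_conjH2 hβ v)
    EventuallyEq.rfl⟩
  refine MemLp.add ?_ (hr (Lp.memLp _))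
  refine memLp_smul_of_bound (C := β * 2 * 1) ?_ (fun x => ?_) (Lp.memLp _)
  · exact (((measurable_slope 0 j).sub (measurable_slope 1 j)).const_mul β).mul
      (continuous_ratio β 0).measurable
  · rw [abs_mul, abs_mul, abs_of_nonneg hβ]
    gcongr
    · exact (abs_sub _ _).trans (by linarith [abs_slope_le 0 j x, abs_slope_le 1 j x])
    · exact ratio_le_one hβ le_rfl zero_le_one x

end

end MagneticNLS

theorem lemma1
    (A : E3 → E3) (divA V : E3 → ℝ)
    (hSA : SelfAdjointAssumption A divA V)
    (hDecay : DecayAssumption A V)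
    -- the sign of the nonlinearity `g(ψ) = σ |ψ|² ψ`
    (σ : ℝ) (hσ : σ = 1 ∨ σ = -1)
    -- a nondegenerate eigenvalue `e₀ < 0` of `H` with `L²`-normalized eigenfunction `φ₀`
    (e₀ : ℝ) (he₀ : e₀ < 0) (φ₀ : H2)
    (hnorm : ‖φ₀.toL2‖ = 1)
    (heig : magH A divA V φ₀ =ᵐ[volume] fun x => (e₀ : ℂ) * φ₀.fn x)
    (hnondeg : ∀ ψ : H2, (magH A divA V ψ =ᵐ[volume] fun x => (e₀ : ℂ) * ψ.fn x) →
      ∃ c : ℂ, ψ = c • φ₀) :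
    ∃ (δ β : ℝ) (Q : ℂ → H2) (E : ℂ → ℝ), 0 < δ ∧ 0 < β ∧
      -- `H Q + g(Q) = E Q`, with `Q[z]` nontrivial for `z ≠ 0`
      (∀ z ∈ Metric.ball (0 : ℂ) δ,
        (fun x => magH A divA V (Q z) x + (σ : ℂ) * (‖(Q z).fn x‖ : ℂ) ^ 2 * (Q z).fn x)
          =ᵐ[volume] fun x => (E z : ℂ) * (Q z).fn x) ∧
      (∀ z ∈ Metric.ball (0 : ℂ) δ, z ≠ 0 → Q z ≠ 0) ∧
      -- `E[z] = e₀ + o(z)` and `q(z) = Q[z] - z φ₀ = o(z²)` in `H²`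
      (fun z => E z - e₀) =o[𝓝 0] (fun z : ℂ => z) ∧
      (fun z => Q z - z • φ₀) =o[𝓝 0] (fun z : ℂ => z ^ 2) ∧
      -- `Q` is twice differentiable in `z`, `DQ[z] = (1, i) φ₀ + o(z)` and `D²Q[z] = o(1)` in `H²`
      ContDiffOn ℝ 2 Q (Metric.ball 0 δ) ∧
      (∀ k : Fin 2, (fun z => DQ k Q z - dir k • φ₀) =o[𝓝 0] (fun z : ℂ => z)) ∧
      (∀ k l : Fin 2, Tendsto (fun z => DQ k (DQ l Q) z) (𝓝 0) (𝓝 0)) ∧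
      -- exponential decay, with a rate independent of `z`
      (∀ z ∈ Metric.ball (0 : ℂ) δ,
        MemH1 (fun x => (Real.exp (β * ‖x‖) : ℂ) * (Q z).fn x) ∧
        MemLp (fun x => (Real.exp (β * ‖x‖) : ℂ) * (Q z).fn x) ⊤ volume) := by
  have hadm := admissible_of_assumptions hSA hDecay
  -- equations between functions almost everywhere become equations in `L²`
  have hiff : ∀ (u : H2) (c : ℂ), (magH A divA V u =ᵐ[volume] fun x => c * u.fn x) ↔
      magOp hadm u = c • incl u := by
    intro u c
    have h1 : ((c • incl u : L2) : E3 → ℂ) =ᵐ[volume] fun x => c * u.fn x :=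
      Lp.coeFn_smul c (incl u)
    refine ⟨fun h => Lp.ext ((coeFn_magOp hadm u).trans (h.trans h1.symm)), fun h => ?_⟩
    rw [← h] at h1
    exact (coeFn_magOp hadm u).symm.trans h1
  have hs : SimpleEigenvalue hadm e₀ φ₀ :=
    ⟨hnorm, (hiff _ _).1 heig, fun ψ hψ => hnondeg ψ ((hiff _ _).2 hψ)⟩
  obtain ⟨β, hβ, r, hr, hdecay⟩ := exists_conjH2_eq hadm he₀ σ
  obtain ⟨F, E, hF, hF0, hE, hperp, heq⟩ := hs.exists_bound_states he₀ σ
  have hQ : ContDiffAt ℝ 2 (fun z : ℂ => z • (φ₀ + F z)) 0 := contDiffAt_smul_add φ₀ hF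
  -- the smallness needed for the decay estimate holds near `z = 0`
  have hdens : ∀ᶠ z in 𝓝 (0 : ℂ), ‖density (z • (φ₀ + F z))‖ < r := by
    have h1 : ContinuousAt (fun z : ℂ => ‖density (z • (φ₀ + F z))‖) 0 :=
      (contDiff_density.continuous.norm.continuousAt).comp hQ.continuousAt
    refine h1.eventually_lt continuousAt_const ?_
    simpa [density] using hr
  have hEr : ∀ᶠ z in 𝓝 (0 : ℂ), |E z - e₀| < r := by
    have h1 : Tendsto (fun z => E z - e₀) (𝓝 0) (𝓝 0) := hE.trans_tendsto tendsto_id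
    have h2 : Tendsto (fun z => |E z - e₀|) (𝓝 0) (𝓝 0) := by simpa using h1.abs
    exact h2.eventually_lt_const hr
  obtain ⟨δ, hδ, hball⟩ := Metric.eventually_nhds_iff_ball.1
    (((heq.and (hQ.eventually (by simp))).and hdens).and hEr)
  refine ⟨δ, β, fun z => z • (φ₀ + F z), E, hδ, hβ, fun z hz => ?_,
    fun z _ hz0 => hs.ne_zero_of_coeff hz0 (hperp z), hE, isLittleO_smul_add φ₀ hF0,
    fun z hz => (hball z hz).1.1.2.contDiffWithinAt,
    fun k => isLittleO_lineDeriv_smul_add φ₀ hF hF0 (dir k),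
    fun k l => tendsto_lineDeriv_lineDeriv_smul_add φ₀ hF hF0 (dir l) (dir k), fun z hz => ?_⟩
  · have h1 := (hball z hz).1.1.1
    filter_upwards [coeFn_magOp hadm (z • (φ₀ + F z)), coeFn_cubic (z • (φ₀ + F z)),
      Lp.coeFn_add (magOp hadm (z • (φ₀ + F z))) ((σ : ℂ) • cubic (z • (φ₀ + F z))),
      Lp.coeFn_smul (σ : ℂ) (cubic (z • (φ₀ + F z))),
      Lp.coeFn_smul (E z : ℂ) (incl (z • (φ₀ + F z)))] with x e1 e2 e3 e4 e5
    rw [h1, e5, Pi.add_apply, e4, Pi.smul_apply, Pi.smul_apply, e1, e2, coeFn_incl] at e3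
    simp only [smul_eq_mul] at e3
    rw [e3]
    ring
  · obtain ⟨v, hv⟩ := hdecay _ _ (hball z hz).2 (hball z hz).1.2 (hball z hz).1.1.1
    dsimp only
    rw [hv]
    exact ⟨memH1_exp_mul_conjH2 hβ.le v, memLp_top_exp_mul_conjH2 hβ.le v⟩
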